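/- **Setting.** Let $H$ be a (real or complex) Hilbert space and let $A:D(A)\subset H\to H$ be a positive self-adjoint operator with compact resolvent such that $|Au|\ge\omega|u|$ on $D(A)$ for some $\omega>0$ (A1). For $k\in\mathbb N$ let $H_k=D(A^{k/2})$ with $|u|_k=|A^{k/2}u|$, and let $H_{-k}$ be its dual, with pivot space $H=H_0$ and norm $|A^{-k/2}\cdot|$. For $k\in\mathbb Z$ and $W=(w,w')$ put $e_k(W)=\frac12\big(|A^{k/2}w|^2+|A^{(k-1)/2}w'|^2\big)$. Solutions of $w''+Aw=f$ on $[0,T]$ are strong solutions: $w\in C([0,T];H_2)\cap C^1([0,T];H_1)\cap C^2([0,T];H)$, $f\in C([0,T];H)$. Let $n\ge2$ and let $C_{i,i-1},\Pi_i\in\mathcal L(H)$, $2\le i\le n$, satisfy for all $i$ (real parts of the scalar products being taken if $H$ is complex): * $(A2)_n$: $C_{i,i-1}^*\in\mathcal L(H_k)$ for $0\le k\le n-i+1$; $|C_{i,i-1}w|^2\le\|C_{i,i-1}\|\,\langle C_{i,i-1}w,w\rangle$ for all $w\in H$; and for some $\alpha_i>0$, $\alpha_i|\Pi_iw|^2\le\langle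 C_{i,i-1}w,w\rangle$ for all $w\in H$. * $(A3)_n$: there is $T_{0,i}>0$ such that for every $T>T_{0,i}$ there is $\gamma_i(T)>0$ with $\int_0^T|\Pi_iw'|^2dt\ge\gamma_i(T)\,e_1(W)(0)$ for all solutions of $w''+Aw=0$. Let $G_n$ be a Hilbert space (identified with its dual) and $\mathbf B_n^*\in\mathcal L(H_2\times H;G_n)$ satisfy: * $(A4)_n$: for every $T>0$ there is $D_n(T)>0$ such that for all solutions of $w''+Aw=f$, $\int_0^T\|\mathbf B_n^*(w,w')\|^2dt\le D_n(T)\big(e_1(W)(0)+e_1(W)(T)+\int_0^Te_1(W)dt+\int_0^T|f|^2dt\big)$. * $(A5)_n$: there is $T_{0,n}>0$ such that for every $T>T_{0,n}$ there is $R_n(T)>0$ with $\int_0^T\|\mathbf B_n^*(w,w')\|^2dt\ge R_n(T)\,e_1(W)(0)$ for all solutions of $w''+Aw=0$. Call $T_n^*>0$ an *observability time* if for every $T>T_n^*$ and $1\le i\le n$ there is $d_i(T)>0$ such that all strong solutions on $[0,T]$ of $$w_1''+Aw_1=0,\qquad w_i''+Aw_i+C_{i,i-1}w_{i-1}=0\quad(2\le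 i\le n)\tag{D}$$ satisfy $e_{1+i-n}(W_i)(0)\le d_i(T)\int_0^T\|\mathbf B_n^*(w_n,w_n')\|^2dt$. Consider the control system $$y_i''+Ay_i+C_{i+1,i}^*y_{i+1}=0\ (1\le i\le n-1),\quad y_n''+Ay_n=B_nv_n,\quad (y_i,y_i')(0)=(y_i^0,y_i^1)\ (1\le i\le n).\tag{C}$$ With state space $X=\prod_iH_{k_i}\times\prod_iH_{k_i-1}$, its solution (by transposition) on $[0,T]$ for $v_n\in L^2((0,T);G_n)$ is $Y=(y_1,\dots,y_n,y_1',\dots,y_n')\in C([0,T];X)$ with $y_i'$ the derivative of $y_i$, $Y(0)=Y_0$ and, for all strong solutions $W$ of (D) on $[0,T]$ and all $\tau\in[0,T]$, $$\int_0^\tau\langle v_n,B_n^*w_n\rangle_{G_n}dt=\sum_{k=1}^n\big(\langle y_k'(\tau),w_k(\tau)\rangle-\langle y_k(\tau),w_k'(\tau)\rangle\big)-\sum_{k=1}^n\big(\langle y_k^1,w_k(0)\rangle-\langle y_k^0,w_k'(0)\rangle\big).$$ **Theorem.** Assume (A1) and $(A2)_n$–$(A5)_n$. (i) Let $\mathbf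 B_n^*(w,w')=B_n^*w'$ with $B_n\in\mathcal L(G_n;H)$, and $X_{-(n-1)}^*=\prod_{i=1}^nH_{n-i+1}\times\prod_{i=1}^nH_{n-i}$. Then observability times exist, and for every observability time $T_n^*$, all $T>T_n^*$ and all $Y_0\in X_{-(n-1)}^*$ there is a control $v_n\in L^2((0,T);G_n)$ such that the system (C) has a solution in the state space $X_{-(n-1)}^*$ with initial data $Y_0$, and this solution satisfies $Y(T)=0$. (ii) Let $\mathbf B_n^*(w,w')=B_n^*w$ with $B_n\in\mathcal L(G_n;H_2')$, and $X_{(n-1)}^*=\prod_{i=1}^nH_{n-i}\times\prod_{i=1}^nH_{n-i-1}$. Then observability times exist, and for every observability time $T_n^*$, all $T>T_n^*$ and all $Y_0\in X_{(n-1)}^*$ there is a control $v_n\in L^2((0,T);G_n)$ such that the system (C) has a solution in the state space $X_{(n-1)}^*$ with initial data $Y_0$, and this solution satisfies $Y(T)=0$. -/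

import Mathlib

/-! Null controllability of cascades of second order equations governed by a positive self-adjoint
operator with compact resolvent. -/

namespace Cascade

open Set MeasureTheory
open scoped InnerProductSpace

universe v w

section Operator

variable {𝕜 : Type} {H : Type v} [RCLike 𝕜] [NormedAddCommGroup H] [InnerProductSpace 𝕜 H]
  [CompleteSpace H]

open Module.End in
/-- Spectral theorem: a compact symmetric operator has a Hilbert basis of eigenvectors. -/
theorem exists_eigenbasis (R : H →L[𝕜] H) (hc : IsCompactOperator R)
    (hs : (R : H →ₗ[𝕜] H).IsSymmetric) :
    ∃ (ι : Type v) (b : HilbertBasis ι 𝕜 H) (μ : ι → 𝕜), ∀ i, R (b i) = μ i • b i := by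
  have hV : OrthogonalFamily 𝕜 (fun μ : 𝕜 => eigenspace (R : H →ₗ[𝕜] H) μ)
      fun μ => (eigenspace (R : H →ₗ[𝕜] H) μ).subtypeₗᵢ := hs.orthogonalFamily_eigenspaces
  have hclosed : ∀ μ : 𝕜, CompleteSpace (eigenspace (R : H →ₗ[𝕜] H) μ) := by
    intro μ
    have : ((eigenspace (R : H →ₗ[𝕜] H) μ : Submodule 𝕜 H) : Set H) = {x | R x = μ • x} := by
      ext x; simp
    have : IsClosed ((eigenspace (R : H →ₗ[𝕜] H) μ : Submodule 𝕜 H) : Set H) := by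
      rw [this]
      exact isClosed_eq R.continuous (continuous_const_smul μ)
    exact this.completeSpace_coe
  choose w b hb using fun μ : 𝕜 => exists_hilbertBasis 𝕜 (eigenspace (R : H →ₗ[𝕜] H) μ)
  have ho := hV.orthonormal_sigma_orthonormal (fun μ => (b μ).orthonormal)
  have hbot : (Submodule.span 𝕜 (Set.range fun a : (Σ μ : 𝕜, w μ) =>
      (eigenspace (R : H →ₗ[𝕜] H) a.1).subtypeₗᵢ (b a.1 a.2)))ᗮ = ⊥ := by
    rw [Submodule.eq_bot_iff]
    intro x hx
    have h0 := ContinuousLinearMap.orthogonalComplement_iSup_eigenspaces_eq_bot hc hs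
    have : x ∈ (⨆ μ, eigenspace (R : Module.End 𝕜 H) μ)ᗮ := by
      rw [← Submodule.iInf_orthogonal, Submodule.mem_iInf]
      intro μ
      rw [Submodule.mem_orthogonal']
      intro u hu
      have hd' := ((b μ).hasSum_repr ⟨u, hu⟩).mapL
        ((innerSL 𝕜 x).comp (eigenspace (R : H →ₗ[𝕜] H) μ).subtypeL)
      have hz : ∀ i, ⟪x, ((b μ i : eigenspace (R : H →ₗ[𝕜] H) μ) : H)⟫_𝕜 = 0 := fun i =>
        (Submodule.mem_orthogonal' _ _).1 hx _ (Submodule.subset_span ⟨⟨μ, i⟩, rfl⟩)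
      simp only [ContinuousLinearMap.comp_apply, Submodule.subtypeL_apply, innerSL_apply_apply,
        Submodule.coe_smul, inner_smul_right, hz, mul_zero] at hd'
      exact hd'.unique hasSum_zero
    rw [h0] at this
    simpa using this
  refine ⟨Σ μ : 𝕜, w μ, HilbertBasis.mkOfOrthogonalEqBot ho hbot, fun a => a.1, ?_⟩
  intro a
  rw [HilbertBasis.coe_mkOfOrthogonalEqBot]
  exact mem_eigenspace_iff.1 (b a.1 a.2).2

/-- A compact positive operator has a positive square root. -/
theorem exists_sqrt (R : H →L[𝕜] H) (hc : IsCompactOperator R) (hp : R.IsPositive) :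
    ∃ S : H →L[𝕜] H, S.IsPositive ∧ S ∘L S = R := by
  obtain ⟨ι, b, μ, hμ⟩ := exists_eigenbasis R hc hp.isSymmetric
  have hn : ∀ i, ‖b i‖ = 1 := b.orthonormal.1
  have hμr : ∀ i, μ i = (RCLike.re (μ i) : 𝕜) ∧ 0 ≤ RCLike.re (μ i) := by
    intro i
    have h1 := hp.inner_nonneg_right (b i)
    rw [hμ, inner_smul_right, inner_self_eq_norm_sq_to_K, hn] at h1
    simp only [RCLike.ofReal_one, one_pow, mul_one] at h1
    exact ⟨(RCLike.conj_eq_iff_re.1 (RCLike.conj_eq_iff_im.2 (RCLike.nonneg_iff.1 h1).2)).symm,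
      (RCLike.nonneg_iff.1 h1).1⟩
  have hle : ∀ i, RCLike.re (μ i) ≤ ‖R‖ := by
    intro i
    have := R.le_opNorm (b i)
    rw [hμ, norm_smul, hn, mul_one, mul_one] at this
    exact (RCLike.re_le_norm _).trans this
  set c : ι → ℝ := fun i => √(RCLike.re (μ i)) with hcdef
  have hc0 : ∀ i, 0 ≤ c i := fun i => Real.sqrt_nonneg _
  have hcc : ∀ i, ((c i : 𝕜)) * (c i : 𝕜) = μ i := by
    intro i
    rw [← RCLike.ofReal_mul, hcdef]
    simp only [Real.mul_self_sqrt (hμr i).2]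
    exact (hμr i).1.symm
  have hcl : ∀ i, c i ^ 2 ≤ ‖R‖ := fun i => by
    simp only [hcdef, Real.sq_sqrt (hμr i).2]; exact hle i
  have hterm : ∀ (f : lp (fun _ : ι => 𝕜) 2) (i : ι), ‖(c i : 𝕜) * f i‖ ^ 2 ≤ ‖R‖ * ‖f i‖ ^ 2 := by
    intro f i
    rw [norm_mul, mul_pow, RCLike.norm_ofReal, sq_abs]
    exact mul_le_mul_of_nonneg_right (hcl i) (by positivity)
  have hsum : ∀ f : lp (fun _ : ι => 𝕜) 2, HasSum (fun i => ‖f i‖ ^ 2) (‖f‖ ^ 2) := by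
    intro f
    simpa using lp.hasSum_norm (p := 2) (by norm_num) f
  have hmem : ∀ f : lp (fun _ : ι => 𝕜) 2, Memℓp (fun i => (c i : 𝕜) * f i) 2 := by
    intro f
    rw [memℓp_gen_iff (by norm_num)]
    refine Summable.of_nonneg_of_le (fun i => by positivity) (fun i => ?_)
      ((hsum f).summable.mul_left ‖R‖)
    simpa using hterm f i
  let M : lp (fun _ : ι => 𝕜) 2 →ₗ[𝕜] lp (fun _ : ι => 𝕜) 2 :=
    { toFun := fun f => ⟨fun i => (c i : 𝕜) * f i, hmem f⟩
      map_add' := fun f g => by ext i; exact mul_add _ _ _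
      map_smul' := fun a f => by ext i; simp [mul_left_comm] }
  have hM : ∀ f i, M f i = (c i : 𝕜) * f i := fun f i => rfl
  let M' : lp (fun _ : ι => 𝕜) 2 →L[𝕜] lp (fun _ : ι => 𝕜) 2 := M.mkContinuous (√‖R‖) (by
    intro f
    refine abs_le_of_sq_le_sq' ?_ (by positivity) |>.2
    rw [mul_pow, Real.sq_sqrt (norm_nonneg _)]
    exact hasSum_le (fun i => hterm f i) (hsum (M f)) ((hsum f).mul_left _))
  have hM' : ∀ f i, M' f i = (c i : 𝕜) * f i := fun f i => rfl
  let S : H →L[𝕜] H := (b.repr.symm.toContinuousLinearEquiv : lp (fun _ : ι => 𝕜) 2 →L[𝕜] H) ∘L M' ∘L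
    (b.repr.toContinuousLinearEquiv : H →L[𝕜] lp (fun _ : ι => 𝕜) 2)
  have hS : ∀ x, S x = b.repr.symm (M' (b.repr x)) := fun x => rfl
  have hin : ∀ x y, ⟪S x, y⟫_𝕜 = ⟪M' (b.repr x), b.repr y⟫_𝕜 := by
    intro x y
    rw [hS, ← b.repr.inner_map_map, LinearIsometryEquiv.apply_symm_apply]
  refine ⟨S, ⟨?_, ?_⟩, ?_⟩
  · intro x y
    change ⟪S x, y⟫_𝕜 = ⟪x, S y⟫_𝕜
    rw [hin, ← inner_conj_symm x (S y), hin, inner_conj_symm, lp.inner_eq_tsum, lp.inner_eq_tsum]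
    refine tsum_congr fun i => ?_
    simp only [hM', RCLike.inner_apply, map_mul, RCLike.conj_ofReal]
    ring
  · intro x
    change 0 ≤ RCLike.re ⟪S x, x⟫_𝕜
    rw [hin]
    refine ((lp.hasSum_inner (𝕜 := 𝕜) (M' (b.repr x)) (b.repr x)).mapL
      (RCLike.reCLM (K := 𝕜))).nonneg fun i => ?_
    rw [RCLike.reCLM_apply]
    rw [hM', ← smul_eq_mul, inner_smul_left, RCLike.conj_ofReal, RCLike.re_ofReal_mul]
    exact mul_nonneg (hc0 i) inner_self_nonneg
  · have hRr : ∀ x i, b.repr (R x) i = μ i * b.repr x i := by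
      intro x i
      rw [b.repr_apply_apply, b.repr_apply_apply]
      have : ⟪b i, R x⟫_𝕜 = ⟪R (b i), x⟫_𝕜 := (hp.isSymmetric (b i) x).symm
      rw [this, hμ, inner_smul_left, (hμr i).1, RCLike.conj_ofReal]
    ext x
    apply b.repr.injective
    ext i
    rw [hRr, ContinuousLinearMap.comp_apply, hS, LinearIsometryEquiv.apply_symm_apply, hM', hS,
      LinearIsometryEquiv.apply_symm_apply, hM', ← mul_assoc, hcc]

variable (𝕜 H) in
/-- An unbounded positive self-adjoint operator `A : D(A) ⊆ H → H` with `|A u| ≥ ω |u|` for some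
`ω > 0` and with compact resolvent: `(A - z)⁻¹` is everywhere defined, bounded and compact for
some scalar `z`. -/
structure CoerciveOperator where
  toPMap : H →ₗ.[𝕜] H
  isSelfAdjoint : IsSelfAdjoint toPMap
  nonneg : ∀ u : toPMap.domain, 0 ≤ RCLike.re ⟪toPMap u, (u : H)⟫_𝕜
  bound : ∃ ω : ℝ, 0 < ω ∧ ∀ u : toPMap.domain, ω * ‖(u : H)‖ ≤ ‖toPMap u‖
  compact_resolvent : ∃ (z : 𝕜) (R : H →L[𝕜] H), IsCompactOperator R ∧
    (∀ x, ∃ h : R x ∈ toPMap.domain, toPMap ⟨R x, h⟩ - z • R x = x) ∧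
    ∀ u : toPMap.domain, R (toPMap u - z • (u : H)) = u

namespace CoerciveOperator

variable (A : CoerciveOperator 𝕜 H)

theorem eq_zero_of_map_eq_zero (u : A.toPMap.domain) (h : A.toPMap u = 0) : (u : H) = 0 := by
  obtain ⟨ω, hω, hb⟩ := A.bound
  have := hb u
  rw [h, norm_zero] at this
  exact norm_le_zero_iff.1 (nonpos_of_mul_nonpos_right this hω)

theorem eq_of_map_eq (u v : A.toPMap.domain) (h : A.toPMap u = A.toPMap v) : (u : H) = v := by
  have := A.eq_zero_of_map_eq_zero (u - v) (by rw [LinearPMap.map_sub, h, sub_self])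
  exact sub_eq_zero.1 this

theorem inner_map_left (u v : A.toPMap.domain) :
    ⟪A.toPMap u, (v : H)⟫_𝕜 = ⟪(u : H), A.toPMap v⟫_𝕜 := by
  have h := LinearPMap.adjoint_isFormalAdjoint A.isSelfAdjoint.dense_domain
  rw [LinearPMap.isSelfAdjoint_def.1 A.isSelfAdjoint] at h
  exact h u v

theorem exists_inv : ∃ R : H →L[𝕜] H, IsCompactOperator R ∧ R.IsPositive ∧
    ∀ x, ∃ h : R x ∈ A.toPMap.domain, A.toPMap ⟨R x, h⟩ = x := by
  have key : ∃ R : H →L[𝕜] H, IsCompactOperator R ∧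
      ∀ x, ∃ h : R x ∈ A.toPMap.domain, A.toPMap ⟨R x, h⟩ = x := by
    obtain ⟨z, R, hc, h1, -⟩ := A.compact_resolvent
    by_cases hz : z = 0
    · exact ⟨R, hc, fun x => by simpa [hz] using h1 x⟩
    have hz' : -z⁻¹ ≠ 0 := neg_ne_zero.2 (inv_ne_zero hz)
    rcases hc.hasEigenvalue_or_mem_resolventSet hz' with he | he
    · exfalso
      obtain ⟨x, hx⟩ := he.exists_hasEigenvector
      have hx1 : R x = -z⁻¹ • x := hx.apply_eq_smul
      obtain ⟨hd, hA⟩ := h1 x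
      have hx2 : z • R x = -x := by rw [hx1, smul_smul]; simp [hz]
      rw [hx2, sub_neg_eq_add, add_eq_right] at hA
      have h3 := A.eq_zero_of_map_eq_zero _ hA
      have h4 : R x = 0 := h3
      rw [h4, smul_zero] at hx2
      exact hx.2 (neg_eq_zero.1 hx2.symm)
    · obtain ⟨V, hV⟩ := (show IsUnit (algebraMap 𝕜 (H →L[𝕜] H) (-z⁻¹) - R) from he).exists_right_inv
      refine ⟨R ∘L (-z⁻¹ • V), hc.comp_clm _, fun x => ?_⟩
      obtain ⟨hd, hA⟩ := h1 ((-z⁻¹ • V) x)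
      refine ⟨hd, ?_⟩
      have hVx : -z⁻¹ • V x - R (V x) = x := by
        have := congrArg (fun L : H →L[𝕜] H => L x) hV
        simpa [Algebra.algebraMap_eq_smul_one] using this
      rw [sub_eq_iff_eq_add] at hA
      refine hA.trans ?_
      rw [smul_apply, map_smul, smul_smul]
      simp only [mul_neg, mul_inv_cancel₀ hz, neg_smul, one_smul]
      rw [← neg_smul, ← sub_eq_add_neg]
      exact hVx
  obtain ⟨R, hc, hR⟩ := key
  refine ⟨R, hc, ⟨fun x y => ?_, fun x => ?_⟩, hR⟩
  · obtain ⟨hx, hx'⟩ := hR x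
    obtain ⟨hy, hy'⟩ := hR y
    have := A.inner_map_left ⟨R x, hx⟩ ⟨R y, hy⟩
    rw [hx', hy'] at this
    exact this.symm
  · obtain ⟨hx, hx'⟩ := hR x
    have := A.nonneg ⟨R x, hx⟩
    rw [hx'] at this
    change 0 ≤ RCLike.re ⟪R x, x⟫_𝕜
    rwa [inner_re_symm]

/-- The bounded operator `A⁻¹`. -/
noncomputable def inv : H →L[𝕜] H := A.exists_inv.choose

theorem inv_compact : IsCompactOperator A.inv := A.exists_inv.choose_spec.1

theorem inv_isPositive : A.inv.IsPositive := A.exists_inv.choose_spec.2.1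

theorem inv_mem (x : H) : A.inv x ∈ A.toPMap.domain := (A.exists_inv.choose_spec.2.2 x).1

theorem map_inv (x : H) : A.toPMap ⟨A.inv x, A.inv_mem x⟩ = x :=
  (A.exists_inv.choose_spec.2.2 x).2

theorem inv_map (u : A.toPMap.domain) : A.inv (A.toPMap u) = u :=
  A.eq_of_map_eq ⟨_, A.inv_mem _⟩ u (A.map_inv _)

theorem inv_injective : Function.Injective A.inv := fun x y h => by
  rw [← A.map_inv x, ← A.map_inv y]; congr 2

/-- The bounded operator `A^{-1/2}`, the positive square root of `A⁻¹`. -/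
noncomputable def invSqrt : H →L[𝕜] H :=
  (exists_sqrt A.inv A.inv_compact A.inv_isPositive).choose

theorem invSqrt_isPositive : A.invSqrt.IsPositive :=
  (exists_sqrt A.inv A.inv_compact A.inv_isPositive).choose_spec.1

theorem invSqrt_comp_self : A.invSqrt ∘L A.invSqrt = A.inv :=
  (exists_sqrt A.inv A.inv_compact A.inv_isPositive).choose_spec.2

theorem invSqrt_sq : A.invSqrt ^ 2 = A.inv := by
  rw [pow_two]; exact A.invSqrt_comp_self

theorem invSqrt_injective : Function.Injective A.invSqrt := fun x y h => A.inv_injective <| by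
  rw [← A.invSqrt_comp_self]
  exact congrArg A.invSqrt h

theorem invSqrt_pow_injective (k : ℕ) : Function.Injective (A.invSqrt ^ k) := by
  induction k with
  | zero => exact fun x y h => h
  | succ k ih =>
    intro x y h
    rw [pow_succ] at h
    exact A.invSqrt_injective (ih h)

/-- The space `H_k = D(A^{k/2})`, the range of `A^{-k/2} = (A^{-1/2})^k`. -/
def Sob (k : ℕ) : Type v :=
  ↥(LinearMap.range ((A.invSqrt ^ k : H →L[𝕜] H) : H →ₗ[𝕜] H))

noncomputable instance (k : ℕ) : AddCommGroup (A.Sob k) :=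
  inferInstanceAs (AddCommGroup ↥(LinearMap.range ((A.invSqrt ^ k : H →L[𝕜] H) : H →ₗ[𝕜] H)))

noncomputable instance (k : ℕ) : Module 𝕜 (A.Sob k) :=
  inferInstanceAs (Module 𝕜 ↥(LinearMap.range ((A.invSqrt ^ k : H →L[𝕜] H) : H →ₗ[𝕜] H)))

/-- The bijection `A^{k/2} : H_k → H`, the inverse of `A^{-k/2} : H → H_k`. -/
noncomputable def halfPow (k : ℕ) : A.Sob k ≃ₗ[𝕜] H :=
  (LinearEquiv.ofInjective ((A.invSqrt ^ k : H →L[𝕜] H) : H →ₗ[𝕜] H)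
    (A.invSqrt_pow_injective k)).symm

/-- `H_k` carries the norm `|u|_k = |A^{k/2} u|`. -/
noncomputable instance (k : ℕ) : NormedAddCommGroup (A.Sob k) :=
  NormedAddCommGroup.induced (A.Sob k) H (A.halfPow k) (A.halfPow k).injective

noncomputable instance (k : ℕ) : NormedSpace 𝕜 (A.Sob k) :=
  NormedSpace.induced 𝕜 (A.Sob k) H (A.halfPow k)

theorem norm_eq (k : ℕ) (x : A.Sob k) : ‖x‖ = ‖A.halfPow k x‖ := rfl

/-- The underlying linear embedding `H_k ⊆ H`. -/
noncomputable def embLin (k : ℕ) : A.Sob k →ₗ[𝕜] H :=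
  (LinearMap.range ((A.invSqrt ^ k : H →L[𝕜] H) : H →ₗ[𝕜] H)).subtype

theorem embLin_eq (k : ℕ) (x : A.Sob k) : A.embLin k x = (A.invSqrt ^ k) (A.halfPow k x) :=
  congrArg Subtype.val ((A.halfPow k).symm_apply_apply x).symm

/-- The continuous embedding `H_k ⊆ H`. -/
noncomputable def emb (k : ℕ) : A.Sob k →L[𝕜] H :=
  (A.embLin k).mkContinuous ‖A.invSqrt ^ k‖ fun x => by
    rw [embLin_eq, norm_eq]
    exact (A.invSqrt ^ k).le_opNorm _

theorem emb_eq (k : ℕ) (x : A.Sob k) : A.emb k x = (A.invSqrt ^ k) (A.halfPow k x) :=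
  A.embLin_eq k x

theorem emb_injective (k : ℕ) : Function.Injective (A.emb k) := Subtype.val_injective

/-- The continuous embedding `H_l ⊆ H_k` for `k ≤ l`. -/
noncomputable def incl {k l : ℕ} (_h : k ≤ l) : A.Sob l →L[𝕜] A.Sob k :=
  LinearMap.mkContinuous
    (((A.halfPow k).symm : H →ₗ[𝕜] A.Sob k) ∘ₗ
      ((A.invSqrt ^ (l - k) : H →L[𝕜] H) : H →ₗ[𝕜] H) ∘ₗ (A.halfPow l : A.Sob l →ₗ[𝕜] H))
    ‖A.invSqrt ^ (l - k)‖ fun x => by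
      rw [norm_eq, norm_eq]
      simp only [LinearMap.comp_apply, LinearEquiv.coe_coe, LinearEquiv.apply_symm_apply]
      exact (A.invSqrt ^ (l - k)).le_opNorm (A.halfPow l x)

theorem halfPow_incl {k l : ℕ} (h : k ≤ l) (x : A.Sob l) :
    A.halfPow k (A.incl h x) = (A.invSqrt ^ (l - k)) (A.halfPow l x) :=
  (A.halfPow k).apply_symm_apply _

theorem emb_incl {k l : ℕ} (h : k ≤ l) (x : A.Sob l) : A.emb k (A.incl h x) = A.emb l x := by
  rw [emb_eq, emb_eq, halfPow_incl, ← mul_apply_eq_comp, ← pow_add,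
    Nat.add_sub_cancel' h]

theorem emb_two_mem (x : A.Sob 2) : A.emb 2 x ∈ A.toPMap.domain := by
  rw [emb_eq, invSqrt_sq]
  exact A.inv_mem _

/-- The operator `A` on `H_2 = D(A)`. -/
noncomputable def op (x : A.Sob 2) : H := A.toPMap ⟨A.emb 2 x, A.emb_two_mem x⟩

theorem op_eq (x : A.Sob 2) : A.op x = A.halfPow 2 x := by
  have h : A.emb 2 x = A.inv (A.halfPow 2 x) := by rw [emb_eq, invSqrt_sq]
  rw [op, ← A.map_inv (A.halfPow 2 x)]
  congr 2

theorem mem_domain_iff (x : H) : x ∈ A.toPMap.domain ↔ ∃ y : A.Sob 2, A.emb 2 y = x := by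
  constructor
  · intro hx
    refine ⟨(A.halfPow 2).symm (A.toPMap ⟨x, hx⟩), ?_⟩
    rw [emb_eq, LinearEquiv.apply_symm_apply, invSqrt_sq]
    exact A.inv_map ⟨x, hx⟩
  · rintro ⟨y, rfl⟩
    exact A.emb_two_mem y

/-- The space `H_{k-1}`: for `k = 0` this is `H_{-1}`, the dual of `H_1` with pivot space `H`. -/
def SobPred : ℕ → Type v
  | 0 => StrongDual 𝕜 (A.Sob 1)
  | k + 1 => A.Sob k

noncomputable instance : (k : ℕ) → NormedAddCommGroup (A.SobPred k)
  | 0 => inferInstanceAs (NormedAddCommGroup (StrongDual 𝕜 (A.Sob 1)))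
  | k + 1 => inferInstanceAs (NormedAddCommGroup (A.Sob k))

/-- The duality pairing `⟨z, φ⟩` of `z ∈ H_{k-1}` with `φ ∈ H_1`: the value of the functional `z`
at `φ` for `k = 0`, the scalar product of `H` otherwise. -/
noncomputable def pair : (k : ℕ) → A.SobPred k → A.Sob 1 → 𝕜
  | 0, z, φ => (show StrongDual 𝕜 (A.Sob 1) from z) φ
  | k + 1, z, φ => ⟪A.emb k (show A.Sob k from z), A.emb 1 φ⟫_𝕜

/-- `L ∈ 𝓛(H_k)`: the bounded operator `L` of `H` restricts to a bounded operator of `H_k`. -/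
def BoundedOn (L : H →L[𝕜] H) (k : ℕ) : Prop :=
  ∃ L' : A.Sob k →L[𝕜] A.Sob k, ∀ x, A.emb k (L' x) = L (A.emb k x)

/-- The energy `e_{1-r}(u, u') = (|A^{(1-r)/2} u|² + |A^{-r/2} u'|²) / 2`, with
`A^{(1-r)/2} u = A^{-r/2} A^{1/2} u`. -/
noncomputable def energy (r : ℕ) (u : A.Sob 2) (u' : A.Sob 1) : ℝ :=
  (‖(A.invSqrt ^ r) (A.halfPow 1 (A.incl one_le_two u))‖ ^ 2 +
    ‖(A.invSqrt ^ r) (A.emb 1 u')‖ ^ 2) / 2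

end CoerciveOperator

end Operator

section Systems

variable {𝕜 : Type} {H : Type v} {G : Type w} [RCLike 𝕜]
  [NormedAddCommGroup H] [InnerProductSpace 𝕜 H] [CompleteSpace H]
  [NormedSpace ℝ H]
  [NormedAddCommGroup G] [InnerProductSpace 𝕜 G]

/-- The observation `(w, w') ↦ B^* w'` for `B ∈ 𝓛(G; H)`. -/
noncomputable def velocityObs [CompleteSpace G] (A : CoerciveOperator 𝕜 H) (B : G →L[𝕜] H) :
    A.Sob 2 × H →L[𝕜] G :=
  ContinuousLinearMap.adjoint B ∘L ContinuousLinearMap.snd 𝕜 (A.Sob 2) H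

/-- The observation `(w, w') ↦ B^* w` for `B ∈ 𝓛(G; H_2')` with adjoint `Bstar ∈ 𝓛(H_2; G)`. -/
noncomputable def positionObs (A : CoerciveOperator 𝕜 H) (Bstar : A.Sob 2 →L[𝕜] G) :
    A.Sob 2 × H →L[𝕜] G :=
  Bstar ∘L ContinuousLinearMap.fst 𝕜 (A.Sob 2) H

/-- `(w, w')` is a strong solution of `w'' + A w = f` on `[0, T]`:
`w ∈ C([0,T]; H_2)`, `w' ∈ C([0,T]; H_1)`, `f ∈ C([0,T]; H)`, where `w'` is the derivative of `w`
and `f - A w` that of `w'`. -/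
structure IsStrongSolution (A : CoerciveOperator 𝕜 H) (T : ℝ) (w : ℝ → A.Sob 2)
    (w' : ℝ → A.Sob 1) (f : ℝ → H) : Prop where
  continuousOn_pos : ContinuousOn w (Icc 0 T)
  continuousOn_vel : ContinuousOn w' (Icc 0 T)
  continuousOn_source : ContinuousOn f (Icc 0 T)
  deriv_pos : ∀ t ∈ Icc 0 T,
    HasDerivWithinAt (fun s => A.emb 2 (w s)) (A.emb 1 (w' t)) (Icc 0 T) t
  deriv_vel : ∀ t ∈ Icc 0 T,
    HasDerivWithinAt (fun s => A.emb 1 (w' s)) (f t - A.op (w t)) (Icc 0 T) t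

/-- Strong solutions on `[0, T]` of the bi-diagonal cascade of `n = m + 1` equations
`w_1'' + A w_1 = 0`, `w_i'' + A w_i + C_{i,i-1} w_{i-1} = 0` for `2 ≤ i ≤ n`.
The component `w_i` has the index `i - 1`, and `C j` is the operator that couples the component of
index `j` into the one of index `j + 1`. -/
structure IsCascadeSolution (A : CoerciveOperator 𝕜 H) {m : ℕ} (C : Fin m → H →L[𝕜] H) (T : ℝ)
    (w : Fin (m + 1) → ℝ → A.Sob 2) (w' : Fin (m + 1) → ℝ → A.Sob 1) : Prop where
  first : IsStrongSolution A T (w 0) (w' 0) fun _ => 0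
  next : ∀ j : Fin m, IsStrongSolution A T (w j.succ) (w' j.succ)
    fun t => -C j (A.emb 2 (w j.castSucc t))

/-- The coupling operators, `C j = C_{i,i-1}` and `P j = Π_i` with `i = j + 2`, satisfy:
`C_{i,i-1}^* ∈ 𝓛(H_k)` for `0 ≤ k ≤ n - i + 1 = m - j`,
`|C_{i,i-1} w|² ≤ ‖C_{i,i-1}‖ ⟨C_{i,i-1} w, w⟩` and `α_i |Π_i w|² ≤ ⟨C_{i,i-1} w, w⟩`
for some `α_i > 0`. -/
def CouplingAssumption (A : CoerciveOperator 𝕜 H) {m : ℕ} (C P : Fin m → H →L[𝕜] H) : Prop :=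
  ∀ j : Fin m,
    (∀ k ≤ m - (j : ℕ), A.BoundedOn (ContinuousLinearMap.adjoint (C j)) k) ∧
    (∀ x, ‖C j x‖ ^ 2 ≤ ‖C j‖ * RCLike.re ⟪C j x, x⟫_𝕜) ∧
    ∃ α : ℝ, 0 < α ∧ ∀ x, α * ‖P j x‖ ^ 2 ≤ RCLike.re ⟪C j x, x⟫_𝕜

/-- The velocity observed through `P` controls the energy of the solutions of `w'' + A w = 0`, on
every sufficiently long time interval. -/
def VelocityObservable (A : CoerciveOperator 𝕜 H) (P : H →L[𝕜] H) : Prop :=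
  ∃ T₀ : ℝ, 0 < T₀ ∧ ∀ T > T₀, ∃ γ : ℝ, 0 < γ ∧ ∀ w w', IsStrongSolution A T w w' (fun _ => 0) →
    γ * A.energy 0 (w 0) (w' 0) ≤ ∫ t in (0 : ℝ)..T, ‖P (A.emb 1 (w' t))‖ ^ 2

/-- The observation operator `𝓑 ∈ 𝓛(H_2 × H; G)` is admissible for `w'' + A w = f`. -/
def IsAdmissible (A : CoerciveOperator 𝕜 H) (𝓑 : A.Sob 2 × H →L[𝕜] G) : Prop :=
  ∀ T : ℝ, 0 < T → ∃ D : ℝ, 0 < D ∧ ∀ w w' f, IsStrongSolution A T w w' f →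
    ∫ t in (0 : ℝ)..T, ‖𝓑 (w t, A.emb 1 (w' t))‖ ^ 2 ≤
      D * (A.energy 0 (w 0) (w' 0) + A.energy 0 (w T) (w' T) +
        (∫ t in (0 : ℝ)..T, A.energy 0 (w t) (w' t)) + ∫ t in (0 : ℝ)..T, ‖f t‖ ^ 2)

/-- The observation operator `𝓑 ∈ 𝓛(H_2 × H; G)` observes the solutions of `w'' + A w = 0`, on every
sufficiently long time interval. -/
def IsObservable (A : CoerciveOperator 𝕜 H) (𝓑 : A.Sob 2 × H →L[𝕜] G) : Prop :=
  ∃ T₀ : ℝ, 0 < T₀ ∧ ∀ T > T₀, ∃ R : ℝ, 0 < R ∧ ∀ w w', IsStrongSolution A T w w' (fun _ => 0) →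
    R * A.energy 0 (w 0) (w' 0) ≤ ∫ t in (0 : ℝ)..T, ‖𝓑 (w t, A.emb 1 (w' t))‖ ^ 2

/-- `Tstar > 0` is an observability time of the cascade observed through its last component: for
every `T > Tstar` and `1 ≤ i ≤ n` there is `d_i(T) > 0` such that every solution satisfies
`e_{1+i-n}(W_i)(0) ≤ d_i(T) ∫_0^T ‖𝓑(w_n, w_n')‖² dt`.
For the component `i = j + 1` one has `1 + i - n = 1 - (m - j)`. -/
def IsObservabilityTime (A : CoerciveOperator 𝕜 H) {m : ℕ} (C : Fin m → H →L[𝕜] H)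
    (𝓑 : A.Sob 2 × H →L[𝕜] G) (Tstar : ℝ) : Prop :=
  0 < Tstar ∧ ∀ T > Tstar, ∀ j : Fin (m + 1), ∃ d : ℝ, 0 < d ∧
    ∀ w w', IsCascadeSolution A C T w w' →
      A.energy (m - (j : ℕ)) (w j 0) (w' j 0) ≤
        d * ∫ t in (0 : ℝ)..T, ‖𝓑 (w (Fin.last m) t, A.emb 1 (w' (Fin.last m) t))‖ ^ 2

/-- `Y = (y, y')` is the solution by transposition, on `[0, T]`, of the controlled dual cascade
`y_i'' + A y_i + C_{i+1,i}^* y_{i+1} = 0` for `1 ≤ i ≤ n - 1`, `y_n'' + A y_n = B v`, with initial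
data `(y0, y1)`. Here `B` is given by its adjoint `Bstar ∈ 𝓛(H_2; G)`, that is,
`⟨B v, φ⟩ = ⟨v, Bstar φ⟩_G` for `φ ∈ H_2`, and the regularity is
`(y_i, y_i') ∈ C([0,T]; H_{n-i+s} × H_{n-i+s-1})`. The component `y_i` has the index `j = i - 1`, so
that `n - i = m - j`. The test functions are the strong solutions of the adjoint system, whose
values `(w(τ), w'(τ))` at a given time fill the dense subspace `H_2^n × H_1^n` of the dual of the
state space. -/
structure IsTranspositionSolution (A : CoerciveOperator 𝕜 H) {m : ℕ} (C : Fin m → H →L[𝕜] H)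
    (Bstar : A.Sob 2 →L[𝕜] G) (s : ℕ) (T : ℝ) (v : ℝ → G)
    (y0 : (j : Fin (m + 1)) → A.Sob (m - j + s)) (y1 : (j : Fin (m + 1)) → A.SobPred (m - j + s))
    (y : (j : Fin (m + 1)) → ℝ → A.Sob (m - j + s))
    (y' : (j : Fin (m + 1)) → ℝ → A.SobPred (m - j + s)) : Prop where
  continuousOn_pos : ∀ j, ContinuousOn (y j) (Icc 0 T)
  continuousOn_vel : ∀ j, ContinuousOn (y' j) (Icc 0 T)
  initial_pos : ∀ j, y j 0 = y0 j
  initial_vel : ∀ j, y' j 0 = y1 j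
  deriv_pos : ∀ (j : Fin (m + 1)) (φ : A.Sob 1), ∀ t ∈ Icc 0 T,
    HasDerivWithinAt (fun τ => ⟪A.emb _ (y j τ), A.emb 1 φ⟫_𝕜) (A.pair _ (y' j t) φ) (Icc 0 T) t
  transposition : ∀ w w', IsCascadeSolution A C T w w' → ∀ τ ∈ Icc 0 T,
    ∫ t in (0 : ℝ)..τ, ⟪v t, Bstar (w (Fin.last m) t)⟫_𝕜 =
      ∑ j, (A.pair _ (y' j τ) (A.incl one_le_two (w j τ)) -
          ⟪A.emb _ (y j τ), A.emb 1 (w' j τ)⟫_𝕜) -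
        ∑ j, (A.pair _ (y1 j) (A.incl one_le_two (w j 0)) -
          ⟪A.emb _ (y0 j), A.emb 1 (w' j 0)⟫_𝕜)

/-- All initial data in `∏ H_{n-i+s} × ∏ H_{n-i+s-1}` can be steered to zero in time `T`: for some
control `v ∈ L²((0,T); G)` the controlled dual cascade has a solution, and the solution vanishes at
time `T`. -/
def IsNullControllable (A : CoerciveOperator 𝕜 H) {m : ℕ} (C : Fin m → H →L[𝕜] H)
    (Bstar : A.Sob 2 →L[𝕜] G) (s : ℕ) (T : ℝ) : Prop :=
  ∀ (y0 : (j : Fin (m + 1)) → A.Sob (m - j + s)) (y1 : (j : Fin (m + 1)) → A.SobPred (m - j + s)),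
    ∃ v : ℝ → G, MemLp v 2 (volume.restrict (Ioo 0 T)) ∧
      (∃ y y', IsTranspositionSolution A C Bstar s T v y0 y1 y y') ∧
      ∀ y y', IsTranspositionSolution A C Bstar s T v y0 y1 y y' → ∀ j, y j T = 0 ∧ y' j T = 0

end Systems

end Cascade

namespace Cascade

open Set MeasureTheory Filter Topology
open scoped InnerProductSpace

universe v

/-! ### Calculus for vector-valued functions on an interval. -/

section Calculus

/-! Put `S = A^{-1/2}` and describe a strong solution by `p = A w` and `q = A^{1/2} w'`. These are
continuous functions with values in `H`, and the equation reads `(S p)' = q`, `(S q)' = f - p`.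
Every norm of the scale `H_k` that occurs becomes a norm `|S^k x|` of a vector of `H`, so the
analysis takes place for `IsWave` and `IsCascade`, with one bounded injective symmetric operator.

Observability rests on a chain in which each wave is driven by the velocity of the previous one,
`z_1'' + A z_1 = -C z'`. The derivative of `⟨z_1', z'⟩ + ⟨A^{1/2} z_1, A^{1/2} z⟩` contains `-⟨C z',
z'⟩`. The weight `(t - a)(b - t)` removes the boundary terms (`IsWave.integral_coupling`). The
coercivity of `C` with respect to `Π` and the observability through `Π` then bound the energy of `z`
on the middle third of `[a, b]`, with `l = b - a`, by its source, `ε` times its energy on `[a, b]`,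
and `(ε l²)⁻¹` times the energy of `z_1` (`waveEnergy_le_of_coupling`). When `l` is proportional to
`T`, absorption gives that each integrated energy is at most `M / T²` times the next one
(`exists_integral_le_next`). This gain for large `T` replaces any smallness of the couplings: the
error made in observing the last component is absorbed, and the observation controls the whole chain
(`exists_energy_le_observation`).

The cascade itself is coupled through displacements. Integrating the component `i` in time `n - i`
times turns it into a velocity chain and leaves the observed component untouched
(`IsCascade.isVelocityCascade`). No integral is computed: if `z' = w`, the equation forces `A z =
-w' - C z_prev`. Each primitive costs one power of `A^{1/2}`, whence the weakened energies
`e_{1+i-n}`. The coupling terms in the comparison are bounded on spaces of negative order, by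
duality with the boundedness of `C^*` on `H_k`.

Controllability follows by the Hilbert uniqueness method (`exists_transposition_control`). On the
space of cascade solutions, the weak norm of the initial data and the `L²` norm of the observation
are equivalent: one inequality is the observability, the other an energy growth estimate together
with the admissibility of the observation. The functional given by the data to be controlled is thus
represented by a control. The state at time `τ` is minus the adjoint of "data ↦ observation" applied
to the control translated by `τ`. Its continuity in time is that of translations in `L²`, and it
vanishes at `T` because the translated control has left the observation window. For `B^* w'` the
control acts against the observation `B^* w`, that is, against the velocity observation of the
primitive solution; this accounts for the state space being one order more regular in that case. -/

theorem HasDerivWithinAt.clm_comp {𝕜 E F : Type*} [RCLike 𝕜] [NormedAddCommGroup E]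
    [NormedSpace 𝕜 E] [NormedSpace ℝ E] [IsScalarTower ℝ 𝕜 E] [NormedAddCommGroup F]
    [NormedSpace 𝕜 F] [NormedSpace ℝ F] [IsScalarTower ℝ 𝕜 F] (L : E →L[𝕜] F) {f : ℝ → E} {f' : E}
    {s : Set ℝ} {t : ℝ} (h : HasDerivWithinAt f f' s t) :
    HasDerivWithinAt (fun x => L (f x)) (L f') s t :=
  (L.restrictScalars ℝ).hasFDerivAt.comp_hasDerivWithinAt t h

theorem eq_of_hasDerivWithinAt_eq {F : Type*} [NormedAddCommGroup F] [NormedSpace ℝ F]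
    {f g f' : ℝ → F} {a b : ℝ} (hf : ∀ t ∈ Icc a b, HasDerivWithinAt f (f' t) (Icc a b) t)
    (hg : ∀ t ∈ Icc a b, HasDerivWithinAt g (f' t) (Icc a b) t) (h : f a = g a) :
    ∀ t ∈ Icc a b, f t = g t := by
  refine eq_of_derivWithin_eq (fun t ht => (hf t ht).differentiableWithinAt)
    (fun t ht => (hg t ht).differentiableWithinAt) (fun t ht => ?_) h
  have hu : UniqueDiffWithinAt ℝ (Icc a b) t :=
    uniqueDiffOn_Icc (ht.1.trans_lt ht.2) t (Ico_subset_Icc_self ht)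
  rw [(hf t (Ico_subset_Icc_self ht)).derivWithin hu, (hg t (Ico_subset_Icc_self ht)).derivWithin hu]

/-- Extending `g` by constants beyond the interval makes the primitive differentiable on both sides
at the endpoints as well. -/
theorem exists_hasDerivAt_of_continuousOn {F : Type*} [NormedAddCommGroup F] [NormedSpace ℝ F]
    [CompleteSpace F] {g : ℝ → F} {a b : ℝ} (hg : ContinuousOn g (Icc a b)) (x : F) :
    ∃ f : ℝ → F, f a = x ∧ ∀ t ∈ Icc a b, HasDerivAt f (g t) t := by
  by_cases hab : a ≤ b
  · have hc : Continuous (IccExtend hab ((Icc a b).domRestrict g)) :=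
      (continuousOn_iff_continuous_domRestrict.1 hg).Icc_extend'
    refine ⟨fun t => x + ∫ s in a..t, IccExtend hab ((Icc a b).domRestrict g) s, by simp,
      fun t ht => ?_⟩
    have := (hc.integral_hasStrictDerivAt a t).hasDerivAt.const_add x
    rwa [IccExtend_of_mem _ _ ht] at this
  · exact ⟨fun _ => x, rfl, fun t ht => absurd (ht.1.trans ht.2) hab⟩

/-- A continuous function that is the derivative of `F` when tested against a separating family of
functionals is the derivative of `F`. -/
theorem hasDerivWithinAt_of_functionals {𝕜 H I : Type*} [RCLike 𝕜] [NormedAddCommGroup H]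
    [NormedSpace 𝕜 H] [CompleteSpace H] [NormedSpace ℝ H] [IsScalarTower ℝ 𝕜 H]
    (l : I → H →L[𝕜] 𝕜) (hsep : ∀ x, (∀ i, l i x = 0) → x = 0) {F G : ℝ → H} {a b : ℝ}
    (hG : ContinuousOn G (Icc a b))
    (h : ∀ i, ∀ t ∈ Icc a b, HasDerivWithinAt (fun s => l i (F s)) (l i (G t)) (Icc a b) t) :
    ∀ t ∈ Icc a b, HasDerivWithinAt F (G t) (Icc a b) t := by
  obtain ⟨Φ, h0, hΦ⟩ := exists_hasDerivAt_of_continuousOn hG (F a)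
  -- No continuity of `F` is available; it is recovered by identifying `F` with the primitive `Φ` of
  -- `G`, since each functional sees the same derivative and the same value at `a`.
  have key : ∀ t ∈ Icc a b, F t = Φ t := by
    intro t ht
    refine sub_eq_zero.1 (hsep _ fun i => ?_)
    rw [map_sub, sub_eq_zero]
    exact eq_of_hasDerivWithinAt_eq (h i)
      (fun t ht => HasDerivWithinAt.clm_comp (l i) (hΦ t ht).hasDerivWithinAt) (by rw [h0]) t ht
  intro t ht
  exact ((hΦ t ht).hasDerivWithinAt).congr key (key t ht)

theorem hasDerivAt_of_functionals {𝕜 H I : Type*} [RCLike 𝕜] [NormedAddCommGroup H]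
    [NormedSpace 𝕜 H] [CompleteSpace H] [NormedSpace ℝ H] [IsScalarTower ℝ 𝕜 H]
    (l : I → H →L[𝕜] 𝕜) (hsep : ∀ x, (∀ i, l i x = 0) → x = 0) {F G : ℝ → H}
    (hG : Continuous G) (h : ∀ i t, HasDerivAt (fun s => l i (F s)) (l i (G t)) t) (t : ℝ) :
    HasDerivAt F (G t) t :=
  (hasDerivWithinAt_of_functionals l hsep (a := t - 1) (b := t + 1) hG.continuousOn
    (fun i s _ => (h i s).hasDerivWithinAt) t ⟨by linarith, by linarith⟩).hasDerivAt
    (Icc_mem_nhds (by linarith) (by linarith))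

end Calculus

/-! ### Diagonal operators in a Hilbert basis. -/

section Diagonal

variable {𝕜 H ι : Type*} [RCLike 𝕜] [NormedAddCommGroup H] [InnerProductSpace 𝕜 H]
  (b : HilbertBasis ι 𝕜 H)

theorem hasSum_norm_sq_inner (x : H) : HasSum (fun i => ‖⟪b i, x⟫_𝕜‖ ^ 2) (‖x‖ ^ 2) := by
  have := lp.hasSum_norm (p := 2) (by norm_num) (b.repr x)
  simpa [b.repr_apply_apply] using this

theorem eq_zero_of_inner_eq_zero (x : H) (h : ∀ i, ⟪b i, x⟫_𝕜 = 0) : x = 0 := by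
  have h1 := hasSum_norm_sq_inner b x
  simp only [h, norm_zero, ne_eq, OfNat.ofNat_ne_zero, not_false_eq_true, zero_pow] at h1
  have h2 := h1.unique hasSum_zero
  simpa using h2

/-- Bounded diagonal operators. -/
theorem exists_diag (c : ι → ℝ) (hc : ∀ i, |c i| ≤ 1) :
    ∃ D : H →L[𝕜] H, (∀ x i, ⟪b i, D x⟫_𝕜 = (c i : 𝕜) * ⟪b i, x⟫_𝕜) ∧ ∀ x, ‖D x‖ ≤ ‖x‖ := by
  have hterm : ∀ (z : 𝕜) i, ‖(c i : 𝕜) * z‖ ^ 2 ≤ ‖z‖ ^ 2 := by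
    intro z i
    rw [norm_mul, RCLike.norm_ofReal]
    gcongr
    exact mul_le_of_le_one_left (norm_nonneg _) (hc i)
  have hsum : ∀ f : lp (fun _ : ι => 𝕜) 2, HasSum (fun i => ‖f i‖ ^ 2) (‖f‖ ^ 2) := by
    intro f
    simpa using lp.hasSum_norm (p := 2) (by norm_num) f
  have hmem : ∀ f : lp (fun _ : ι => 𝕜) 2, Memℓp (fun i => (c i : 𝕜) * f i) 2 := by
    intro f
    rw [memℓp_gen_iff (by norm_num)]
    refine Summable.of_nonneg_of_le (fun i => by positivity) (fun i => ?_) (hsum f).summable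
    simpa using hterm (f i) i
  let M : lp (fun _ : ι => 𝕜) 2 →ₗ[𝕜] lp (fun _ : ι => 𝕜) 2 :=
    { toFun := fun f => ⟨fun i => (c i : 𝕜) * f i, hmem f⟩
      map_add' := fun f g => by ext i; exact mul_add _ _ _
      map_smul' := fun a f => by ext i; simp [mul_left_comm] }
  have hM : ∀ f, ‖M f‖ ≤ ‖f‖ := fun f =>
    (sq_le_sq₀ (norm_nonneg _) (norm_nonneg _)).1
      (hasSum_le (fun i => hterm (f i) i) (hsum (M f)) (hsum f))
  let D : H →ₗ[𝕜] H := (b.repr.symm.toLinearEquiv : lp (fun _ : ι => 𝕜) 2 →ₗ[𝕜] H) ∘ₗ M ∘ₗ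
    (b.repr.toLinearEquiv : H →ₗ[𝕜] lp (fun _ : ι => 𝕜) 2)
  have hD : ∀ x, D x = b.repr.symm (M (b.repr x)) := fun x => rfl
  have hDn : ∀ x, ‖D x‖ ≤ ‖x‖ := fun x => by
    rw [hD, LinearIsometryEquiv.norm_map]
    exact (hM _).trans (b.repr.norm_map x).le
  refine ⟨D.mkContinuous 1 fun x => by simpa using hDn x, fun x i => ?_, fun x => hDn x⟩
  rw [LinearMap.mkContinuous_apply, ← b.repr_apply_apply, hD, LinearIsometryEquiv.apply_symm_apply,
    ← b.repr_apply_apply]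
  rfl

/-- Uniformly bounded diagonal operators with continuous symbols are strongly continuous. -/
theorem continuous_diag_apply {c : ℝ → ι → ℝ} (hc : ∀ t i, |c t i| ≤ 1)
    (hcont : ∀ i, Continuous fun t => c t i) {D : ℝ → H →L[𝕜] H}
    (hD : ∀ t x i, ⟪b i, D t x⟫_𝕜 = (c t i : 𝕜) * ⟪b i, x⟫_𝕜) (hDn : ∀ t x, ‖D t x‖ ≤ ‖x‖)
    {α : ℝ → H} (hα : Continuous α) : Continuous fun t => D t (α t) := by
  have h1 : ∀ x, Continuous fun t => D t x := by
    intro x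
    refine continuous_iff_continuousAt.2 fun s => ?_
    -- The convergence is only strong, not in operator norm: it comes from dominated convergence of
    -- the coordinate series, with `|c t i - c s i|² ≤ 4`.
    have hs : Tendsto (fun t => ∑' i, ‖⟪b i, D t x - D s x⟫_𝕜‖ ^ 2) (𝓝 s) (𝓝 (∑' _ : ι, (0 : ℝ))) := by
      refine tendsto_tsum_of_dominated_convergence (bound := fun i => 4 * ‖⟪b i, x⟫_𝕜‖ ^ 2)
        ((hasSum_norm_sq_inner b x).summable.mul_left 4) (fun i => ?_)
        (Eventually.of_forall fun t i => ?_)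
      · have : Continuous fun t => ‖⟪b i, D t x - D s x⟫_𝕜‖ ^ 2 := by
          simp only [inner_sub_right, hD]
          have := hcont i
          fun_prop
        simpa using this.tendsto s
      · rw [inner_sub_right, hD, hD, ← sub_mul, ← RCLike.ofReal_sub, norm_mul, RCLike.norm_ofReal,
          Real.norm_of_nonneg (by positivity), mul_pow]
        gcongr
        have h2 := abs_sub (c t i) (c s i)
        nlinarith [hc t i, hc s i, abs_nonneg (c t i - c s i)]
    simp only [(hasSum_norm_sq_inner b _).tsum_eq, tsum_zero] at hs
    have := (Real.continuous_sqrt.tendsto 0).comp hs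
    simp only [Function.comp_def, Real.sqrt_sq (norm_nonneg _), Real.sqrt_zero] at this
    exact tendsto_iff_norm_sub_tendsto_zero.2 this
  refine continuous_iff_continuousAt.2 fun s => ?_
  have h2 : Tendsto (fun t => ‖α t - α s‖ + ‖D t (α s) - D s (α s)‖) (𝓝 s) (𝓝 0) := by
    have h3 := tendsto_iff_norm_sub_tendsto_zero.1 (hα.tendsto s)
    have h4 := tendsto_iff_norm_sub_tendsto_zero.1 ((h1 (α s)).tendsto s)
    simpa using h3.add h4
  refine tendsto_iff_norm_sub_tendsto_zero.2 (squeeze_zero (fun _ => norm_nonneg _) (fun t => ?_) h2)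
  have : D t (α t) - D s (α s) = D t (α t - α s) + (D t (α s) - D s (α s)) := by
    rw [map_sub]; abel
  rw [this]
  exact (norm_add_le _ _).trans (add_le_add_left (hDn t _) _)

end Diagonal

/-! ### The wave equation as a first order system in `H`, and existence of solutions. -/

section Wave

variable {𝕜 H : Type*} [RCLike 𝕜] [NormedAddCommGroup H] [InnerProductSpace 𝕜 H]
  [NormedSpace ℝ H]

/-- The equation `w'' + A w = f` on the time set `s`, in terms of `p = A w`, `q = A^{1/2} w'` and
`S = A^{-1/2}`. -/
structure IsWave (S : H →L[𝕜] H) (s : Set ℝ) (p q f : ℝ → H) : Prop where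
  continuousOn_fst : ContinuousOn p s
  continuousOn_snd : ContinuousOn q s
  continuousOn_source : ContinuousOn f s
  deriv_fst : ∀ t ∈ s, HasDerivWithinAt (fun x => S (p x)) (q t) s t
  deriv_snd : ∀ t ∈ s, HasDerivWithinAt (fun x => S (q x)) (f t - p t) s t

/-- The cascade `w_0'' + A w_0 = 0`, `w_{j+1}'' + A w_{j+1} + C_j w_j = 0` in the variables of
`IsWave`. -/
structure IsCascade (S : H →L[𝕜] H) {m : ℕ} (C : Fin m → H →L[𝕜] H) (s : Set ℝ)
    (p q : Fin (m + 1) → ℝ → H) : Prop where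
  first : IsWave S s (p 0) (q 0) fun _ => 0
  next : ∀ j : Fin m, IsWave S s (p j.succ) (q j.succ) fun t => -C j (S (S (p j.castSucc t)))

/-- Variation of constants in the eigenbasis, with frequencies `1 / μ i`. The pair `(q, f - p)`
solves a rotation system in which the source enters through `f'` alone, so a `C¹` source with values
in `H` suffices for a strong solution and no unbounded operator is applied to `f`. -/
theorem exists_wave [IsScalarTower ℝ 𝕜 H] [CompleteSpace H] {ι : Type*} (b : HilbertBasis ι 𝕜 H)
    {S : H →L[𝕜] H} (hsymm : (S : H →ₗ[𝕜] H).IsSymmetric) {μ : ι → ℝ} (hμ : ∀ i, 0 < μ i)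
    (hb : ∀ i, S (b i) = (μ i : 𝕜) • b i) {f f' : ℝ → H} (hf : ∀ t, HasDerivAt f (f' t) t)
    (hf' : Continuous f') (x y : H) :
    ∃ p q : ℝ → H, IsWave S univ p q f ∧ p 0 = x ∧ q 0 = y := by
  choose Co hCo hCon using fun t : ℝ =>
    exists_diag b (fun i => Real.cos (t / μ i)) fun i => Real.abs_cos_le_one _
  choose Si hSi hSin using fun t : ℝ =>
    exists_diag b (fun i => Real.sin (t / μ i)) fun i => Real.abs_sin_le_one _
  have hCc : ∀ {α : ℝ → H}, Continuous α → Continuous fun t => Co t (α t) := fun hα =>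
    continuous_diag_apply b (c := fun t i => Real.cos (t / μ i)) (fun t i => Real.abs_cos_le_one _)
      (fun i => by fun_prop) hCo hCon hα
  have hSc : ∀ {α : ℝ → H}, Continuous α → Continuous fun t => Si t (α t) := fun hα =>
    continuous_diag_apply b (c := fun t i => Real.sin (t / μ i)) (fun t i => Real.abs_sin_le_one _)
      (fun i => by fun_prop) hSi hSin hα
  have hfc : Continuous f := continuous_iff_continuousAt.2 fun t => (hf t).continuousAt
  -- `α` and `β` are the varied constants of the rotation; their initial values are `q 0 = y` and `f
  -- 0 - p 0 = f 0 - x`.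
  let α : ℝ → H := fun t => y - ∫ s in (0 : ℝ)..t, Si s (f' s)
  let β : ℝ → H := fun t => (f 0 - x) + ∫ s in (0 : ℝ)..t, Co s (f' s)
  have hα : ∀ t, HasDerivAt α (-Si t (f' t)) t := fun t =>
    ((hSc hf').integral_hasStrictDerivAt 0 t).hasDerivAt.const_sub y
  have hβ : ∀ t, HasDerivAt β (Co t (f' t)) t := fun t =>
    ((hCc hf').integral_hasStrictDerivAt 0 t).hasDerivAt.const_add _
  have hαc : Continuous α := continuous_iff_continuousAt.2 fun t => (hα t).continuousAt
  have hβc : Continuous β := continuous_iff_continuousAt.2 fun t => (hβ t).continuousAt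
  -- Here `P` is the future `q`, and `Q` is the future `f - p`.
  let P : ℝ → H := fun t => Co t (α t) + Si t (β t)
  let Q : ℝ → H := fun t => -Si t (α t) + Co t (β t)
  have hPc : Continuous P := (hCc hαc).add (hSc hβc)
  have hQc : Continuous Q := (hSc hαc).neg.add (hCc hβc)
  have hSb : ∀ i z, ⟪b i, S z⟫_𝕜 = (μ i : 𝕜) * ⟪b i, z⟫_𝕜 := by
    intro i z
    have : ⟪b i, S z⟫_𝕜 = ⟪S (b i), z⟫_𝕜 := (hsymm (b i) z).symm
    rw [this, hb, inner_smul_left, RCLike.conj_ofReal]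
  have hder : ∀ i (F : ℝ → H) F' t, HasDerivAt F F' t →
      HasDerivAt (fun s => ⟪b i, F s⟫_𝕜) ⟪b i, F'⟫_𝕜 t := fun i F F' t h =>
    ((innerSL 𝕜 (b i)).restrictScalars ℝ).hasFDerivAt.comp_hasDerivAt t h
  have hcos : ∀ i t, HasDerivAt (fun s : ℝ => ((Real.cos (s / μ i) : ℝ) : 𝕜))
      ((-Real.sin (t / μ i) * (1 / μ i) : ℝ) : 𝕜) t := fun i t =>
    (RCLike.ofRealCLM (K := 𝕜)).hasFDerivAt.comp_hasDerivAt t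
      ((hasDerivAt_id' t).div_const (μ i)).cos
  have hsin : ∀ i t, HasDerivAt (fun s : ℝ => ((Real.sin (s / μ i) : ℝ) : 𝕜))
      ((Real.cos (t / μ i) * (1 / μ i) : ℝ) : 𝕜) t := fun i t =>
    (RCLike.ofRealCLM (K := 𝕜)).hasFDerivAt.comp_hasDerivAt t
      ((hasDerivAt_id' t).div_const (μ i)).sin
  have hsep : ∀ z : H, (∀ i, innerSL 𝕜 (b i) z = 0) → z = 0 := fun z h =>
    eq_zero_of_inner_eq_zero b z h
  have hm : ∀ i, (μ i : 𝕜) * ((1 / μ i : ℝ) : 𝕜) = 1 := fun i => by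
    rw [← RCLike.ofReal_mul, mul_one_div_cancel (hμ i).ne', RCLike.ofReal_one]
  have hP : ∀ t, HasDerivAt (fun s => S (P s)) (Q t) t := by
    refine hasDerivAt_of_functionals (fun i => innerSL 𝕜 (b i)) hsep hQc fun i t => ?_
    simp only [innerSL_apply_apply, hSb, P, Q, inner_add_right, inner_neg_right, hCo, hSi]
    have h := (((hcos i t).mul (hder i _ _ _ (hα t))).add
      ((hsin i t).mul (hder i _ _ _ (hβ t)))).const_mul (μ i : 𝕜)
    refine h.congr_deriv ?_
    simp only [inner_neg_right, hCo, hSi, RCLike.ofReal_mul, RCLike.ofReal_neg]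
    linear_combination (-(Real.sin (t / μ i) : 𝕜) * ⟪b i, α t⟫_𝕜 +
      (Real.cos (t / μ i) : 𝕜) * ⟪b i, β t⟫_𝕜) * hm i
  have hQ : ∀ t, HasDerivAt (fun s => S (Q s)) (S (f' t) - P t) t := by
    refine hasDerivAt_of_functionals (fun i => innerSL 𝕜 (b i)) hsep
      ((S.continuous.comp hf').sub hPc) fun i t => ?_
    simp only [innerSL_apply_apply, hSb, P, Q, inner_add_right, inner_sub_right, inner_neg_right,
      hCo, hSi]
    have h := (((hsin i t).mul (hder i _ _ _ (hα t))).neg.add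
      ((hcos i t).mul (hder i _ _ _ (hβ t)))).const_mul (μ i : 𝕜)
    refine h.congr_deriv ?_
    simp only [inner_neg_right, hCo, hSi, RCLike.ofReal_mul, RCLike.ofReal_neg]
    have hsc : (Real.sin (t / μ i) : 𝕜) ^ 2 + (Real.cos (t / μ i) : 𝕜) ^ 2 = 1 := by
      rw [← RCLike.ofReal_pow, ← RCLike.ofReal_pow, ← RCLike.ofReal_add, Real.sin_sq_add_cos_sq,
        RCLike.ofReal_one]
    linear_combination (-(Real.cos (t / μ i) : 𝕜) * ⟪b i, α t⟫_𝕜 -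
      (Real.sin (t / μ i) : 𝕜) * ⟪b i, β t⟫_𝕜) * hm i + (μ i : 𝕜) * ⟪b i, f' t⟫_𝕜 * hsc
  have hC0 : ∀ z, Co 0 z = z := fun z => sub_eq_zero.1 <|
    eq_zero_of_inner_eq_zero b _ fun i => by rw [inner_sub_right, hCo]; simp
  have hS0 : ∀ z, Si 0 z = 0 := fun z =>
    eq_zero_of_inner_eq_zero b _ fun i => by rw [hSi]; simp
  refine ⟨fun t => f t - Q t, P, ⟨(hfc.sub hQc).continuousOn, hPc.continuousOn, hfc.continuousOn,
    fun t _ => ?_, fun t _ => ?_⟩, ?_, ?_⟩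
  · have h1 : HasDerivAt (fun s => S (f s)) (S (f' t)) t :=
      (S.restrictScalars ℝ).hasFDerivAt.comp_hasDerivAt t (hf t)
    simp only [map_sub]
    exact ((h1.sub (hQ t)).congr_deriv (by abel)).hasDerivWithinAt
  · exact ((hP t).congr_deriv (by abel)).hasDerivWithinAt
  · simp [Q, hS0, hC0, α, β]
  · simp [P, hS0, hC0, α, β]

end Wave

/-! ### Spectral description of `A^{-1/2}` and the isometries `A^{k/2}`. -/

namespace CoerciveOperator

variable {𝕜 : Type} {H : Type v} [RCLike 𝕜] [NormedAddCommGroup H] [InnerProductSpace 𝕜 H]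
  [CompleteSpace H] (A : CoerciveOperator 𝕜 H)

/-- An eigenbasis of `A⁻¹` already diagonalizes its positive square root: with `μ² = ν i`, the
vector `y = A^{-1/2} b - μ b` satisfies `A^{-1/2} y = -μ y`, which positivity of `A^{-1/2}` and `μ >
0` allow only for `y = 0`. -/
theorem exists_eigenbasis_invSqrt :
    ∃ (ι : Type v) (b : HilbertBasis ι 𝕜 H) (μ : ι → ℝ), (∀ i, 0 < μ i) ∧
      ∀ i, A.invSqrt (b i) = (μ i : 𝕜) • b i := by
  obtain ⟨ι, b, ν, hν⟩ := exists_eigenbasis A.inv A.inv_compact A.inv_isPositive.isSymmetric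
  have hn : ∀ i, ‖b i‖ = 1 := b.orthonormal.1
  have hre : ∀ i, ν i = (RCLike.re (ν i) : 𝕜) ∧ 0 ≤ RCLike.re (ν i) := by
    intro i
    have h1 := A.inv_isPositive.inner_nonneg_right (b i)
    rw [hν, inner_smul_right, inner_self_eq_norm_sq_to_K, hn] at h1
    simp only [RCLike.ofReal_one, one_pow, mul_one] at h1
    exact ⟨(RCLike.conj_eq_iff_re.1 (RCLike.conj_eq_iff_im.2 (RCLike.nonneg_iff.1 h1).2)).symm,
      (RCLike.nonneg_iff.1 h1).1⟩
  have hpos : ∀ i, 0 < RCLike.re (ν i) := by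
    intro i
    refine lt_of_le_of_ne (hre i).2 fun h => ?_
    have h1 : A.inv (b i) = A.inv 0 := by rw [hν, (hre i).1, ← h]; simp
    have := A.inv_injective h1
    have h2 := hn i
    simp [this] at h2
  refine ⟨ι, b, fun i => √(RCLike.re (ν i)), fun i => Real.sqrt_pos.2 (hpos i), fun i => ?_⟩
  set μ := √(RCLike.re (ν i)) with hμ
  have hμ0 : 0 < μ := Real.sqrt_pos.2 (hpos i)
  have hμν : (μ : 𝕜) * μ = ν i := by
    rw [← RCLike.ofReal_mul, hμ, Real.mul_self_sqrt (hre i).2, ← (hre i).1]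
  set y := A.invSqrt (b i) - (μ : 𝕜) • b i with hy
  have h1 : A.invSqrt y = -((μ : 𝕜) • y) := by
    have h2 : A.invSqrt (A.invSqrt (b i)) = ν i • b i := by
      rw [← hν, ← A.invSqrt_comp_self]; rfl
    rw [hy, map_sub, map_smul, h2, ← hμν, smul_sub, smul_smul]
    abel
  have h3 := A.invSqrt_isPositive.re_inner_nonneg_left y
  rw [h1, inner_neg_left, inner_smul_left, RCLike.conj_ofReal, map_neg, RCLike.re_ofReal_mul,
    inner_self_eq_norm_sq] at h3
  have h4 : ‖y‖ ^ 2 = 0 := le_antisymm (by nlinarith) (by positivity)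
  exact sub_eq_zero.1 (norm_eq_zero.1 (pow_eq_zero_iff two_ne_zero |>.1 h4))

/-- The isometry `A^{k/2} : H_k → H`. -/
noncomputable def halfPowIso (k : ℕ) : A.Sob k ≃ₗᵢ[𝕜] H where
  toLinearEquiv := A.halfPow k
  norm_map' _ := rfl

theorem continuous_halfPow (k : ℕ) : Continuous (A.halfPow k) := (A.halfPowIso k).continuous

theorem continuous_halfPow_symm (k : ℕ) : Continuous (A.halfPow k).symm :=
  (A.halfPowIso k).symm.continuous

theorem emb_one (x : A.Sob 1) : A.emb 1 x = A.invSqrt (A.halfPow 1 x) := by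
  rw [emb_eq, pow_one]

theorem emb_two (x : A.Sob 2) : A.emb 2 x = A.invSqrt (A.invSqrt (A.halfPow 2 x)) := by
  rw [emb_eq, pow_two]; rfl

theorem halfPow_incl_one_two (x : A.Sob 2) :
    A.halfPow 1 (A.incl one_le_two x) = A.invSqrt (A.halfPow 2 x) := by
  rw [halfPow_incl]; rw [show 2 - 1 = 1 from rfl, pow_one]

theorem energy_eq (r : ℕ) (u : A.Sob 2) (u' : A.Sob 1) :
    A.energy r u u' = (‖(A.invSqrt ^ (r + 1)) (A.halfPow 2 u)‖ ^ 2 +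
      ‖(A.invSqrt ^ (r + 1)) (A.halfPow 1 u')‖ ^ 2) / 2 := by
  rw [energy, halfPow_incl_one_two, emb_one, pow_succ]; rfl

theorem isSymmetric_invSqrt : (A.invSqrt : H →ₗ[𝕜] H).IsSymmetric :=
  A.invSqrt_isPositive.isSymmetric

end CoerciveOperator

/-! ### Dictionary between strong solutions and `IsWave`, `IsCascade`. -/

section Translation

variable {𝕜 : Type} {H : Type*} [RCLike 𝕜] [NormedAddCommGroup H] [InnerProductSpace 𝕜 H]
  [CompleteSpace H] [NormedSpace ℝ H] {A : CoerciveOperator 𝕜 H} {T : ℝ}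

/-- The hypothesis differentiates `w = S (S p)` in `H`, whereas `(S p)' = q` is a derivative in the
stronger space `H_1`. The gain comes from the continuity of `q`: tested against vectors `S y`, which
separate points, the two statements coincide. -/
theorem IsStrongSolution.isWave [IsScalarTower ℝ 𝕜 H] {w : ℝ → A.Sob 2} {w' : ℝ → A.Sob 1}
    {f : ℝ → H} (h : IsStrongSolution A T w w' f) :
    IsWave A.invSqrt (Icc 0 T) (fun t => A.halfPow 2 (w t)) (fun t => A.halfPow 1 (w' t)) f := by
  have hq : ContinuousOn (fun t => A.halfPow 1 (w' t)) (Icc 0 T) :=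
    (A.continuous_halfPow 1).comp_continuousOn h.continuousOn_vel
  refine ⟨(A.continuous_halfPow 2).comp_continuousOn h.continuousOn_pos, hq, h.continuousOn_source,
    ?_, fun t ht => ?_⟩
  · refine hasDerivWithinAt_of_functionals (fun y => innerSL 𝕜 (A.invSqrt y)) (fun x hx => ?_) hq
      fun y t ht => ?_
    · have h1 : A.invSqrt x = 0 := by
        refine inner_self_eq_zero (𝕜 := 𝕜) |>.1 ?_
        exact (A.isSymmetric_invSqrt (A.invSqrt x) x).symm.trans (hx (A.invSqrt x))
      exact A.invSqrt_injective (h1.trans (map_zero _).symm)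
    · have h1 := HasDerivWithinAt.clm_comp (innerSL 𝕜 y) (h.deriv_pos t ht)
      simp only [A.emb_one, A.emb_two, innerSL_apply_apply] at h1
      have h2 : ∀ x, ⟪A.invSqrt y, x⟫_𝕜 = ⟪y, A.invSqrt x⟫_𝕜 := fun x => A.isSymmetric_invSqrt y x
      simpa only [innerSL_apply_apply, h2] using h1
  · simpa only [A.emb_one, A.op_eq] using h.deriv_vel t ht

theorem IsWave.isStrongSolution {p q f : ℝ → H} (h : IsWave A.invSqrt (Icc 0 T) p q f)
    [IsScalarTower ℝ 𝕜 H] :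
    IsStrongSolution A T (fun t => (A.halfPow 2).symm (p t)) (fun t => (A.halfPow 1).symm (q t)) f :=
  { continuousOn_pos := (A.continuous_halfPow_symm 2).comp_continuousOn h.continuousOn_fst
    continuousOn_vel := (A.continuous_halfPow_symm 1).comp_continuousOn h.continuousOn_snd
    continuousOn_source := h.continuousOn_source
    deriv_pos := fun t ht => by
      simpa only [A.emb_one, A.emb_two, LinearEquiv.apply_symm_apply] using
        HasDerivWithinAt.clm_comp A.invSqrt (h.deriv_fst t ht)
    deriv_vel := fun t ht => by
      simpa only [A.emb_one, A.op_eq, LinearEquiv.apply_symm_apply] using h.deriv_snd t ht }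

theorem IsCascadeSolution.isCascade [IsScalarTower ℝ 𝕜 H] {m : ℕ} {C : Fin m → H →L[𝕜] H}
    {w : Fin (m + 1) → ℝ → A.Sob 2} {w' : Fin (m + 1) → ℝ → A.Sob 1}
    (h : IsCascadeSolution A C T w w') :
    IsCascade A.invSqrt C (Icc 0 T) (fun j t => A.halfPow 2 (w j t))
      (fun j t => A.halfPow 1 (w' j t)) :=
  ⟨h.first.isWave, fun j => by simpa only [A.emb_two] using (h.next j).isWave⟩

theorem IsCascade.isCascadeSolution [IsScalarTower ℝ 𝕜 H] {m : ℕ} {C : Fin m → H →L[𝕜] H}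
    {p q : Fin (m + 1) → ℝ → H} (h : IsCascade A.invSqrt C (Icc 0 T) p q) :
    IsCascadeSolution A C T (fun j t => (A.halfPow 2).symm (p j t))
      (fun j t => (A.halfPow 1).symm (q j t)) :=
  ⟨h.first.isStrongSolution, fun j => by
    simpa only [A.emb_two, LinearEquiv.apply_symm_apply] using (h.next j).isStrongSolution⟩

end Translation

/-! ### Linearity, time translation and existence for the cascade. -/

section Basic

variable {𝕜 H : Type*} [RCLike 𝕜] [NormedAddCommGroup H] [InnerProductSpace 𝕜 H]
  [NormedSpace ℝ H] {S : H →L[𝕜] H} {s : Set ℝ} {p q f p₁ q₁ f₁ : ℝ → H}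

theorem IsWave.mono (h : IsWave S s p q f) {t : Set ℝ} (hst : t ⊆ s) : IsWave S t p q f :=
  ⟨h.1.mono hst, h.2.mono hst, h.3.mono hst, fun x hx => (h.4 x (hst hx)).mono hst,
    fun x hx => (h.5 x (hst hx)).mono hst⟩

theorem IsWave.sub (h : IsWave S s p q f) (h₁ : IsWave S s p₁ q₁ f₁) :
    IsWave S s (fun t => p t - p₁ t) (fun t => q t - q₁ t) (fun t => f t - f₁ t) :=
  ⟨h.1.sub h₁.1, h.2.sub h₁.2, h.3.sub h₁.3,
    fun x hx => by simp only [map_sub]; exact (h.4 x hx).sub (h₁.4 x hx),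
    fun x hx => by
      simp only [map_sub]
      exact ((h.5 x hx).sub (h₁.5 x hx)).congr_deriv (sub_sub_sub_comm _ _ _ _)⟩

theorem IsWave.add (h : IsWave S s p q f) (h₁ : IsWave S s p₁ q₁ f₁) :
    IsWave S s (fun t => p t + p₁ t) (fun t => q t + q₁ t) (fun t => f t + f₁ t) :=
  ⟨h.1.add h₁.1, h.2.add h₁.2, h.3.add h₁.3,
    fun x hx => by simp only [map_add]; exact (h.4 x hx).add (h₁.4 x hx),
    fun x hx => by
      simp only [map_add]
      exact ((h.5 x hx).add (h₁.5 x hx)).congr_deriv (add_sub_add_comm _ _ _ _).symm⟩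

theorem IsWave.smul [IsScalarTower ℝ 𝕜 H] (c : 𝕜) (h : IsWave S s p q f) :
    IsWave S s (fun t => c • p t) (fun t => c • q t) (fun t => c • f t) :=
  have hL : ∀ {g : ℝ → H} {g' t}, HasDerivWithinAt g g' s t →
      HasDerivWithinAt (fun x => c • g x) (c • g') s t := fun hg =>
    HasDerivWithinAt.clm_comp (c • ContinuousLinearMap.id 𝕜 H) hg
  ⟨h.1.const_smul c, h.2.const_smul c, h.3.const_smul c,
    fun x hx => by simpa only [map_smul] using hL (h.4 x hx),
    fun x hx => by simpa only [map_smul, smul_sub] using hL (h.5 x hx)⟩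

theorem IsWave.comp_add_const (h : IsWave S s p q f) (c : ℝ) {t : Set ℝ}
    (ht : ∀ x ∈ t, x + c ∈ s) :
    IsWave S t (fun x => p (x + c)) (fun x => q (x + c)) (fun x => f (x + c)) := by
  have hcont : ContinuousOn (fun x : ℝ => x + c) t := (continuous_add_const c).continuousOn
  have hd : ∀ {g : ℝ → H} {g' x}, x ∈ t → HasDerivWithinAt g g' s (x + c) →
      HasDerivWithinAt (fun x => g (x + c)) g' t x := fun {g g' x} _ hg => by
    have := hg.scomp x ((hasDerivWithinAt_id x t).add_const c) ht
    simpa [Function.comp_def] using this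
  exact ⟨h.1.comp hcont ht, h.2.comp hcont ht, h.3.comp hcont ht,
    fun x hx => hd hx (h.4 _ (ht x hx)), fun x hx => hd hx (h.5 _ (ht x hx))⟩

variable {m : ℕ} {C : Fin m → H →L[𝕜] H} {P Q P₁ Q₁ : Fin (m + 1) → ℝ → H}

theorem IsCascade.mono (h : IsCascade S C s P Q) {t : Set ℝ} (hst : t ⊆ s) :
    IsCascade S C t P Q :=
  ⟨h.1.mono hst, fun j => (h.2 j).mono hst⟩

theorem IsCascade.isWave (h : IsCascade S C s P Q) (j : Fin (m + 1)) :
    ∃ f, IsWave S s (P j) (Q j) f := by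
  cases j using Fin.cases with
  | zero => exact ⟨_, h.first⟩
  | succ j => exact ⟨_, h.next j⟩

theorem IsCascade.add (h : IsCascade S C s P Q) (h₁ : IsCascade S C s P₁ Q₁) :
    IsCascade S C s (fun j t => P j t + P₁ j t) (fun j t => Q j t + Q₁ j t) :=
  ⟨by simpa only [add_zero] using h.1.add h₁.1, fun j => by
    simpa only [map_add, neg_add] using (h.2 j).add (h₁.2 j)⟩

theorem IsCascade.sub (h : IsCascade S C s P Q) (h₁ : IsCascade S C s P₁ Q₁) :
    IsCascade S C s (fun j t => P j t - P₁ j t) (fun j t => Q j t - Q₁ j t) :=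
  ⟨by simpa only [sub_zero] using h.1.sub h₁.1, fun j => by
    simpa only [map_sub, neg_sub, neg_sub_neg, sub_neg_eq_add, neg_add_eq_sub] using (h.2 j).sub (h₁.2 j)⟩

theorem IsCascade.smul [IsScalarTower ℝ 𝕜 H] (c : 𝕜) (h : IsCascade S C s P Q) :
    IsCascade S C s (fun j t => c • P j t) (fun j t => c • Q j t) :=
  ⟨by simpa only [smul_zero] using h.1.smul c, fun j => by
    simpa only [map_smul, smul_neg] using (h.2 j).smul c⟩

theorem IsCascade.comp_add_const (h : IsCascade S C s P Q) (c : ℝ) {t : Set ℝ}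
    (ht : ∀ x ∈ t, x + c ∈ s) :
    IsCascade S C t (fun j x => P j (x + c)) (fun j x => Q j (x + c)) :=
  ⟨h.1.comp_add_const c ht, fun j => (h.2 j).comp_add_const c ht⟩

theorem isCascade_zero : IsCascade S C s (fun _ _ => 0) (fun _ _ => 0) := by
  have : IsWave S s (fun _ => 0) (fun _ => 0) (fun _ => 0) :=
    ⟨continuousOn_const, continuousOn_const, continuousOn_const, fun t _ => by
      simpa using hasDerivWithinAt_const t s (0 : H), fun t _ => by
      simpa using hasDerivWithinAt_const t s (0 : H)⟩
  exact ⟨this, fun j => by simpa only [map_zero, neg_zero] using this⟩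

/-- The equations are solved one after the other. The relation `(S p)' = q` makes each coupling term
`-C (S (S p))` a `C¹` function with derivative `-C (S q)`, which is the regularity that
`exists_wave` asks of a source. -/
theorem exists_cascade [IsScalarTower ℝ 𝕜 H] [CompleteSpace H] {ι : Type*} (b : HilbertBasis ι 𝕜 H)
    (hsymm : (S : H →ₗ[𝕜] H).IsSymmetric) {μ : ι → ℝ} (hμ : ∀ i, 0 < μ i)
    (hb : ∀ i, S (b i) = (μ i : 𝕜) • b i) {m : ℕ} (C : Fin m → H →L[𝕜] H)
    (x y : Fin (m + 1) → H) :
    ∃ p q : Fin (m + 1) → ℝ → H, IsCascade S C univ p q ∧ (∀ j, p j 0 = x j) ∧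
      ∀ j, q j 0 = y j := by
  induction m with
  | zero =>
    obtain ⟨p, q, h, hp, hq⟩ := exists_wave b hsymm hμ hb (fun t => hasDerivAt_const t (0 : H))
      continuous_const (x 0) (y 0)
    exact ⟨fun _ => p, fun _ => q, ⟨h, fun j => j.elim0⟩, fun j => by rw [Fin.eq_zero j]; exact hp,
      fun j => by rw [Fin.eq_zero j]; exact hq⟩
  | succ m ih =>
    obtain ⟨p, q, h, hp, hq⟩ := ih (fun j => C j.castSucc) (fun j => x j.castSucc)
      fun j => y j.castSucc
    obtain ⟨f₀, h₀⟩ := h.isWave (Fin.last m)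
    obtain ⟨u, v, huv, hu, hv⟩ := exists_wave b hsymm hμ hb
      (f := fun t => -C (Fin.last m) (S (S (p (Fin.last m) t))))
      (f' := fun t => -C (Fin.last m) (S (q (Fin.last m) t)))
      (fun t => ((((C (Fin.last m)).comp S).restrictScalars ℝ).hasFDerivAt.comp_hasDerivAt t
        (hasDerivWithinAt_univ.1 (h₀.deriv_fst t (mem_univ t)))).neg)
      ((((C (Fin.last m)).comp S).continuous.comp
        (continuousOn_univ.1 h₀.continuousOn_snd)).neg) (x (Fin.last _)) (y (Fin.last _))
    refine ⟨Fin.snoc (α := fun _ => ℝ → H) p u, Fin.snoc (α := fun _ => ℝ → H) q v,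
      ⟨?_, fun j => ?_⟩, fun j => ?_, fun j => ?_⟩
    · have := h.first
      rw [← Fin.castSucc_zero, Fin.snoc_castSucc, Fin.snoc_castSucc]
      exact this
    · cases j using Fin.lastCases with
      | last => simpa only [Fin.succ_last, Fin.snoc_last, Fin.snoc_castSucc] using huv
      | cast j => simpa only [← Fin.castSucc_succ, Fin.snoc_castSucc] using h.next j
    · cases j using Fin.lastCases with
      | last => rw [Fin.snoc_last, hu]
      | cast j => rw [Fin.snoc_castSucc, hp]
    · cases j using Fin.lastCases with
      | last => rw [Fin.snoc_last, hv]
      | cast j => rw [Fin.snoc_castSucc, hq]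

end Basic

/-! ### Grönwall inequality and sliding windows for real functions. -/

section RealLemmas

theorem ContinuousOn.intervalIntegrable_sub {E : Type*} [NormedAddCommGroup E] {g : ℝ → E}
    {a b c d : ℝ} (hg : ContinuousOn g (Icc a b)) (hc : c ∈ Icc a b) (hd : d ∈ Icc a b) :
    IntervalIntegrable g volume c d :=
  (hg.mono (uIcc_subset_Icc hc hd)).intervalIntegrable

theorem integral_le_integral_of_subinterval {g : ℝ → ℝ} {a b c d : ℝ}
    (hg : ContinuousOn g (Icc a b)) (h0 : ∀ t ∈ Icc a b, 0 ≤ g t) (hac : a ≤ c) (hcd : c ≤ d)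
    (hdb : d ≤ b) : ∫ t in c..d, g t ≤ ∫ t in a..b, g t := by
  refine intervalIntegral.integral_mono_interval hac hcd hdb ?_
    (ContinuousOn.intervalIntegrable_sub hg ⟨le_rfl, by linarith⟩ ⟨by linarith, le_rfl⟩)
  refine (ae_restrict_iff' measurableSet_Ioc).2 (Eventually.of_forall fun t ht => ?_)
  exact h0 t (Ioc_subset_Icc_self ht)

theorem integral_nonneg_of_continuousOn {g : ℝ → ℝ} {a b : ℝ} (hab : a ≤ b)
    (h0 : ∀ t ∈ Icc a b, 0 ≤ g t) : 0 ≤ ∫ t in a..b, g t :=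
  intervalIntegral.integral_nonneg hab h0

/-- Two-sided Grönwall inequality. -/
theorem le_exp_mul_of_abs_deriv_le {E E' h : ℝ → ℝ} {a b ε : ℝ} (hε : 0 ≤ ε)
    (hE : ∀ t ∈ Icc a b, HasDerivWithinAt E (E' t) (Icc a b) t) (hE0 : ∀ t ∈ Icc a b, 0 ≤ E t)
    (hh : ContinuousOn h (Icc a b)) (hh0 : ∀ t ∈ Icc a b, 0 ≤ h t)
    (hb : ∀ t ∈ Icc a b, |E' t| ≤ ε * E t + h t) {s t : ℝ} (hs : s ∈ Icc a b) (ht : t ∈ Icc a b) :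
    E t ≤ Real.exp (ε * (b - a)) * (E s + ∫ x in a..b, h x) := by
  obtain ⟨U, hU0, hU⟩ := exists_hasDerivAt_of_continuousOn hh 0
  have hab : a ≤ b := hs.1.trans hs.2
  have hcE : ContinuousOn E (Icc a b) := fun t ht => (hE t ht).continuousWithinAt
  have hcU : ContinuousOn U (Icc a b) := fun t ht => (hU t ht).continuousAt.continuousWithinAt
  have hUint : ∀ c d, c ∈ Icc a b → d ∈ Icc a b → ∫ x in c..d, h x = U d - U c := by
    intro c d hc hd
    refine intervalIntegral.integral_eq_sub_of_hasDerivAt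
      (fun x hx => hU x (uIcc_subset_Icc hc hd hx)) (ContinuousOn.intervalIntegrable_sub hh hc hd)
  have hbound : ∀ c d, c ∈ Icc a b → d ∈ Icc a b → c ≤ d → U d - U c ≤ ∫ x in a..b, h x := by
    intro c d hc hd hcd
    rw [← hUint c d hc hd]
    exact integral_le_integral_of_subinterval hh hh0 hc.1 hcd hd.2
  have hI0 : 0 ≤ ∫ x in a..b, h x := integral_nonneg_of_continuousOn hab hh0
  have hEd : ∀ x ∈ Ioo a b, HasDerivAt E (E' x) x := fun x hx =>
    (hE x (Ioo_subset_Icc_self hx)).hasDerivAt (Icc_mem_nhds hx.1 hx.2)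
  have main : ∀ r, 0 ≤ r → r ≤ ε * (b - a) → ∀ I, I ≤ ∫ x in a..b, h x →
      Real.exp (-r) * E t ≤ E s + I → E t ≤ Real.exp (ε * (b - a)) * (E s + ∫ x in a..b, h x) := by
    intro r _ hr I hI h1
    have h2 : E t ≤ Real.exp r * (E s + I) := by
      have := mul_le_mul_of_nonneg_left h1 (Real.exp_pos r).le
      rwa [← mul_assoc, ← Real.exp_add, add_neg_cancel, Real.exp_zero, one_mul] at this
    have h3 : 0 ≤ E s + ∫ x in a..b, h x := add_nonneg (hE0 s hs) hI0
    calc E t ≤ Real.exp r * (E s + I) := h2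
      _ ≤ Real.exp r * (E s + ∫ x in a..b, h x) := by gcongr
      _ ≤ _ := by gcongr
  -- Forward in time `exp(-ε(x-s)) E - U` decreases; backward in time `exp(ε(x-s)) E + U` increases.
  -- On the relevant side of `s` the exponential is at most one, so it can be dropped in front of
  -- `h`.
  rcases le_total s t with hst | hst
  · have hsub : Icc s t ⊆ Icc a b := Icc_subset_Icc hs.1 ht.2
    have hanti : AntitoneOn (fun x => Real.exp (-(ε * (x - s))) * E x - U x) (Icc s t) := by
      have hd : ∀ x ∈ interior (Icc s t), HasDerivAt (fun x => Real.exp (-(ε * (x - s))) * E x - U x)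
          (Real.exp (-(ε * (x - s))) * (-(ε * 1)) * E x + Real.exp (-(ε * (x - s))) * E' x - h x) x := by
        intro x hx
        rw [interior_Icc] at hx
        have hx' : x ∈ Ioo a b := ⟨hs.1.trans_lt hx.1, hx.2.trans_le ht.2⟩
        exact ((((((hasDerivAt_id' x).sub_const s).const_mul ε).neg.exp).mul (hEd x hx')).sub
          (hU x (Ioo_subset_Icc_self hx')))
      refine antitoneOn_of_deriv_nonpos (convex_Icc s t) ?_
        (fun x hx => (hd x hx).differentiableAt.differentiableWithinAt) fun x hx => ?_
      · exact (ContinuousOn.mul (by fun_prop) (hcE.mono hsub)).sub (hcU.mono hsub)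
      · rw [(hd x hx).deriv]
        have hx1 : x ∈ Icc s t := interior_subset hx
        have hx' := hsub hx1
        have h1 := (abs_le.1 (hb x hx')).2
        have h2 : Real.exp (-(ε * (x - s))) ≤ 1 := by
          rw [Real.exp_le_one_iff]
          have := mul_nonneg hε (sub_nonneg.2 hx1.1)
          linarith
        have h3 := Real.exp_pos (-(ε * (x - s)))
        have h4 : Real.exp (-(ε * (x - s))) * (E' x - ε * E x) ≤
            Real.exp (-(ε * (x - s))) * h x := by
          gcongr; linarith
        have h5 : Real.exp (-(ε * (x - s))) * h x ≤ 1 * h x := by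
          gcongr; exact hh0 x hx'
        linarith
    have h1 := hanti (left_mem_Icc.2 hst) (right_mem_Icc.2 hst) hst
    simp only [sub_self, mul_zero, neg_zero, Real.exp_zero, one_mul] at h1
    refine main (ε * (t - s)) (mul_nonneg hε (by linarith)) ?_ (U t - U s)
      (hbound s t hs ht hst) (by linarith)
    have := hs.1; have := ht.2
    gcongr
  · have hsub : Icc t s ⊆ Icc a b := Icc_subset_Icc ht.1 hs.2
    have hmono : MonotoneOn (fun x => Real.exp (ε * (x - s)) * E x + U x) (Icc t s) := by
      have hd : ∀ x ∈ interior (Icc t s), HasDerivAt (fun x => Real.exp (ε * (x - s)) * E x + U x)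
          (Real.exp (ε * (x - s)) * (ε * 1) * E x + Real.exp (ε * (x - s)) * E' x + h x) x := by
        intro x hx
        rw [interior_Icc] at hx
        have hx' : x ∈ Ioo a b := ⟨ht.1.trans_lt hx.1, hx.2.trans_le hs.2⟩
        exact ((((((hasDerivAt_id' x).sub_const s).const_mul ε).exp).mul (hEd x hx')).add
          (hU x (Ioo_subset_Icc_self hx')))
      refine monotoneOn_of_deriv_nonneg (convex_Icc t s) ?_
        (fun x hx => (hd x hx).differentiableAt.differentiableWithinAt) fun x hx => ?_
      · exact (ContinuousOn.mul (by fun_prop) (hcE.mono hsub)).add (hcU.mono hsub)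
      · rw [(hd x hx).deriv]
        have hx1 : x ∈ Icc t s := interior_subset hx
        have hx' := hsub hx1
        have h1 := (abs_le.1 (hb x hx')).1
        have h2 : Real.exp (ε * (x - s)) ≤ 1 := by
          rw [Real.exp_le_one_iff]
          exact mul_nonpos_of_nonneg_of_nonpos hε (sub_nonpos.2 hx1.2)
        have h3 := Real.exp_pos (ε * (x - s))
        have h4 : Real.exp (ε * (x - s)) * (-(E' x) - ε * E x) ≤ Real.exp (ε * (x - s)) * h x := by
          gcongr; linarith
        have h5 : Real.exp (ε * (x - s)) * h x ≤ 1 * h x := by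
          gcongr; exact hh0 x hx'
        linarith
    have h1 := hmono (left_mem_Icc.2 hst) (right_mem_Icc.2 hst) hst
    simp only [sub_self, mul_zero, Real.exp_zero, one_mul] at h1
    refine main (ε * (s - t)) (mul_nonneg hε (by linarith)) ?_ (U s - U t)
      (hbound t s ht hs hst) ?_
    · have := hs.2; have := ht.1
      gcongr
    · rw [show -(ε * (s - t)) = ε * (t - s) by ring]
      linarith

/-- Averaging an estimate over sliding windows of length `τ`. -/
theorem integral_le_of_window_le {E g : ℝ → ℝ} {a b τ K : ℝ} (hab : a ≤ b) (hτ : 0 ≤ τ) (hK : 0 ≤ K)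
    (hE : ContinuousOn E (Icc a b)) (hg : ContinuousOn g (Icc a (b + τ)))
    (hg0 : ∀ t ∈ Icc a (b + τ), 0 ≤ g t)
    (h : ∀ s ∈ Icc a b, E s ≤ K * ∫ t in s..s + τ, g t) :
    ∫ t in a..b, E t ≤ K * τ * ∫ t in a..b + τ, g t := by
  obtain ⟨U, hU0, hU⟩ := exists_hasDerivAt_of_continuousOn hg 0
  have hUint : ∀ c d, c ∈ Icc a (b + τ) → d ∈ Icc a (b + τ) → ∫ x in c..d, g x = U d - U c := by
    intro c d hc hd
    refine intervalIntegral.integral_eq_sub_of_hasDerivAt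
      (fun x hx => hU x (uIcc_subset_Icc hc hd hx)) (ContinuousOn.intervalIntegrable_sub hg hc hd)
  have hcU : ContinuousOn U (Icc a (b + τ)) := fun t ht => (hU t ht).continuousAt.continuousWithinAt
  have hmem : ∀ {x}, a ≤ x → x ≤ b + τ → x ∈ Icc a (b + τ) := fun h1 h2 => ⟨h1, h2⟩
  have hmono : ∀ x y, a ≤ x → x ≤ y → y ≤ b + τ → U x ≤ U y := by
    intro x y hx hxy hy
    have := intervalIntegral.integral_nonneg (μ := volume) hxy fun t (ht : t ∈ Icc x y) =>
      hg0 t ⟨hx.trans ht.1, ht.2.trans hy⟩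
    rw [hUint x y ⟨hx, hxy.trans hy⟩ ⟨hx.trans hxy, hy⟩] at this
    linarith
  have hUi : ∀ c d, c ∈ Icc a (b + τ) → d ∈ Icc a (b + τ) → IntervalIntegrable U volume c d :=
    fun c d hc hd => ContinuousOn.intervalIntegrable_sub hcU hc hd
  have haa : a ∈ Icc a (b + τ) := ⟨le_rfl, by linarith⟩
  have hbb : b ∈ Icc a (b + τ) := ⟨hab, by linarith⟩
  have haτ : a + τ ∈ Icc a (b + τ) := ⟨by linarith, by linarith⟩
  have hbτ : b + τ ∈ Icc a (b + τ) := ⟨by linarith, le_rfl⟩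
  have hshift : ContinuousOn (fun s => U (s + τ)) (Icc a b) :=
    hcU.comp (continuous_add_const τ).continuousOn fun x hx => ⟨by linarith [hx.1], by linarith [hx.2]⟩
  have h1 : ∫ t in a..b, E t ≤ ∫ s in a..b, K * (U (s + τ) - U s) := by
    refine intervalIntegral.integral_mono_on hab (hE.intervalIntegrable_of_Icc hab)
      (((hshift.sub (hcU.mono (Icc_subset_Icc_right (by linarith)))).const_smul
        K).intervalIntegrable_of_Icc hab) fun s hs => ?_
    rw [← hUint s (s + τ) ⟨hs.1, by linarith [hs.2]⟩ ⟨by linarith [hs.1], by linarith [hs.2]⟩]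
    exact h s hs
  refine h1.trans ?_
  rw [intervalIntegral.integral_const_mul, intervalIntegral.integral_sub
    (hshift.intervalIntegrable_of_Icc hab) (hUi a b haa hbb),
    intervalIntegral.integral_comp_add_right, mul_assoc]
  refine mul_le_mul_of_nonneg_left ?_ hK
  -- Fubini's theorem is replaced by a telescoping of the primitive `U` of `g`: what remains is the
  -- integral of `U` over the last window minus that over the first, and `U` is monotone.
  have h2 : ∫ x in a + τ..b + τ, U x = (∫ x in a..b, U x) - (∫ x in a..a + τ, U x) +
      ∫ x in b..b + τ, U x := by
    have e1 := intervalIntegral.integral_add_adjacent_intervals (hUi _ _ haa haτ) (hUi _ _ haτ hbτ)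
    have e2 := intervalIntegral.integral_add_adjacent_intervals (hUi _ _ haa hbb) (hUi _ _ hbb hbτ)
    linarith
  have h3 : ∫ x in b..b + τ, U x ≤ ∫ _x in b..b + τ, U (b + τ) :=
    intervalIntegral.integral_mono_on (by linarith) (hUi _ _ hbb hbτ) (by simp) fun x hx =>
      hmono x _ (by linarith [hx.1]) hx.2 le_rfl
  have h4 : ∫ _x in a..a + τ, U a ≤ ∫ x in a..a + τ, U x :=
    intervalIntegral.integral_mono_on (by linarith) (by simp) (hUi _ _ haa haτ) fun x hx =>
      hmono a x le_rfl hx.1 (by linarith [hx.2])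
  rw [intervalIntegral.integral_const, smul_eq_mul] at h3 h4
  rw [hUint a (b + τ) haa hbτ, h2]
  nlinarith

end RealLemmas

/-! ### Energies of a wave and their growth. -/

section Powers

variable {𝕜 H : Type*} [RCLike 𝕜] [NormedAddCommGroup H] [InnerProductSpace 𝕜 H]

theorem pow_comm_apply (S : H →L[𝕜] H) (k : ℕ) (x : H) : (S ^ k) (S x) = S ((S ^ k) x) := by
  have h := pow_succ S k
  rw [pow_succ'] at h
  exact (congrArg (fun L : H →L[𝕜] H => L x) h).symm

theorem pow_succ_apply_left (S : H →L[𝕜] H) (k : ℕ) (x : H) : (S ^ (k + 1)) x = S ((S ^ k) x) := by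
  rw [pow_succ']; rfl

/-- The energy `(|A^{1/2} w|² + |w'|²) / 2` in the variables of `IsWave`. -/
noncomputable def waveEnergy (S : H →L[𝕜] H) (p q : ℝ → H) (t : ℝ) : ℝ :=
  (‖S (p t)‖ ^ 2 + ‖S (q t)‖ ^ 2) / 2

theorem waveEnergy_nonneg (S : H →L[𝕜] H) (p q : ℝ → H) (t : ℝ) : 0 ≤ waveEnergy S p q t := by
  unfold waveEnergy; positivity

end Powers

section Energy

variable {𝕜 H : Type*} [RCLike 𝕜] [NormedAddCommGroup H] [InnerProductSpace 𝕜 H]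
  [NormedSpace ℝ H] {S : H →L[𝕜] H} {a b : ℝ} {s : Set ℝ} {p q f : ℝ → H}

theorem hasDerivWithinAt_re_inner {F K : ℝ → H} {F' K' : H} {t : ℝ}
    (hF : HasDerivWithinAt F F' s t) (hK : HasDerivWithinAt K K' s t) :
    HasDerivWithinAt (fun t => RCLike.re ⟪F t, K t⟫_𝕜)
      (RCLike.re ⟪F t, K'⟫_𝕜 + RCLike.re ⟪F', K t⟫_𝕜) s t := by
  rw [← map_add]
  exact (RCLike.reCLM (K := 𝕜)).hasFDerivAt.comp_hasDerivWithinAt t (hF.inner 𝕜 hK)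

/-- The energy identity at the level of order `1 - k`. Powers of `S` commute with the equation, and
the cross terms between `p` and `q` cancel by the symmetry of `S`. -/
theorem IsWave.hasDerivWithinAt_energy [IsScalarTower ℝ 𝕜 H]
    (hS : (S : H →ₗ[𝕜] H).IsSymmetric) (h : IsWave S s p q f) (k : ℕ) {t : ℝ} (ht : t ∈ s) :
    HasDerivWithinAt (fun t => ‖(S ^ (k + 1)) (p t)‖ ^ 2 + ‖(S ^ (k + 1)) (q t)‖ ^ 2)
      (2 * RCLike.re ⟪(S ^ (k + 1)) (q t), (S ^ k) (f t)⟫_𝕜) s t := by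
  have h1 := HasDerivWithinAt.clm_comp (S ^ k) (h.deriv_fst t ht)
  have h2 := HasDerivWithinAt.clm_comp (S ^ k) (h.deriv_snd t ht)
  have h3 := (hasDerivWithinAt_re_inner (𝕜 := 𝕜) h1 h1).add (hasDerivWithinAt_re_inner (𝕜 := 𝕜) h2 h2)
  simp only [inner_self_eq_norm_sq, pow_comm_apply] at h3
  simp only [pow_succ_apply_left]
  refine h3.congr_deriv ?_
  simp only [map_sub, inner_sub_left, inner_sub_right]
  have e : ∀ x y, RCLike.re ⟪S x, y⟫_𝕜 = RCLike.re ⟪x, S y⟫_𝕜 := fun x y =>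
    congrArg RCLike.re (hS x y)
  have c : ∀ x y : H, RCLike.re ⟪x, y⟫_𝕜 = RCLike.re ⟪y, x⟫_𝕜 := fun x y => inner_re_symm x y
  rw [c ((S ^ k) (q t)) _, c ((S ^ k) (f t)) _, c ((S ^ k) (p t)) _]
  rw [e ((S ^ k) (p t)), c ((S ^ k) (p t))]
  ring

theorem IsWave.continuousOn_waveEnergy (h : IsWave S s p q f) :
    ContinuousOn (waveEnergy S p q) s :=
  (((S.continuous.comp_continuousOn h.continuousOn_fst).norm.pow 2).add
    ((S.continuous.comp_continuousOn h.continuousOn_snd).norm.pow 2)).div_const 2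

theorem IsWave.hasDerivWithinAt_waveEnergy [IsScalarTower ℝ 𝕜 H]
    (hS : (S : H →ₗ[𝕜] H).IsSymmetric) (h : IsWave S s p q f) {t : ℝ} (ht : t ∈ s) :
    HasDerivWithinAt (waveEnergy S p q) (RCLike.re ⟪S (q t), f t⟫_𝕜) s t := by
  have := (h.hasDerivWithinAt_energy hS 0 ht).div_const 2
  simp only [zero_add, pow_one, pow_zero, one_apply_eq_self] at this
  exact this.congr_deriv (mul_div_cancel_left₀ _ two_ne_zero)

/-- Grönwall with rate `1 / (b - a)`: the exponential factor is `e < 3` whatever the length of the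
interval, at the price of the factor `b - a` in front of the source. The independence of the length
matters, since the interval later becomes arbitrarily long. -/
theorem IsWave.waveEnergy_le [IsScalarTower ℝ 𝕜 H] (hS : (S : H →ₗ[𝕜] H).IsSymmetric)
    (h : IsWave S (Icc a b) p q f) {s t : ℝ} (hs : s ∈ Icc a b) (ht : t ∈ Icc a b) :
    waveEnergy S p q t ≤ 3 * (waveEnergy S p q s + (b - a) * ∫ x in a..b, ‖f x‖ ^ 2) := by
  rcases (hs.1.trans hs.2).eq_or_lt with hab | hab
  · subst hab
    have : s = t := le_antisymm (hs.2.trans ht.1) (ht.2.trans hs.1)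
    subst this
    have := waveEnergy_nonneg S p q s
    simp
    linarith
  have hl : 0 < b - a := sub_pos.2 hab
  have hc : ContinuousOn (fun x => (b - a) * ‖f x‖ ^ 2) (Icc a b) :=
    (h.continuousOn_source.norm.pow 2).const_smul (b - a)
  have h1 := le_exp_mul_of_abs_deriv_le (E := waveEnergy S p q) (ε := 1 / (b - a))
    (h := fun x => (b - a) * ‖f x‖ ^ 2) (by positivity)
    (fun t ht => h.hasDerivWithinAt_waveEnergy hS ht) (fun t _ => waveEnergy_nonneg S p q t) hc
    (fun t _ => by positivity) (fun t ht => ?_) hs ht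
  · rw [one_div_mul_cancel hl.ne', intervalIntegral.integral_const_mul] at h1
    refine h1.trans (mul_le_mul_of_nonneg_right ?_ ?_)
    · exact Real.exp_one_lt_three.le
    · have := waveEnergy_nonneg S p q s
      have h2 : 0 ≤ ∫ x in a..b, ‖f x‖ ^ 2 :=
        intervalIntegral.integral_nonneg hab.le fun _ _ => by positivity
      positivity
  · have h2 : |RCLike.re ⟪S (q t), f t⟫_𝕜| ≤ ‖S (q t)‖ * ‖f t‖ :=
      (RCLike.abs_re_le_norm _).trans (norm_inner_le_norm _ _)
    refine h2.trans ?_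
    have h3 : ‖S (q t)‖ ^ 2 / 2 ≤ waveEnergy S p q t := by
      unfold waveEnergy; nlinarith [sq_nonneg ‖S (p t)‖]
    have h4 : ‖S (q t)‖ * ‖f t‖ ≤ 1 / (b - a) * (‖S (q t)‖ ^ 2 / 2) + (b - a) * ‖f t‖ ^ 2 := by
      have h5 : 1 / (b - a) * (‖S (q t)‖ ^ 2 / 2) + (b - a) * ‖f t‖ ^ 2 - ‖S (q t)‖ * ‖f t‖ =
          (‖S (q t)‖ - (b - a) * ‖f t‖) ^ 2 / (2 * (b - a)) + (b - a) * ‖f t‖ ^ 2 / 2 := by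
        field_simp; ring
      have : 0 ≤ (‖S (q t)‖ - (b - a) * ‖f t‖) ^ 2 / (2 * (b - a)) + (b - a) * ‖f t‖ ^ 2 / 2 := by
        positivity
      linarith
    refine h4.trans ?_
    gcongr

end Energy

/-! ### Observability inequality for waves with a source. -/

section Windows

variable {𝕜 H G : Type*} [RCLike 𝕜] [NormedAddCommGroup H] [InnerProductSpace 𝕜 H]
  [NormedSpace ℝ H] [NormedAddCommGroup G] [NormedSpace 𝕜 G] {S : H →L[𝕜] H}

/-- Admissibility of the observation `B (A w, w')`, in the variables of `IsWave`. -/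
def WaveAdmissible (S : H →L[𝕜] H) (B : H × H →L[𝕜] G) : Prop :=
  ∀ T : ℝ, 0 < T → ∃ D : ℝ, 0 < D ∧ ∀ p q f, IsWave S (Icc 0 T) p q f →
    ∫ t in (0 : ℝ)..T, ‖B (p t, S (q t))‖ ^ 2 ≤
      D * (waveEnergy S p q 0 + waveEnergy S p q T +
        (∫ t in (0 : ℝ)..T, waveEnergy S p q t) + ∫ t in (0 : ℝ)..T, ‖f t‖ ^ 2)

/-- Observability through `B (A w, w')`, in the variables of `IsWave`. -/
def WaveObservable (S : H →L[𝕜] H) (B : H × H →L[𝕜] G) : Prop :=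
  ∃ T₀ : ℝ, 0 < T₀ ∧ ∀ T > T₀, ∃ R : ℝ, 0 < R ∧ ∀ p q, IsWave S (Icc 0 T) p q (fun _ => 0) →
    R * waveEnergy S p q 0 ≤ ∫ t in (0 : ℝ)..T, ‖B (p t, S (q t))‖ ^ 2

theorem IsWave.continuousOn_obs {s : Set ℝ} {p q f : ℝ → H} (h : IsWave S s p q f)
    (B : H × H →L[𝕜] G) : ContinuousOn (fun t => ‖B (p t, S (q t))‖ ^ 2) s :=
  (B.continuous.comp_continuousOn (h.continuousOn_fst.prodMk
    (S.continuous.comp_continuousOn h.continuousOn_snd))).norm.pow 2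

theorem norm_sub_sq_le_two_mul {E : Type*} [SeminormedAddCommGroup E] (x y : E) :
    ‖x - y‖ ^ 2 ≤ 2 * ‖x‖ ^ 2 + 2 * ‖y‖ ^ 2 := by
  have h := norm_sub_le x y
  have h2 : ‖x - y‖ ^ 2 ≤ (‖x‖ + ‖y‖) ^ 2 := by gcongr
  nlinarith [sq_nonneg (‖x‖ - ‖y‖)]

/-- An admissible and observable observation controls the initial energy of the solutions of the
equation with a source. -/
theorem waveEnergy_le_window [IsScalarTower ℝ 𝕜 H] (hS : (S : H →ₗ[𝕜] H).IsSymmetric)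
    (hex : ∀ x y : H, ∃ p q : ℝ → H, IsWave S univ p q (fun _ => 0) ∧ p 0 = x ∧ q 0 = y)
    {B : H × H →L[𝕜] G} (hadm : WaveAdmissible S B) (hobs : WaveObservable S B) :
    ∃ τ K : ℝ, 0 < τ ∧ 0 < K ∧ ∀ p q f s, IsWave S (Icc s (s + τ)) p q f →
      waveEnergy S p q s ≤ K * ∫ t in s..s + τ, (‖B (p t, S (q t))‖ ^ 2 + ‖f t‖ ^ 2) := by
  obtain ⟨T₀, hT₀, hobs⟩ := hobs
  set τ := T₀ + 1 with hτdef
  have hτ : 0 < τ := by positivity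
  obtain ⟨R, hR, hobs⟩ := hobs τ (by linarith)
  obtain ⟨D, hD, hadm⟩ := hadm τ hτ
  have key : ∀ p q f, IsWave S (Icc 0 τ) p q f → waveEnergy S p q 0 ≤
      2 / R * (1 + D * (1 + 3 * τ + 3 * τ ^ 2)) *
        ∫ t in (0 : ℝ)..τ, (‖B (p t, S (q t))‖ ^ 2 + ‖f t‖ ^ 2) := by
    intro p q f h
    -- The solution is split into the free wave with the same data, to which observability applies,
    -- and a wave with zero data driven by `f`, whose energy and observation are bounded by the
    -- source through admissibility.
    obtain ⟨p₀, q₀, h₀, hp₀, hq₀⟩ := hex (p 0) (q 0)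
    replace h₀ := h₀.mono (subset_univ (Icc 0 τ))
    have h₁ := h.sub h₀
    simp only [sub_zero] at h₁
    have h0mem : (0 : ℝ) ∈ Icc 0 τ := ⟨le_rfl, hτ.le⟩
    have hE0 : waveEnergy S (fun t => p t - p₀ t) (fun t => q t - q₀ t) 0 = 0 := by
      simp [waveEnergy, hp₀, hq₀]
    have hEt : ∀ t ∈ Icc 0 τ, waveEnergy S (fun t => p t - p₀ t) (fun t => q t - q₀ t) t ≤
        3 * τ * ∫ x in (0 : ℝ)..τ, ‖f x‖ ^ 2 := by
      intro t ht
      have := h₁.waveEnergy_le hS h0mem ht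
      rw [hE0] at this
      linarith
    set F := ∫ x in (0 : ℝ)..τ, ‖f x‖ ^ 2 with hF
    have hF0 : 0 ≤ F := intervalIntegral.integral_nonneg hτ.le fun _ _ => by positivity
    have hI : ∫ t in (0 : ℝ)..τ, waveEnergy S (fun t => p t - p₀ t) (fun t => q t - q₀ t) t ≤
        3 * τ ^ 2 * F := by
      have := intervalIntegral.integral_mono_on hτ.le
        (h₁.continuousOn_waveEnergy.intervalIntegrable_of_Icc hτ.le)
        (intervalIntegrable_const (μ := volume) (c := 3 * τ * F)) hEt
      simp only [intervalIntegral.integral_const, smul_eq_mul] at this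
      nlinarith
    have hB₁ := hadm _ _ _ h₁
    have hB₀ := hobs _ _ h₀
    have hcB := h.continuousOn_obs B
    have hcB₁ := h₁.continuousOn_obs B
    have h2 : ∫ t in (0 : ℝ)..τ, ‖B (p₀ t, S (q₀ t))‖ ^ 2 ≤
        ∫ t in (0 : ℝ)..τ, (2 * ‖B (p t, S (q t))‖ ^ 2 +
          2 * ‖B (p t - p₀ t, S (q t - q₀ t))‖ ^ 2) := by
      refine intervalIntegral.integral_mono_on hτ.le
        ((h₀.continuousOn_obs B).intervalIntegrable_of_Icc hτ.le)
        (((hcB.intervalIntegrable_of_Icc hτ.le).const_mul 2).add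
          ((hcB₁.intervalIntegrable_of_Icc hτ.le).const_mul 2))
        fun t _ => ?_
      have := norm_sub_sq_le_two_mul (B (p t, S (q t))) (B (p t - p₀ t, S (q t - q₀ t)))
      rwa [show B (p t, S (q t)) - B (p t - p₀ t, S (q t - q₀ t)) = B (p₀ t, S (q₀ t)) by
        rw [← map_sub]; simp] at this
    have hFc : ContinuousOn (fun t => ‖f t‖ ^ 2) (Icc 0 τ) := h.continuousOn_source.norm.pow 2
    rw [intervalIntegral.integral_add
      ((hcB.intervalIntegrable_of_Icc hτ.le).const_mul 2)
      ((hcB₁.intervalIntegrable_of_Icc hτ.le).const_mul 2),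
      intervalIntegral.integral_const_mul, intervalIntegral.integral_const_mul] at h2
    rw [intervalIntegral.integral_add (hcB.intervalIntegrable_of_Icc hτ.le)
      (hFc.intervalIntegrable_of_Icc hτ.le), ← hF]
    set O := ∫ t in (0 : ℝ)..τ, ‖B (p t, S (q t))‖ ^ 2 with hO
    have hO0 : 0 ≤ O := intervalIntegral.integral_nonneg hτ.le fun _ _ => by positivity
    have hEe : waveEnergy S p q 0 = waveEnergy S p₀ q₀ 0 := by simp [waveEnergy, hp₀, hq₀]
    have h3 := hEt τ ⟨hτ.le, le_rfl⟩
    rw [hE0] at hB₁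
    have h4 : R * waveEnergy S p q 0 ≤ 2 * O + 2 * (D * (0 + 3 * τ * F + 3 * τ ^ 2 * F + F)) := by
      rw [hEe]
      refine hB₀.trans (h2.trans ?_)
      gcongr
      refine hB₁.trans ?_
      gcongr
    have h5 : 2 * O + 2 * (D * (0 + 3 * τ * F + 3 * τ ^ 2 * F + F)) ≤
        2 * (1 + D * (1 + 3 * τ + 3 * τ ^ 2)) * (O + F) := by
      have : 0 ≤ D * (1 + 3 * τ + 3 * τ ^ 2) * O := by positivity
      nlinarith
    rw [div_mul_eq_mul_div, div_mul_eq_mul_div, le_div_iff₀ hR]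
    linarith
  refine ⟨τ, 2 / R * (1 + D * (1 + 3 * τ + 3 * τ ^ 2)), hτ, by positivity, fun p q f s h => ?_⟩
  -- The equation is autonomous, so the estimate at time `0` holds at every `s` with the same
  -- constants.
  have h1 := key _ _ _ (h.comp_add_const s (t := Icc 0 τ) fun x hx =>
    ⟨by linarith [hx.1], by linarith [hx.2]⟩)
  have h2 := intervalIntegral.integral_comp_add_right (a := 0) (b := τ)
    (fun t => ‖B (p t, S (q t))‖ ^ 2 + ‖f t‖ ^ 2) s
  rw [h2, zero_add, add_comm τ s] at h1
  simpa [waveEnergy] using h1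

/-- A bounded observation of the velocity is admissible. -/
theorem waveAdmissible_velocity [IsScalarTower ℝ 𝕜 H] (L : H →L[𝕜] G) :
    WaveAdmissible S (L ∘L ContinuousLinearMap.snd 𝕜 H H) := by
  intro T hT
  refine ⟨2 * ‖L‖ ^ 2 + 1, by positivity, fun p q f h => ?_⟩
  have h1 : ∫ t in (0 : ℝ)..T, ‖(L ∘L ContinuousLinearMap.snd 𝕜 H H) (p t, S (q t))‖ ^ 2 ≤
      ∫ t in (0 : ℝ)..T, (2 * ‖L‖ ^ 2 + 1) * waveEnergy S p q t := by
    refine intervalIntegral.integral_mono_on hT.le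
      ((h.continuousOn_obs _).intervalIntegrable_of_Icc hT.le)
      ((h.continuousOn_waveEnergy.const_smul (2 * ‖L‖ ^ 2 + 1)).intervalIntegrable_of_Icc hT.le)
      fun t _ => ?_
    have h2 : ‖L (S (q t))‖ ^ 2 ≤ (‖L‖ * ‖S (q t)‖) ^ 2 := by
      gcongr; exact L.le_opNorm _
    have h3 := waveEnergy_nonneg S p q t
    have h4 : ‖S (q t)‖ ^ 2 ≤ 2 * waveEnergy S p q t := by
      unfold waveEnergy; nlinarith [sq_nonneg ‖S (p t)‖]
    calc ‖L (S (q t))‖ ^ 2 ≤ ‖L‖ ^ 2 * ‖S (q t)‖ ^ 2 := by rwa [← mul_pow]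
      _ ≤ ‖L‖ ^ 2 * (2 * waveEnergy S p q t) := by gcongr
      _ ≤ _ := by nlinarith
  rw [intervalIntegral.integral_const_mul] at h1
  refine h1.trans (mul_le_mul_of_nonneg_left ?_ (by positivity))
  have h2 : 0 ≤ ∫ t in (0 : ℝ)..T, ‖f t‖ ^ 2 :=
    intervalIntegral.integral_nonneg hT.le fun _ _ => by positivity
  linarith [waveEnergy_nonneg S p q 0, waveEnergy_nonneg S p q T]

end Windows

/-! ### Two waves coupled through the velocity. -/

section Coupling

variable {𝕜 H : Type*} [RCLike 𝕜] [NormedAddCommGroup H] [InnerProductSpace 𝕜 H]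
  [NormedSpace ℝ H] {S : H →L[𝕜] H} {a b : ℝ} {p q f p₁ q₁ : ℝ → H}
  {C : H →L[𝕜] H}

/-- The multiplier identity for two waves coupled through the velocity. -/
theorem IsWave.integral_coupling (hS : (S : H →ₗ[𝕜] H).IsSymmetric) (hab : a ≤ b)
    (h : IsWave S (Icc a b) p q f) (h₁ : IsWave S (Icc a b) p₁ q₁ fun t => -C (S (q t))) :
    ∫ t in a..b, (t - a) * (b - t) * RCLike.re ⟪C (S (q t)), S (q t)⟫_𝕜 =
      ∫ t in a..b, ((a + b - 2 * t) * (RCLike.re ⟪S (q₁ t), S (q t)⟫_𝕜 +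
        RCLike.re ⟪S (p₁ t), S (p t)⟫_𝕜) + (t - a) * (b - t) * RCLike.re ⟪S (q₁ t), f t⟫_𝕜) := by
  have hd : ∀ t ∈ Icc a b, HasDerivWithinAt
      (fun t => (t - a) * (b - t) * (RCLike.re ⟪S (q₁ t), S (q t)⟫_𝕜 +
        RCLike.re ⟪S (p₁ t), S (p t)⟫_𝕜))
      (((a + b - 2 * t) * (RCLike.re ⟪S (q₁ t), S (q t)⟫_𝕜 +
        RCLike.re ⟪S (p₁ t), S (p t)⟫_𝕜) + (t - a) * (b - t) * RCLike.re ⟪S (q₁ t), f t⟫_𝕜) -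
        (t - a) * (b - t) * RCLike.re ⟪C (S (q t)), S (q t)⟫_𝕜) (Icc a b) t := by
    intro t ht
    have h1 := (hasDerivWithinAt_re_inner (𝕜 := 𝕜) (h₁.deriv_snd t ht) (h.deriv_snd t ht)).add
      (hasDerivWithinAt_re_inner (𝕜 := 𝕜) (h₁.deriv_fst t ht) (h.deriv_fst t ht))
    have h2 : HasDerivWithinAt (fun t : ℝ => (t - a) * (b - t)) (1 * (b - t) + (t - a) * (-1))
        (Icc a b) t :=
      (((hasDerivAt_id' t).sub_const a).mul ((hasDerivAt_id' t).const_sub b)).hasDerivWithinAt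
    -- The terms pairing `p` with `q₁` and `p₁` with `q` cancel by symmetry of `S`; only the
    -- coupling term and the source of the driving wave survive. The weight vanishes at `a` and `b`,
    -- so integration leaves no boundary term.
    refine (h2.mul h1).congr_deriv ?_
    have e : ∀ x y, RCLike.re ⟪S x, y⟫_𝕜 = RCLike.re ⟪x, S y⟫_𝕜 := fun x y =>
      congrArg RCLike.re (hS x y)
    simp only [inner_sub_left, inner_sub_right, inner_neg_left, map_sub, map_neg]
    rw [e (q₁ t) (p t), e (p₁ t) (q t)]
    simp only [Pi.add_apply]
    ring
  have hcont : ∀ {u v : ℝ → H}, ContinuousOn u (Icc a b) → ContinuousOn v (Icc a b) →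
      ContinuousOn (fun t => RCLike.re ⟪u t, v t⟫_𝕜) (Icc a b) := fun hu hv =>
    RCLike.continuous_re.comp_continuousOn (hu.inner hv)
  have hSq := S.continuous.comp_continuousOn h.continuousOn_snd
  have hSp := S.continuous.comp_continuousOn h.continuousOn_fst
  have hSq₁ := S.continuous.comp_continuousOn h₁.continuousOn_snd
  have hSp₁ := S.continuous.comp_continuousOn h₁.continuousOn_fst
  have hw : ContinuousOn (fun t : ℝ => (t - a) * (b - t)) (Icc a b) := by fun_prop
  have hw' : ContinuousOn (fun t : ℝ => a + b - 2 * t) (Icc a b) := by fun_prop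
  have hc1 : ContinuousOn (fun t => (a + b - 2 * t) * (RCLike.re ⟪S (q₁ t), S (q t)⟫_𝕜 +
      RCLike.re ⟪S (p₁ t), S (p t)⟫_𝕜) + (t - a) * (b - t) * RCLike.re ⟪S (q₁ t), f t⟫_𝕜)
      (Icc a b) :=
    (hw'.mul ((hcont hSq₁ hSq).add (hcont hSp₁ hSp))).add
      (hw.mul (hcont hSq₁ h.continuousOn_source))
  have hc2 : ContinuousOn (fun t => (t - a) * (b - t) * RCLike.re ⟪C (S (q t)), S (q t)⟫_𝕜)
      (Icc a b) := hw.mul (hcont (C.continuous.comp_continuousOn hSq) hSq)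
  have hint := intervalIntegral.integral_eq_sub_of_hasDeriv_right_of_le hab
    (fun t ht => (hd t ht).continuousWithinAt)
    (fun t ht => ((hd t (Ioo_subset_Icc_self ht)).hasDerivAt
      (Icc_mem_nhds ht.1 ht.2)).hasDerivWithinAt)
    ((hc1.sub hc2).intervalIntegrable_of_Icc hab)
  simp only [sub_self, zero_mul, mul_zero] at hint
  rw [intervalIntegral.integral_sub (hc1.intervalIntegrable_of_Icc hab)
    (hc2.intervalIntegrable_of_Icc hab)] at hint
  exact (sub_eq_zero.1 hint).symm

/-- The multiplier identity with its products split by Young's inequality. The weight is of size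
`l²` inside the interval and its derivative of size `l`, with `l = b - a`; after division by `l²`,
the driven wave carries the small factor `(ε l²)⁻¹` that produces the gain over long times. -/
theorem IsWave.coupling_le (hS : (S : H →ₗ[𝕜] H).IsSymmetric) (hab : a < b)
    (h : IsWave S (Icc a b) p q f) (h₁ : IsWave S (Icc a b) p₁ q₁ fun t => -C (S (q t)))
    (hC : ∀ x, 0 ≤ RCLike.re ⟪C x, x⟫_𝕜) {ε : ℝ} (hε : 0 < ε) :
    ∫ t in (a + (b - a) / 6)..(b - (b - a) / 6), RCLike.re ⟪C (S (q t)), S (q t)⟫_𝕜 ≤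
      9 * (ε * (∫ t in a..b, waveEnergy S p q t) +
        2 * (ε * (b - a) ^ 2)⁻¹ * (∫ t in a..b, waveEnergy S p₁ q₁ t) +
        ε * (b - a) ^ 2 * ∫ t in a..b, ‖f t‖ ^ 2) := by
  set l := b - a with hl
  have hl0 : 0 < l := sub_pos.2 hab
  have hSq := S.continuous.comp_continuousOn h.continuousOn_snd
  have hc : ContinuousOn (fun t => RCLike.re ⟪C (S (q t)), S (q t)⟫_𝕜) (Icc a b) :=
    RCLike.continuous_re.comp_continuousOn ((C.continuous.comp_continuousOn hSq).inner hSq)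
  have hw : ContinuousOn (fun t : ℝ => (t - a) * (b - t)) (Icc a b) := by fun_prop
  have hl6 : a + l / 6 ≤ b - l / 6 := by linarith
  have h6 : a ≤ a + l / 6 := by linarith
  have h6' : b - l / 6 ≤ b := by linarith
  have hsub : Icc (a + l / 6) (b - l / 6) ⊆ Icc a b := Icc_subset_Icc h6 h6'
  -- On this subinterval the weight is at least `(l/6)(5l/6) = 5 l² / 36`, hence at least `l² / 9`.
  have h1 : l ^ 2 / 9 * ∫ t in (a + l / 6)..(b - l / 6), RCLike.re ⟪C (S (q t)), S (q t)⟫_𝕜 ≤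
      ∫ t in a..b, (t - a) * (b - t) * RCLike.re ⟪C (S (q t)), S (q t)⟫_𝕜 := by
    rw [← intervalIntegral.integral_const_mul]
    refine le_trans (intervalIntegral.integral_mono_on hl6
      (((hc.mono hsub).const_smul (l ^ 2 / 9)).intervalIntegrable_of_Icc hl6)
      (((hw.mul hc).mono hsub).intervalIntegrable_of_Icc hl6) fun t ht => ?_)
      (integral_le_integral_of_subinterval (hw.mul hc) (fun t ht => ?_) h6 hl6 h6')
    · refine mul_le_mul_of_nonneg_right ?_ (hC _)
      have e1 : 0 ≤ t - a - l / 6 := by linarith [ht.1]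
      have e2 : 0 ≤ b - t - l / 6 := by linarith [ht.2]
      nlinarith [mul_nonneg e1 e2]
    · exact mul_nonneg (mul_nonneg (by linarith [ht.1]) (by linarith [ht.2])) (hC _)
  rw [IsWave.integral_coupling hS hab.le h h₁] at h1
  have hSq₁ := S.continuous.comp_continuousOn h₁.continuousOn_snd
  have hSp := S.continuous.comp_continuousOn h.continuousOn_fst
  have hSp₁ := S.continuous.comp_continuousOn h₁.continuousOn_fst
  have hcont : ∀ {u v : ℝ → H}, ContinuousOn u (Icc a b) → ContinuousOn v (Icc a b) →
      ContinuousOn (fun t => RCLike.re ⟪u t, v t⟫_𝕜) (Icc a b) := fun hu hv =>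
    RCLike.continuous_re.comp_continuousOn (hu.inner hv)
  have hw' : ContinuousOn (fun t : ℝ => a + b - 2 * t) (Icc a b) := by fun_prop
  have hE := h.continuousOn_waveEnergy
  have hE₁ := h₁.continuousOn_waveEnergy
  have hf : ContinuousOn (fun t => ‖f t‖ ^ 2) (Icc a b) := h.continuousOn_source.norm.pow 2
  have h2 : ∫ t in a..b, ((a + b - 2 * t) * (RCLike.re ⟪S (q₁ t), S (q t)⟫_𝕜 +
        RCLike.re ⟪S (p₁ t), S (p t)⟫_𝕜) + (t - a) * (b - t) * RCLike.re ⟪S (q₁ t), f t⟫_𝕜) ≤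
      ∫ t in a..b, (ε * l ^ 2 * waveEnergy S p q t + 2 / ε * waveEnergy S p₁ q₁ t +
        ε * l ^ 4 * ‖f t‖ ^ 2) := by
    refine intervalIntegral.integral_mono_on hab.le
      (((hw'.mul ((hcont hSq₁ hSq).add (hcont hSp₁ hSp))).add
        (hw.mul (hcont hSq₁ h.continuousOn_source))).intervalIntegrable_of_Icc hab.le)
      ((((hE.intervalIntegrable_of_Icc hab.le).const_mul (ε * l ^ 2)).add
        ((hE₁.intervalIntegrable_of_Icc hab.le).const_mul (2 / ε))).add
        ((hf.intervalIntegrable_of_Icc hab.le).const_mul (ε * l ^ 4))) fun t ht => ?_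
    have hin : ∀ x y : H, |RCLike.re ⟪x, y⟫_𝕜| ≤ ‖x‖ * ‖y‖ := fun x y =>
      (RCLike.abs_re_le_norm _).trans (norm_inner_le_norm _ _)
    have hy : ∀ c x y : ℝ, 0 < c → c * (x * y) ≤ (ε * c ^ 2 * y ^ 2 + 1 / ε * x ^ 2) / 2 := by
      intro c x y _
      have : (ε * c ^ 2 * y ^ 2 + 1 / ε * x ^ 2) / 2 - c * (x * y) =
          (x - ε * c * y) ^ 2 / (2 * ε) := by field_simp; ring
      have h0 : 0 ≤ (x - ε * c * y) ^ 2 / (2 * ε) := by positivity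
      linarith
    have hwl : |a + b - 2 * t| ≤ l := abs_le.2 ⟨by linarith [ht.2], by linarith [ht.1]⟩
    have hw0 : 0 ≤ (t - a) * (b - t) := mul_nonneg (by linarith [ht.1]) (by linarith [ht.2])
    have hwl2 : (t - a) * (b - t) ≤ l ^ 2 := by
      have e1 : t - a ≤ l := by linarith [ht.2]
      have e2 : b - t ≤ l := by linarith [ht.1]
      calc (t - a) * (b - t) ≤ l * l := mul_le_mul e1 e2 (by linarith [ht.2]) hl0.le
        _ = l ^ 2 := by ring
    have t1 : (a + b - 2 * t) * (RCLike.re ⟪S (q₁ t), S (q t)⟫_𝕜 +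
        RCLike.re ⟪S (p₁ t), S (p t)⟫_𝕜) ≤
        l * (‖S (q₁ t)‖ * ‖S (q t)‖ + ‖S (p₁ t)‖ * ‖S (p t)‖) := by
      refine (le_abs_self _).trans ?_
      rw [abs_mul]
      exact mul_le_mul hwl ((abs_add_le _ _).trans (add_le_add (hin _ _) (hin _ _)))
        (abs_nonneg _) hl0.le
    have t2 : (t - a) * (b - t) * RCLike.re ⟪S (q₁ t), f t⟫_𝕜 ≤ l ^ 2 * (‖S (q₁ t)‖ * ‖f t‖) :=
      (mul_le_mul_of_nonneg_left ((le_abs_self _).trans (hin _ _)) hw0).trans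
        (mul_le_mul_of_nonneg_right hwl2 (by positivity))
    have y1 := hy l ‖S (q₁ t)‖ ‖S (q t)‖ hl0
    have y2 := hy l ‖S (p₁ t)‖ ‖S (p t)‖ hl0
    have y3 := hy (l ^ 2) ‖S (q₁ t)‖ ‖f t‖ (by positivity)
    have y4 : 0 ≤ ε * l ^ 4 * ‖f t‖ ^ 2 := by positivity
    have y5 : 0 ≤ 1 / ε * ‖S (p₁ t)‖ ^ 2 := by positivity
    have e3 : ε * (l ^ 2) ^ 2 * ‖f t‖ ^ 2 = ε * l ^ 4 * ‖f t‖ ^ 2 := by ring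
    have e4 : 2 / ε = 2 * (1 / ε) := by ring
    rw [e3] at y3
    unfold waveEnergy
    rw [e4]
    linarith
  rw [intervalIntegral.integral_add
    (((hE.intervalIntegrable_of_Icc hab.le).const_mul (ε * l ^ 2)).add
      ((hE₁.intervalIntegrable_of_Icc hab.le).const_mul (2 / ε)))
    ((hf.intervalIntegrable_of_Icc hab.le).const_mul (ε * l ^ 4)),
    intervalIntegral.integral_add ((hE.intervalIntegrable_of_Icc hab.le).const_mul (ε * l ^ 2))
    ((hE₁.intervalIntegrable_of_Icc hab.le).const_mul (2 / ε)),
    intervalIntegral.integral_const_mul, intervalIntegral.integral_const_mul,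
    intervalIntegral.integral_const_mul] at h2
  have h3 := h1.trans h2
  have h4 : l ^ 2 / 9 * (9 * (ε * (∫ t in a..b, waveEnergy S p q t) +
        2 * (ε * l ^ 2)⁻¹ * (∫ t in a..b, waveEnergy S p₁ q₁ t) +
        ε * l ^ 2 * ∫ t in a..b, ‖f t‖ ^ 2)) =
      ε * l ^ 2 * (∫ t in a..b, waveEnergy S p q t) + 2 / ε * (∫ t in a..b, waveEnergy S p₁ q₁ t) +
      ε * l ^ 4 * ∫ t in a..b, ‖f t‖ ^ 2 := by field_simp
  rw [← h4] at h3
  exact le_of_mul_le_mul_left h3 (by positivity)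

/-- The energy of a wave is controlled by that of the wave that it drives through its velocity. -/
theorem waveEnergy_le_of_coupling [IsScalarTower ℝ 𝕜 H] (hS : (S : H →ₗ[𝕜] H).IsSymmetric)
    (hex : ∀ x y : H, ∃ p q : ℝ → H, IsWave S univ p q (fun _ => 0) ∧ p 0 = x ∧ q 0 = y)
    {P : H →L[𝕜] H} (hP : WaveObservable S (P ∘L ContinuousLinearMap.snd 𝕜 H H))
    {α : ℝ} (hα : 0 < α) (hC : ∀ x, α * ‖P x‖ ^ 2 ≤ RCLike.re ⟪C x, x⟫_𝕜) :
    ∃ τ K : ℝ, 0 < τ ∧ 0 < K ∧ ∀ a b p q f p₁ q₁, 6 * τ ≤ b - a → IsWave S (Icc a b) p q f →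
      IsWave S (Icc a b) p₁ q₁ (fun t => -C (S (q t))) → ∀ ε, 0 < ε →
      ∫ t in (a + (b - a) / 3)..(b - (b - a) / 3), waveEnergy S p q t ≤
        K * ((∫ t in a..b, ‖f t‖ ^ 2) + ε * (∫ t in a..b, waveEnergy S p q t) +
          (ε * (b - a) ^ 2)⁻¹ * (∫ t in a..b, waveEnergy S p₁ q₁ t) +
          ε * (b - a) ^ 2 * ∫ t in a..b, ‖f t‖ ^ 2) := by
  obtain ⟨τ, K, hτ, hK, hwin⟩ := waveEnergy_le_window hS hex (waveAdmissible_velocity P) hP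
  refine ⟨τ, K * τ * (18 / α + 1), hτ, by positivity, ?_⟩
  intro a b p q f p₁ q₁ hlen h h₁ ε hε
  set l := b - a with hl
  have hl0 : 0 < l := by linarith
  have hC0 : ∀ x, 0 ≤ RCLike.re ⟪C x, x⟫_𝕜 := fun x => le_trans (by positivity) (hC x)
  have hg : ContinuousOn (fun t => ‖P (S (q t))‖ ^ 2 + ‖f t‖ ^ 2) (Icc a b) :=
    (h.continuousOn_obs (P ∘L ContinuousLinearMap.snd 𝕜 H H)).add (h.continuousOn_source.norm.pow 2)
  have hf : ContinuousOn (fun t => ‖f t‖ ^ 2) (Icc a b) := h.continuousOn_source.norm.pow 2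
  have hPc : ContinuousOn (fun t => ‖P (S (q t))‖ ^ 2) (Icc a b) :=
    h.continuousOn_obs (P ∘L ContinuousLinearMap.snd 𝕜 H H)
  have hsub1 : Icc (a + l / 3) (b - l / 3 + τ) ⊆ Icc a b :=
    Icc_subset_Icc (by linarith) (by linarith)
  have h1 := integral_le_of_window_le (E := waveEnergy S p q)
    (g := fun t => ‖P (S (q t))‖ ^ 2 + ‖f t‖ ^ 2) (a := a + l / 3) (b := b - l / 3) (τ := τ) (K := K)
    (by linarith) hτ.le hK.le
    (h.continuousOn_waveEnergy.mono (Icc_subset_Icc (by linarith) (by linarith)))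
    (hg.mono hsub1) (fun t _ => by positivity) fun s hs =>
      hwin p q f s (h.mono (Icc_subset_Icc (by linarith [hs.1]) (by linarith [hs.2])))
  refine h1.trans ?_
  have hsub2 : Icc (a + l / 6) (b - l / 6) ⊆ Icc a b := Icc_subset_Icc (by linarith) (by linarith)
  -- Windows of length `τ ≤ l / 6` that start in the middle third stay inside `[a + l/6, b - l/6]`,
  -- where the coupling term dominates the observation.
  have h2 : ∫ t in (a + l / 3)..(b - l / 3 + τ), (‖P (S (q t))‖ ^ 2 + ‖f t‖ ^ 2) ≤
      (∫ t in (a + l / 6)..(b - l / 6), ‖P (S (q t))‖ ^ 2) + ∫ t in a..b, ‖f t‖ ^ 2 := by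
    rw [intervalIntegral.integral_add
      ((hPc.mono hsub1).intervalIntegrable_of_Icc (by linarith))
      ((hf.mono hsub1).intervalIntegrable_of_Icc (by linarith))]
    exact add_le_add (integral_le_integral_of_subinterval (hPc.mono hsub2)
      (fun _ _ => by positivity) (by linarith) (by linarith) (by linarith))
      (integral_le_integral_of_subinterval hf
      (fun _ _ => by positivity) (by linarith) (by linarith) (by linarith))
  have hSq := S.continuous.comp_continuousOn h.continuousOn_snd
  have hc : ContinuousOn (fun t => RCLike.re ⟪C (S (q t)), S (q t)⟫_𝕜) (Icc a b) :=
    RCLike.continuous_re.comp_continuousOn ((C.continuous.comp_continuousOn hSq).inner hSq)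
  have h3 : α * ∫ t in (a + l / 6)..(b - l / 6), ‖P (S (q t))‖ ^ 2 ≤
      ∫ t in (a + l / 6)..(b - l / 6), RCLike.re ⟪C (S (q t)), S (q t)⟫_𝕜 := by
    rw [← intervalIntegral.integral_const_mul]
    exact intervalIntegral.integral_mono_on (by linarith)
      (((hPc.mono hsub2).const_smul α).intervalIntegrable_of_Icc (by linarith))
      ((hc.mono hsub2).intervalIntegrable_of_Icc (by linarith)) fun t _ => hC _
  have h4 := IsWave.coupling_le hS (sub_pos.1 hl0) h h₁ hC0 hε
  rw [← hl] at h4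
  have hX : 0 ≤ ∫ t in a..b, waveEnergy S p q t :=
    intervalIntegral.integral_nonneg (by linarith) fun _ _ => waveEnergy_nonneg _ _ _ _
  have hY : 0 ≤ ∫ t in a..b, waveEnergy S p₁ q₁ t :=
    intervalIntegral.integral_nonneg (by linarith) fun _ _ => waveEnergy_nonneg _ _ _ _
  have hF : 0 ≤ ∫ t in a..b, ‖f t‖ ^ 2 :=
    intervalIntegral.integral_nonneg (by linarith) fun _ _ => by positivity
  set X := ∫ t in a..b, waveEnergy S p q t
  set Y := ∫ t in a..b, waveEnergy S p₁ q₁ t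
  set F := ∫ t in a..b, ‖f t‖ ^ 2
  set Z := ∫ t in (a + l / 6)..(b - l / 6), ‖P (S (q t))‖ ^ 2
  -- The constant is `9 · 2 / α`: the factor `9` of `IsWave.coupling_le` and its `2` in front of the
  -- driven energy, extended to all the terms.
  have h5 : Z ≤ 18 / α * (ε * X + (ε * l ^ 2)⁻¹ * Y + ε * l ^ 2 * F) := by
    rw [div_mul_eq_mul_div, le_div_iff₀ hα]
    have e1 : 0 ≤ ε * X := by positivity
    have e2 : 0 ≤ ε * l ^ 2 * F := by positivity
    nlinarith
  rw [mul_assoc (K * τ)]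
  refine mul_le_mul_of_nonneg_left (h2.trans ?_) (by positivity)
  have e1 : 0 ≤ ε * X + (ε * l ^ 2)⁻¹ * Y + ε * l ^ 2 * F := by positivity
  have e2 : 0 ≤ 18 / α * F := by positivity
  nlinarith

end Coupling

/-! ### Comparison of the energies of a chain over long times. -/

section EnergyChain

/-- The inequalities satisfied on `[0, T]` by the energies `E 1, …, E n` of a chain of waves coupled
through their velocities; `E 0 = 0`. -/
structure EnergyChain (K τ : ℕ → ℝ) (n : ℕ) (T : ℝ) (E : ℕ → ℝ → ℝ) : Prop where
  continuousOn : ∀ k ≤ n, ContinuousOn (E k) (Icc 0 T)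
  nonneg : ∀ k t, 0 ≤ E k t
  zero : ∀ t, E 0 t = 0
  growth : ∀ k < n, ∀ s ∈ Icc 0 T, ∀ t ∈ Icc 0 T,
    E (k + 1) t ≤ K k * (E (k + 1) s + T * ∫ x in (0 : ℝ)..T, E k x)
  coupling : ∀ k, k + 1 < n → ∀ a b, 0 ≤ a → b ≤ T → 6 * τ k ≤ b - a → ∀ ε, 0 < ε →
    ∫ t in (a + (b - a) / 3)..(b - (b - a) / 3), E (k + 1) t ≤
      K k * ((∫ t in a..b, E k t) + ε * (∫ t in a..b, E (k + 1) t) +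
        (ε * (b - a) ^ 2)⁻¹ * (∫ t in a..b, E (k + 2) t) + ε * (b - a) ^ 2 * ∫ t in a..b, E k t)

variable {K τ : ℕ → ℝ} {n : ℕ}

theorem EnergyChain.integral_nonneg {T : ℝ} {E : ℕ → ℝ → ℝ} (h : EnergyChain K τ n T E) (k : ℕ)
    {a b : ℝ} (hab : a ≤ b) : 0 ≤ ∫ t in a..b, E k t :=
  intervalIntegral.integral_nonneg hab fun _ _ => h.nonneg _ _

theorem EnergyChain.integral_mono {T : ℝ} {E : ℕ → ℝ → ℝ} (h : EnergyChain K τ n T E) {k : ℕ}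
    (hk : k ≤ n) {a b c d : ℝ} (ha : 0 ≤ a) (hac : a ≤ c) (hcd : c ≤ d) (hdb : d ≤ b) (hb : b ≤ T) :
    ∫ t in c..d, E k t ≤ ∫ t in a..b, E k t :=
  integral_le_integral_of_subinterval ((h.continuousOn k hk).mono (Icc_subset_Icc ha hb))
    (fun _ _ => h.nonneg _ _) hac hcd hdb

/-- The energy on `[0, T]` is controlled by the energy on a subinterval and the previous energy. -/
theorem EnergyChain.integral_le {T : ℝ} {E : ℕ → ℝ → ℝ} (h : EnergyChain K τ n T E)
    {k : ℕ} (hk : k < n) {a b : ℝ} (ha : 0 ≤ a) (hab : a ≤ b) (hb : b ≤ T) :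
    (b - a) * ∫ t in (0 : ℝ)..T, E (k + 1) t ≤
      K k * T * ((∫ t in a..b, E (k + 1) t) + (b - a) * T * ∫ t in (0 : ℝ)..T, E k t) := by
  have hT : 0 ≤ T := ha.trans (hab.trans hb)
  have hc := h.continuousOn (k + 1) hk
  have h1 : ∀ s ∈ Icc a b, ∫ t in (0 : ℝ)..T, E (k + 1) t ≤
      T * (K k * (E (k + 1) s + T * ∫ x in (0 : ℝ)..T, E k x)) := by
    intro s hs
    have := intervalIntegral.integral_mono_on hT (hc.intervalIntegrable_of_Icc hT)
      (intervalIntegrable_const (μ := volume)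
        (c := K k * (E (k + 1) s + T * ∫ x in (0 : ℝ)..T, E k x)))
      fun t ht => h.growth k hk s ⟨ha.trans hs.1, hs.2.trans hb⟩ t ht
    simpa only [intervalIntegral.integral_const, smul_eq_mul, sub_zero] using this
  have hcab := hc.mono (Icc_subset_Icc ha hb)
  have h2 := intervalIntegral.integral_mono_on hab
    (intervalIntegrable_const (μ := volume) (c := ∫ t in (0 : ℝ)..T, E (k + 1) t))
    ((((hcab.intervalIntegrable_of_Icc hab).add
      (intervalIntegrable_const (μ := volume) (c := T * ∫ x in (0 : ℝ)..T, E k x))).const_mul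
      (K k)).const_mul T) h1
  rw [intervalIntegral.integral_const_mul, intervalIntegral.integral_const_mul,
    intervalIntegral.integral_add (hcab.intervalIntegrable_of_Icc hab) intervalIntegrable_const] at h2
  simp only [intervalIntegral.integral_const, smul_eq_mul] at h2
  linarith

/-- The elimination step in the comparison of consecutive energies. -/
theorem le_of_coupling_estimates {K M δ T ε Q x y z w : ℝ} (hK : 0 < K) (hM : 0 < M) (hδ : 0 < δ)
    (hδ1 : δ ≤ 1) (hT : 0 < T) (hQ : Q = K * (3 / δ + M)) (hε : ε = 1 / (4 * Q * K * (1 + M)))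
    (hy : 0 ≤ y) (hyT : T ^ 2 * y ≤ M * w) (hwx : w ≤ x)
    (hxw : δ * T / 3 * x ≤ K * T * (w + δ * T / 3 * T * y))
    (hw : w ≤ K * (y + ε * x + (ε * (δ * T) ^ 2)⁻¹ * z + ε * (δ * T) ^ 2 * y))
    (hTQ : 4 * Q * K * M ≤ T ^ 2) : x ≤ 2 * Q * K * (ε * δ ^ 2)⁻¹ / T ^ 2 * z := by
  have hQ0 : 0 < Q := by rw [hQ]; positivity
  have hε0 : 0 < ε := by rw [hε]; positivity
  -- The energy `x` on `[0, T]` is comparable with the energy `w` on the inner third: the previous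
  -- energy `y` is at most `M w / T²`, which offsets the factor `T²` that multiplies `y` in the
  -- growth estimate.
  have hxw' : x ≤ Q * w := by
    have : δ * T / 3 * x ≤ δ * T / 3 * (Q * w) := by
      calc δ * T / 3 * x ≤ K * T * (w + δ / 3 * (T ^ 2 * y)) := hxw.trans (le_of_eq (by ring))
        _ ≤ K * T * (w + δ / 3 * (M * w)) := by gcongr
        _ = δ * T / 3 * (Q * w) := by rw [hQ]; field_simp
    exact le_of_mul_le_mul_left this (by positivity)
  have hyx : T ^ 2 * y ≤ M * x := hyT.trans (by gcongr)
  have hy1 : Q * K * y ≤ x / 4 := by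
    have h' : 4 * Q * K * y * M ≤ x * M := by
      calc 4 * Q * K * y * M = 4 * Q * K * M * y := by ring
        _ ≤ T ^ 2 * y := by gcongr
        _ ≤ x * M := by linarith
    have := le_of_mul_le_mul_right h' hM
    linarith
  have hy2 : (δ * T) ^ 2 * y ≤ M * x := by
    calc (δ * T) ^ 2 * y = δ ^ 2 * (T ^ 2 * y) := by ring
      _ ≤ 1 * (T ^ 2 * y) := by gcongr; exact pow_le_one₀ hδ.le hδ1
      _ ≤ M * x := by linarith
  -- With this choice the two terms carrying `ε` together cost a quarter of `x`; the term in `y`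
  -- costs another quarter once `T² ≥ 4QKM`. Half of `x` remains on the left.
  have hε1 : Q * K * (ε * (1 + M)) = 1 / 4 := by rw [hε]; field_simp
  have hfin : x ≤ x / 2 + Q * K * ((ε * (δ * T) ^ 2)⁻¹ * z) := by
    calc x ≤ Q * w := hxw'
      _ ≤ Q * (K * (y + ε * x + (ε * (δ * T) ^ 2)⁻¹ * z + ε * (δ * T) ^ 2 * y)) := by gcongr
      _ = Q * K * y + Q * K * (ε * (x + (δ * T) ^ 2 * y)) +
          Q * K * ((ε * (δ * T) ^ 2)⁻¹ * z) := by ring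
      _ ≤ x / 4 + Q * K * (ε * (x + M * x)) + Q * K * ((ε * (δ * T) ^ 2)⁻¹ * z) := by gcongr
      _ = x / 4 + Q * K * (ε * (1 + M)) * x + Q * K * ((ε * (δ * T) ^ 2)⁻¹ * z) := by ring
      _ = _ := by rw [hε1]; ring
  have : 2 * Q * K * (ε * δ ^ 2)⁻¹ / T ^ 2 * z = 2 * (Q * K * ((ε * (δ * T) ^ 2)⁻¹ * z)) := by
    field_simp
  rw [this]
  linarith

/-- Over long times, every energy is dominated by the next one. -/
theorem exists_integral_le_next (hK : ∀ k, 0 < K k) (k : ℕ) (hk : k < n) :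
    ∀ α β : ℝ, 0 ≤ α → α < β → β ≤ 1 → ∃ M T₀ : ℝ, 0 < M ∧ 0 < T₀ ∧ ∀ T ≥ T₀, ∀ E,
      EnergyChain K τ n T E →
        ∫ t in (0 : ℝ)..T, E k t ≤ M / T ^ 2 * ∫ t in (α * T)..(β * T), E (k + 1) t := by
  induction k with
  | zero =>
    intro α β hα hαβ _
    refine ⟨1, 1, one_pos, one_pos, fun T hT E h => ?_⟩
    have : 0 ≤ ∫ t in (α * T)..(β * T), E (0 + 1) t :=
      h.integral_nonneg _ (mul_le_mul_of_nonneg_right hαβ.le (by linarith))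
    simp only [h.zero, intervalIntegral.integral_zero]
    positivity
  | succ k ih =>
    intro α β hα hαβ hβ
    have hδ : 0 < β - α := sub_pos.2 hαβ
    set δ := β - α with hδdef
    -- The induction hypothesis is used on the middle third of `[αT, βT]`, the interval on which the
    -- coupling inequality gives its bound. This requires an induction over all subintervals `[α,
    -- β]` of `[0, 1]`.
    obtain ⟨M, T₀, hM, hT₀, hP⟩ := ih (by omega) (α + δ / 3) (β - δ / 3) (by linarith)
      (by linarith) (by linarith)
    have hK0 := hK k
    set Q := K k * (3 / δ + M) with hQ
    have hQ0 : 0 < Q := by positivity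
    set ε := 1 / (4 * Q * K k * (1 + M)) with hε
    have hε0 : 0 < ε := by positivity
    -- The bound `6τ/δ` makes `[αT, βT]` long enough for the coupling inequality; `T ≥ 1` and `T ≥
    -- 4QKM` give `T² ≥ 4QKM`.
    refine ⟨2 * Q * K k * (ε * δ ^ 2)⁻¹, max (max T₀ 1) (max (6 * τ k / δ) (4 * Q * K k * M)),
      by positivity, lt_max_of_lt_left (lt_max_of_lt_left hT₀), fun T hT E h => ?_⟩
    simp only [ge_iff_le, max_le_iff] at hT
    obtain ⟨⟨hT1, hT2⟩, hT3, hT4⟩ := hT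
    have hT0 : 0 < T := by linarith
    rw [div_le_iff₀ hδ] at hT3
    have hlen : β * T - α * T = δ * T := by rw [hδdef]; ring
    have e1 : α * T + (β * T - α * T) / 3 = (α + δ / 3) * T := by rw [hδdef]; ring
    have e2 : β * T - (β * T - α * T) / 3 = (β - δ / 3) * T := by rw [hδdef]; ring
    have ha : 0 ≤ α * T := by positivity
    have hb : β * T ≤ T := by nlinarith
    have h1 := h.coupling k hk (α * T) (β * T) ha hb (by rw [hlen]; linarith) ε hε0
    rw [e1, e2, hlen] at h1
    have h2 := hP T hT1 E h
    have h3 := h.integral_le (k := k) (by omega) (a := (α + δ / 3) * T) (b := (β - δ / 3) * T)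
      (by positivity) (by gcongr; linarith) (by nlinarith)
    have h4 : ∫ t in (α + δ / 3) * T..(β - δ / 3) * T, E (k + 1) t ≤
        ∫ t in (0 : ℝ)..T, E (k + 1) t :=
      h.integral_mono (by omega) le_rfl (by positivity) (by gcongr; linarith) (by nlinarith) le_rfl
    have h5 : ∫ t in (α * T)..(β * T), E (k + 1) t ≤ ∫ t in (0 : ℝ)..T, E (k + 1) t :=
      h.integral_mono (by omega) le_rfl ha (by gcongr) hb le_rfl
    have h6 : ∫ t in (α * T)..(β * T), E k t ≤ ∫ t in (0 : ℝ)..T, E k t :=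
      h.integral_mono (by omega) le_rfl ha (by gcongr) hb le_rfl
    have h7 : 0 ≤ ∫ t in (α * T)..(β * T), E (k + 2) t := h.integral_nonneg _ (by gcongr)
    have h8 : 0 ≤ ∫ t in (0 : ℝ)..T, E k t := h.integral_nonneg _ hT0.le
    rw [show (β - δ / 3) * T - (α + δ / 3) * T = δ * T / 3 by rw [hδdef]; ring] at h3
    set x := ∫ t in (0 : ℝ)..T, E (k + 1) t with hx
    set y := ∫ t in (0 : ℝ)..T, E k t with hy
    set z := ∫ t in (α * T)..(β * T), E (k + 2) t with hz
    set w := ∫ t in (α + δ / 3) * T..(β - δ / 3) * T, E (k + 1) t with hw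
    have hyT : T ^ 2 * y ≤ M * w := by
      rw [div_mul_eq_mul_div, le_div_iff₀ (by positivity)] at h2
      linarith
    have hwx : w ≤ K k * (y + ε * x + (ε * (δ * T) ^ 2)⁻¹ * z + ε * (δ * T) ^ 2 * y) := by
      refine h1.trans ?_
      gcongr
    exact le_of_coupling_estimates hK0 hM hδ (by rw [hδdef]; linarith) hT0 hQ hε h8 hyT h4 h3 hwx
      (hT4.trans (by nlinarith))

/-- If an observation `O` controls the last energy up to the previous one, then over long times it
controls all initial energies. -/
theorem exists_energy_le_observation (hK : ∀ k, 0 < K k) (hn : 1 ≤ n)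
    {K' τ' : ℝ} (hK' : 0 < K') :
    ∃ T₁ : ℝ, 0 < T₁ ∧ ∀ T ≥ T₁, ∃ d : ℝ, 0 < d ∧ ∀ E O, EnergyChain K τ n T E → 0 ≤ O →
      (2 * τ' ≤ T → ∫ t in (0 : ℝ)..(T / 2), E n t ≤ K' * (O + ∫ t in (0 : ℝ)..T, E (n - 1) t)) →
      ∀ k < n, E (k + 1) 0 ≤ d * O := by
  obtain ⟨M, T₀, hM, hT₀, hP⟩ := exists_integral_le_next (n := n) hK (n - 1) (by omega) 0 (1 / 2) le_rfl
    (by norm_num) (by norm_num)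
  rw [Nat.sub_add_cancel hn] at hP
  -- With `y` the integral of the energy of index `n - 1`, the comparison and the observation give
  -- `y ≤ (M K' / T²)(O + y)`, and for large `T` this is at most `(O + y) / 2`, so that `y ≤ O`.
  have hlast : ∀ T ≥ max (max T₀ 1) (max (2 * τ') (2 * M * K')), ∀ E O, EnergyChain K τ n T E →
      0 ≤ O →
      (2 * τ' ≤ T → ∫ t in (0 : ℝ)..(T / 2), E n t ≤ K' * (O + ∫ t in (0 : ℝ)..T, E (n - 1) t)) →
      ∫ t in (0 : ℝ)..T, E (n - 1) t ≤ O ∧ ∫ t in (0 : ℝ)..(T / 2), E n t ≤ 2 * K' * O := by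
    intro T hT E O h hO hobs
    simp only [ge_iff_le, max_le_iff] at hT
    obtain ⟨⟨hT1, hT2⟩, hT3, hT4⟩ := hT
    have h1 := hP T hT1 E h
    rw [zero_mul, one_div_mul_eq_div] at h1
    have h2 := hobs hT3
    have h8 : 0 ≤ ∫ t in (0 : ℝ)..T, E (n - 1) t := h.integral_nonneg _ (by linarith)
    set y := ∫ t in (0 : ℝ)..T, E (n - 1) t
    set x := ∫ t in (0 : ℝ)..(T / 2), E n t
    rw [div_mul_eq_mul_div, le_div_iff₀ (by positivity)] at h1
    have h3 : y * T ^ 2 ≤ (O + y) / 2 * T ^ 2 := by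
      have : 2 * M * K' ≤ T ^ 2 := by nlinarith
      calc y * T ^ 2 ≤ M * (K' * (O + y)) := h1.trans (by gcongr)
        _ = 2 * M * K' * ((O + y) / 2) := by ring
        _ ≤ T ^ 2 * ((O + y) / 2) := by gcongr
        _ = _ := by ring
    have h4 := le_of_mul_le_mul_right h3 (by positivity)
    refine ⟨by linarith, h2.trans ?_⟩
    have : O + y ≤ 2 * O := by linarith
    calc K' * (O + y) ≤ K' * (2 * O) := by gcongr
      _ = _ := by ring
  set T₂ := max (max T₀ 1) (max (2 * τ') (2 * M * K')) with hT₂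
  have hT₂1 : 1 ≤ T₂ := le_max_of_le_left (le_max_right _ _)
  -- The bound descends the chain, each energy being dominated by the next one. The index `i` counts
  -- the steps down from `n - 1`.
  have hall : ∀ i ≤ n - 1, ∃ c T₁ : ℝ, 0 < c ∧ T₂ ≤ T₁ ∧ ∀ T ≥ T₁, ∀ E O, EnergyChain K τ n T E →
      0 ≤ O →
      (2 * τ' ≤ T → ∫ t in (0 : ℝ)..(T / 2), E n t ≤ K' * (O + ∫ t in (0 : ℝ)..T, E (n - 1) t)) →
      ∫ t in (0 : ℝ)..T, E (n - 1 - i) t ≤ c * O := by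
    intro i
    induction i with
    | zero =>
      intro _
      exact ⟨1, T₂, one_pos, le_rfl, fun T hT E O h hO hobs => by
        simpa using (hlast T hT E O h hO hobs).1⟩
    | succ i ih =>
      intro hi
      obtain ⟨c, T₁, hc, hT₁, hc'⟩ := ih (by omega)
      obtain ⟨M', T₃, hM', hT₃, hP'⟩ := exists_integral_le_next (n := n) hK (n - 1 - (i + 1)) (by omega)
        0 1 le_rfl one_pos le_rfl
      refine ⟨M' * c, max T₁ T₃, by positivity, le_max_of_le_left hT₁, fun T hT E O h hO hobs => ?_⟩
      have h1 := hP' T ((le_max_right _ _).trans hT) E h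
      have h2 := hc' T ((le_max_left _ _).trans hT) E O h hO hobs
      rw [zero_mul, one_mul, show n - 1 - (i + 1) + 1 = n - 1 - i by omega] at h1
      have hT1 : 1 ≤ T := hT₂1.trans (hT₁.trans ((le_max_left _ _).trans hT))
      have h3 : M' / T ^ 2 ≤ M' := div_le_self hM'.le (one_le_pow₀ hT1)
      have h4 : 0 ≤ ∫ t in (0 : ℝ)..T, E (n - 1 - i) t := h.integral_nonneg _ (by linarith)
      calc _ ≤ M' / T ^ 2 * ∫ t in (0 : ℝ)..T, E (n - 1 - i) t := h1
        _ ≤ M' * (c * O) := by gcongr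
        _ = _ := by ring
  choose! c T₁ hc hT₁ hbound using hall
  -- A single threshold valid for all the finitely many comparisons.
  have hsum : ∀ i ≤ n - 1, T₁ i ≤ T₂ + ∑ i ∈ Finset.range n, T₁ i := by
    intro i hi
    have := Finset.single_le_sum (f := T₁) (s := Finset.range n)
      (fun j hj => (by linarith [hT₁ j (by have := Finset.mem_range.1 hj; omega)] : (0 : ℝ) ≤ T₁ j))
      (Finset.mem_range.2 (by omega : i < n))
    linarith
  have hTpos : T₂ ≤ T₂ + ∑ i ∈ Finset.range n, T₁ i := by
    have := Finset.sum_nonneg (f := T₁) (s := Finset.range n)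
      (fun j hj => (by linarith [hT₁ j (by have := Finset.mem_range.1 hj; omega)] : (0 : ℝ) ≤ T₁ j))
    linarith
  refine ⟨T₂ + ∑ i ∈ Finset.range n, T₁ i, by linarith, fun T hT => ?_⟩
  have hT0 : 1 ≤ T := by linarith
  have hmain : ∀ k < n, ∃ d : ℝ, 0 < d ∧ ∀ E O, EnergyChain K τ n T E → 0 ≤ O →
      (2 * τ' ≤ T → ∫ t in (0 : ℝ)..(T / 2), E n t ≤ K' * (O + ∫ t in (0 : ℝ)..T, E (n - 1) t)) →
      E (k + 1) 0 ≤ d * O := by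
    intro k hk
    obtain ⟨g, hg, hgb⟩ : ∃ g : ℝ, 0 < g ∧ ∀ E O, EnergyChain K τ n T E → 0 ≤ O →
        (2 * τ' ≤ T → ∫ t in (0 : ℝ)..(T / 2), E n t ≤
          K' * (O + ∫ t in (0 : ℝ)..T, E (n - 1) t)) →
        ∫ t in (0 : ℝ)..(T / 2), E (k + 1) t ≤ g * O := by
      by_cases hkn : k + 1 = n
      · rw [hkn]
        exact ⟨2 * K', by positivity, fun E O h hO hobs =>
          (hlast T (hTpos.trans hT) E O h hO hobs).2⟩
      · refine ⟨c (n - 1 - (k + 1)), hc _ (by omega), fun E O h hO hobs => ?_⟩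
        have := hbound (n - 1 - (k + 1)) (by omega) T ((hsum _ (by omega)).trans hT) E O h hO hobs
        rw [show n - 1 - (n - 1 - (k + 1)) = k + 1 by omega] at this
        exact (h.integral_mono (by omega) le_rfl le_rfl (by linarith) (by linarith) le_rfl).trans this
    have hck := hc (n - 1 - k) (by omega)
    have hKk := hK k
    refine ⟨K k * (2 * g + T * c (n - 1 - k)), by positivity, fun E O h hO hobs => ?_⟩
    have h1 := hbound (n - 1 - k) (by omega) T ((hsum _ (by omega)).trans hT) E O h hO hobs
    rw [show n - 1 - (n - 1 - k) = k by omega] at h1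
    have h2 := hgb E O h hO hobs
    have hcont := (h.continuousOn (k + 1) hk).mono (Icc_subset_Icc le_rfl (by linarith : T / 2 ≤ T))
    -- The value at time `0` is recovered by averaging the growth inequality over the departure
    -- times in `[0, T/2]`.
    have h3 := intervalIntegral.integral_mono_on (by linarith : (0 : ℝ) ≤ T / 2)
      (intervalIntegrable_const (μ := volume) (c := E (k + 1) 0))
      (((hcont.intervalIntegrable_of_Icc (by linarith)).add
        (intervalIntegrable_const (μ := volume) (c := T * ∫ x in (0 : ℝ)..T, E k x))).const_mul (K k))
      fun s hs => h.growth k hk s ⟨hs.1, by linarith [hs.2]⟩ 0 ⟨le_rfl, by linarith⟩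
    rw [intervalIntegral.integral_const_mul, intervalIntegral.integral_add
      (hcont.intervalIntegrable_of_Icc (by linarith)) intervalIntegrable_const] at h3
    simp only [intervalIntegral.integral_const, smul_eq_mul, sub_zero] at h3
    have h4 : T / 2 * E (k + 1) 0 ≤ T / 2 * (K k * (2 * g + T * c (n - 1 - k)) * O) := by
      calc T / 2 * E (k + 1) 0 ≤ K k * (g * O + T / 2 * (T * (c (n - 1 - k) * O))) :=
            h3.trans (by gcongr)
        _ ≤ K k * (T * (g * O) + T / 2 * (T * (c (n - 1 - k) * O))) := by
            have : g * O ≤ T * (g * O) := le_mul_of_one_le_left (by positivity) hT0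
            gcongr
        _ = _ := by ring
    exact le_of_mul_le_mul_left h4 (by positivity)
  choose! d hd hdb using hmain
  refine ⟨∑ k ∈ Finset.range n, d k, Finset.sum_pos (fun k hk => hd k (Finset.mem_range.1 hk))
    ⟨0, Finset.mem_range.2 (by omega)⟩, fun E O h hO hobs k hk => ?_⟩
  refine (hdb k hk E O h hO hobs).trans (mul_le_mul_of_nonneg_right ?_ hO)
  exact Finset.single_le_sum (fun j hj => (hd j (Finset.mem_range.1 hj)).le) (Finset.mem_range.2 hk)

end EnergyChain

/-! ### Chains of waves coupled through the velocities. -/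

section ChainEnergy

variable {𝕜 H : Type*} [RCLike 𝕜] [NormedAddCommGroup H] [InnerProductSpace 𝕜 H]
  {S : H →L[𝕜] H} {m : ℕ}

/-- The energies of a chain of waves, shifted by one index. -/
noncomputable def chainEnergy (S : H →L[𝕜] H) (p q : Fin (m + 1) → ℝ → H) : ℕ → ℝ → ℝ
  | 0, _ => 0
  | k + 1, t => if h : k < m + 1 then waveEnergy S (p ⟨k, h⟩) (q ⟨k, h⟩) t else 0

theorem chainEnergy_succ (p q : Fin (m + 1) → ℝ → H) {k : ℕ} (h : k < m + 1) :
    chainEnergy S p q (k + 1) = waveEnergy S (p ⟨k, h⟩) (q ⟨k, h⟩) := by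
  ext t; simp [chainEnergy, h]

theorem chainEnergy_nonneg (p q : Fin (m + 1) → ℝ → H) (k : ℕ) (t : ℝ) :
    0 ≤ chainEnergy S p q k t := by
  cases k with
  | zero => exact le_rfl
  | succ k =>
    by_cases h : k < m + 1
    · rw [chainEnergy_succ p q h]; exact waveEnergy_nonneg _ _ _ _
    · simp [chainEnergy, h]

end ChainEnergy

section VelocityCascade

variable {𝕜 H G : Type*} [RCLike 𝕜] [NormedAddCommGroup H] [InnerProductSpace 𝕜 H]
  [NormedSpace ℝ H] [NormedAddCommGroup G] [NormedSpace 𝕜 G]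
  {S : H →L[𝕜] H} {m : ℕ}

/-- A chain of waves in which every wave is driven by the velocity of the previous one. -/
structure IsVelocityCascade (S : H →L[𝕜] H) (C : Fin m → H →L[𝕜] H) (s : Set ℝ)
    (p q : Fin (m + 1) → ℝ → H) : Prop where
  first : IsWave S s (p 0) (q 0) fun _ => 0
  next : ∀ j : Fin m, IsWave S s (p j.succ) (q j.succ) fun t => -C j (S (q j.castSucc t))

/-- The shift of indices in `chainEnergy` treats all waves alike: the source of the wave `k` is
bounded by the energy of index `k`, which belongs to the wave `k - 1`, and is zero for the free wave
`k = 0`. The constant comes from `|S q|² ≤ 2 E` and is made common to all couplings by summation. -/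
theorem IsVelocityCascade.exists_source {C : Fin m → H →L[𝕜] H} {s : Set ℝ}
    {p q : Fin (m + 1) → ℝ → H} (h : IsVelocityCascade S C s p q) {k : ℕ} (hk : k < m + 1) :
    ∃ f, IsWave S s (p ⟨k, hk⟩) (q ⟨k, hk⟩) f ∧
      ∀ t, ‖f t‖ ^ 2 ≤ (1 + ∑ j, 2 * ‖C j‖ ^ 2) * chainEnergy S p q k t := by
  cases k with
  | zero => exact ⟨_, h.first, fun t => by simp [chainEnergy]⟩
  | succ k =>
    have hk' : k < m := by omega
    refine ⟨_, h.next ⟨k, hk'⟩, fun t => ?_⟩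
    rw [chainEnergy_succ p q (by omega : k < m + 1), norm_neg]
    have h1 : 2 * ‖C ⟨k, hk'⟩‖ ^ 2 ≤ 1 + ∑ j, 2 * ‖C j‖ ^ 2 := by
      have := Finset.single_le_sum (f := fun j => 2 * ‖C j‖ ^ 2) (s := Finset.univ)
        (fun j _ => by positivity) (Finset.mem_univ ⟨k, hk'⟩)
      linarith
    have h2 := waveEnergy_nonneg S (p ⟨k, by omega⟩) (q ⟨k, by omega⟩) t
    have h3 : ‖S (q ⟨k, by omega⟩ t)‖ ^ 2 ≤
        2 * waveEnergy S (p ⟨k, by omega⟩) (q ⟨k, by omega⟩) t := by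
      unfold waveEnergy; nlinarith [sq_nonneg ‖S (p ⟨k, by omega⟩ t)‖]
    calc ‖C ⟨k, hk'⟩ (S (q ⟨k, by omega⟩ t))‖ ^ 2
        ≤ (‖C ⟨k, hk'⟩‖ * ‖S (q ⟨k, by omega⟩ t)‖) ^ 2 := by
          gcongr; exact (C ⟨k, hk'⟩).le_opNorm _
      _ = ‖C ⟨k, hk'⟩‖ ^ 2 * ‖S (q ⟨k, by omega⟩ t)‖ ^ 2 := mul_pow _ _ _
      _ ≤ ‖C ⟨k, hk'⟩‖ ^ 2 * (2 * waveEnergy S (p ⟨k, by omega⟩) (q ⟨k, by omega⟩) t) := by gcongr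
      _ = 2 * ‖C ⟨k, hk'⟩‖ ^ 2 * waveEnergy S (p ⟨k, by omega⟩) (q ⟨k, by omega⟩) t := by ring
      _ ≤ _ := by gcongr

/-- The energies of the chain satisfy the abstract inequalities of `EnergyChain`, and the window
estimate for the observed component provides the remaining hypothesis of
`exists_energy_le_observation`. -/
theorem IsVelocityCascade.exists_energy_le [IsScalarTower ℝ 𝕜 H] (hS : (S : H →ₗ[𝕜] H).IsSymmetric)
    (hex : ∀ x y : H, ∃ p q : ℝ → H, IsWave S univ p q (fun _ => 0) ∧ p 0 = x ∧ q 0 = y)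
    {C P : Fin m → H →L[𝕜] H}
    (hP : ∀ j, WaveObservable S (P j ∘L ContinuousLinearMap.snd 𝕜 H H))
    (hC : ∀ j, ∃ α : ℝ, 0 < α ∧ ∀ x, α * ‖P j x‖ ^ 2 ≤ RCLike.re ⟪C j x, x⟫_𝕜)
    {B : H × H →L[𝕜] G} (hadm : WaveAdmissible S B) (hobs : WaveObservable S B) :
    ∃ T₁ : ℝ, 0 < T₁ ∧ ∀ T ≥ T₁, ∃ d : ℝ, 0 < d ∧ ∀ p q, IsVelocityCascade S C (Icc 0 T) p q →
      ∀ j, waveEnergy S (p j) (q j) 0 ≤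
        d * ∫ t in (0 : ℝ)..T, ‖B (p (Fin.last m) t, S (q (Fin.last m) t))‖ ^ 2 := by
  obtain ⟨τ', Kw, hτ', hKw, hwin⟩ := waveEnergy_le_window hS hex hadm hobs
  choose α hα hCα using hC
  choose τ Kc hτ hKc hcoup using fun j => waveEnergy_le_of_coupling hS hex (hP j) (hα j) (hCα j)
  set κ := 1 + ∑ j, 2 * ‖C j‖ ^ 2 with hκ
  have hκ1 : 1 ≤ κ := by
    have : 0 ≤ ∑ j, 2 * ‖C j‖ ^ 2 := Finset.sum_nonneg fun j _ => by positivity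
    linarith
  -- The part `3κ` serves the growth of all `m + 1` energies, the other part the couplings, which
  -- exist only for `k < m`. The default values of `K` and `τn` beyond that range never enter a
  -- coupling inequality.
  let K : ℕ → ℝ := fun k => 3 * κ + if h : k < m then Kc ⟨k, h⟩ * κ else 0
  let τn : ℕ → ℝ := fun k => if h : k < m then τ ⟨k, h⟩ else 1
  have hK3 : ∀ k, 3 * κ ≤ K k := by
    intro k
    by_cases h : k < m
    · have := mul_pos (hKc ⟨k, h⟩) (by linarith : 0 < κ)
      simp only [K, h, dif_pos]; linarith
    · simp [K, h]
  have hK : ∀ k, 0 < K k := fun k => by linarith [hK3 k]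
  obtain ⟨T₁, hT₁, hmain⟩ := exists_energy_le_observation (n := m + 1) (K := K) (τ := τn) hK
    (by omega) (K' := Kw * τ' * κ) (τ' := τ') (by positivity)
  refine ⟨T₁, hT₁, fun T hT => ?_⟩
  obtain ⟨d, hd, hmain⟩ := hmain T hT
  have hT0 : 0 < T := by linarith
  refine ⟨d, hd, fun p q h => ?_⟩
  have hcont : ∀ k ≤ m + 1, ContinuousOn (chainEnergy S p q k) (Icc 0 T) := by
    intro k hk
    cases k with
    | zero => exact continuousOn_const
    | succ k =>
      obtain ⟨f, hf, -⟩ := h.exists_source (k := k) (by omega)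
      rw [chainEnergy_succ p q (by omega)]
      exact hf.continuousOn_waveEnergy
  have hsource : ∀ {k : ℕ}, k < m + 1 → ∀ {f : ℝ → H} {a b : ℝ}, 0 ≤ a → a ≤ b → b ≤ T →
      ContinuousOn f (Icc 0 T) → (∀ t, ‖f t‖ ^ 2 ≤ κ * chainEnergy S p q k t) →
      ∫ t in a..b, ‖f t‖ ^ 2 ≤ κ * ∫ t in a..b, chainEnergy S p q k t := by
    intro k hk f a b ha hab hb hf hle
    rw [← intervalIntegral.integral_const_mul]
    have hsub : Icc a b ⊆ Icc 0 T := Icc_subset_Icc ha hb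
    exact intervalIntegral.integral_mono_on hab
      (((hf.mono hsub).norm.pow 2).intervalIntegrable_of_Icc hab)
      ((((hcont k (by omega)).mono hsub).intervalIntegrable_of_Icc hab).const_mul κ)
      fun t _ => hle t
  have hnn : ∀ k {a b : ℝ}, a ≤ b → 0 ≤ ∫ t in a..b, chainEnergy S p q k t := fun k a b hab =>
    intervalIntegral.integral_nonneg hab fun t _ => chainEnergy_nonneg p q k t
  have hchain : EnergyChain K τn (m + 1) T (chainEnergy S p q) := by
    refine ⟨hcont, chainEnergy_nonneg p q, fun t => rfl, fun k hk s hs t ht => ?_,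
      fun k hk a b ha hb hlen ε hε => ?_⟩
    · obtain ⟨f, hf, hfle⟩ := h.exists_source hk
      have h1 := hf.waveEnergy_le hS hs ht
      rw [← chainEnergy_succ p q hk, sub_zero] at h1
      have h2 := hsource hk le_rfl hT0.le le_rfl hf.continuousOn_source hfle
      have h3 := chainEnergy_nonneg (S := S) p q (k + 1) s
      have h4 := hnn k hT0.le
      calc chainEnergy S p q (k + 1) t
          ≤ 3 * (chainEnergy S p q (k + 1) s + T * ∫ x in (0 : ℝ)..T, ‖f x‖ ^ 2) := h1
        _ ≤ 3 * (κ * chainEnergy S p q (k + 1) s +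
            T * (κ * ∫ x in (0 : ℝ)..T, chainEnergy S p q k x)) := by
          gcongr
          exact le_mul_of_one_le_left h3 hκ1
        _ = 3 * κ * (chainEnergy S p q (k + 1) s +
            T * ∫ x in (0 : ℝ)..T, chainEnergy S p q k x) := by ring
        _ ≤ _ := by gcongr; exact hK3 k
    · have hkm : k < m := by omega
      obtain ⟨f, hf, hfle⟩ := h.exists_source (k := k) (by omega)
      have hlen' : 6 * τ ⟨k, hkm⟩ ≤ b - a := by simpa only [τn, hkm, dif_pos] using hlen
      have hab : a ≤ b := by linarith [hτ ⟨k, hkm⟩]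
      have hsub : Icc a b ⊆ Icc 0 T := Icc_subset_Icc ha hb
      have h1 := hcoup ⟨k, hkm⟩ a b _ _ f _ _ hlen' (hf.mono hsub)
        ((h.next ⟨k, hkm⟩).mono hsub) ε hε
      have e1 := chainEnergy_succ (S := S) p q (by omega : k < m + 1)
      have e2 := chainEnergy_succ (S := S) p q (by omega : k + 1 < m + 1)
      rw [← e1] at h1
      have e3 : waveEnergy S (p (Fin.succ ⟨k, hkm⟩)) (q (Fin.succ ⟨k, hkm⟩)) =
        chainEnergy S p q (k + 2) := e2.symm
      rw [e3] at h1
      have h2 := hsource (by omega : k < m + 1) ha hab hb hf.continuousOn_source hfle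
      have n0 := hnn k hab
      have n1 := hnn (k + 1) hab
      have n2 := hnn (k + 2) hab
      set F := ∫ t in a..b, ‖f t‖ ^ 2
      set X := ∫ t in a..b, chainEnergy S p q (k + 1) t
      set Y := ∫ t in a..b, chainEnergy S p q (k + 2) t
      set Z := ∫ t in a..b, chainEnergy S p q k t
      have hKc0 := hKc ⟨k, hkm⟩
      refine h1.trans ?_
      calc Kc ⟨k, hkm⟩ * (F + ε * X + (ε * (b - a) ^ 2)⁻¹ * Y + ε * (b - a) ^ 2 * F)
          ≤ Kc ⟨k, hkm⟩ * (κ * Z + κ * (ε * X) + κ * ((ε * (b - a) ^ 2)⁻¹ * Y) +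
            ε * (b - a) ^ 2 * (κ * Z)) := by
            have i1 : ε * X ≤ κ * (ε * X) := le_mul_of_one_le_left (by positivity) hκ1
            have i2 : (ε * (b - a) ^ 2)⁻¹ * Y ≤ κ * ((ε * (b - a) ^ 2)⁻¹ * Y) :=
              le_mul_of_one_le_left (by positivity) hκ1
            have i3 : ε * (b - a) ^ 2 * F ≤ ε * (b - a) ^ 2 * (κ * Z) := by gcongr
            exact mul_le_mul_of_nonneg_left (by linarith) hKc0.le
        _ = Kc ⟨k, hkm⟩ * κ * (Z + ε * X + (ε * (b - a) ^ 2)⁻¹ * Y + ε * (b - a) ^ 2 * Z) := by ring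
        _ ≤ K k * (Z + ε * X + (ε * (b - a) ^ 2)⁻¹ * Y + ε * (b - a) ^ 2 * Z) := by
            gcongr
            simp only [K, hkm, dif_pos]
            linarith
  have hO0 : 0 ≤ ∫ t in (0 : ℝ)..T, ‖B (p (Fin.last m) t, S (q (Fin.last m) t))‖ ^ 2 :=
    intervalIntegral.integral_nonneg hT0.le fun _ _ => by positivity
  intro j
  have := hmain (chainEnergy S p q) _ hchain hO0 (fun hTτ => ?_) j j.2
  · rwa [chainEnergy_succ p q j.2] at this
  · obtain ⟨f, hf, hfle⟩ := h.exists_source (k := m) (by omega)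
    rw [chainEnergy_succ p q (by omega : m < m + 1), Nat.add_sub_cancel]
    have hBc : ContinuousOn (fun t => ‖B (p (Fin.last m) t, S (q (Fin.last m) t))‖ ^ 2) (Icc 0 T) :=
      hf.continuousOn_obs B
    have hfc : ContinuousOn (fun t => ‖f t‖ ^ 2) (Icc 0 T) := hf.continuousOn_source.norm.pow 2
    have hsub : Icc 0 (T / 2 + τ') ⊆ Icc 0 T := Icc_subset_Icc le_rfl (by linarith)
    have hsc : ContinuousOn
        (fun t => ‖B (p (Fin.last m) t, S (q (Fin.last m) t))‖ ^ 2 + ‖f t‖ ^ 2) (Icc 0 T) :=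
      hBc.add hfc
    -- Windows starting in `[0, T/2]` remain in `[0, T]` because `2 τ' ≤ T`; this is why only half
    -- of the interval appears on the left.
    have h1 := integral_le_of_window_le (E := waveEnergy S (p (Fin.last m)) (q (Fin.last m)))
      (g := fun t => ‖B (p (Fin.last m) t, S (q (Fin.last m) t))‖ ^ 2 + ‖f t‖ ^ 2)
      (a := 0) (b := T / 2) (τ := τ') (K := Kw) (by linarith) hτ'.le hKw.le
      (hf.continuousOn_waveEnergy.mono (Icc_subset_Icc le_rfl (by linarith)))
      (hsc.mono hsub) (fun t _ => by positivity) fun s hs =>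
        hwin _ _ f s (hf.mono (Icc_subset_Icc hs.1 (by linarith [hs.2])))
    have h2 := integral_le_integral_of_subinterval hsc (fun t _ => by positivity)
      (le_refl (0 : ℝ)) (by linarith : 0 ≤ T / 2 + τ') (by linarith)
    rw [intervalIntegral.integral_add (hBc.intervalIntegrable_of_Icc hT0.le)
      (hfc.intervalIntegrable_of_Icc hT0.le)] at h2
    have h3 := hsource (by omega : m < m + 1) le_rfl hT0.le le_rfl hf.continuousOn_source hfle
    refine h1.trans ?_
    rw [mul_assoc (Kw * τ')]
    refine mul_le_mul_of_nonneg_left (h2.trans ?_) (by positivity)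
    rw [mul_add]
    exact add_le_add (le_mul_of_one_le_left hO0 hκ1) h3

end VelocityCascade

/-! ### Primitives in time and passage to a velocity coupling. -/

section Primitive

variable {𝕜 H : Type*} [RCLike 𝕜] [NormedAddCommGroup H] [InnerProductSpace 𝕜 H]
  {S : H →L[𝕜] H} {m : ℕ} {C : Fin m → H →L[𝕜] H}

/-- The first component of the primitive in time of a solution of the cascade. -/
noncomputable def primitive (S : H →L[𝕜] H) (C : Fin m → H →L[𝕜] H) (q : Fin (m + 1) → ℝ → H) :
    Fin (m + 1) → ℝ → H :=
  Fin.induction (fun t => -S (q 0 t)) fun j z t => -S (q j.succ t) - C j (S (S (z t)))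

theorem primitive_zero (q : Fin (m + 1) → ℝ → H) (t : ℝ) :
    primitive S C q 0 t = -S (q 0 t) := rfl

theorem primitive_succ (q : Fin (m + 1) → ℝ → H) (j : Fin m) (t : ℝ) :
    primitive S C q j.succ t = -S (q j.succ t) - C j (S (S (primitive S C q j.castSucc t))) := rfl

/-- The formula for `primitive` is the cascade equation solved for `A z` when `z' = w`, so the
constants of integration are fixed by the equation. Differentiating it returns `A w = p`. -/
theorem IsCascade.hasDerivWithinAt_primitive [NormedSpace ℝ H] [IsScalarTower ℝ 𝕜 H] {s : Set ℝ}
    {p q : Fin (m + 1) → ℝ → H} (h : IsCascade S C s p q) (j : Fin (m + 1)) :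
    ∀ t ∈ s, HasDerivWithinAt (primitive S C q j) (p j t) s t := by
  induction j using Fin.induction with
  | zero =>
    intro t ht
    exact (h.first.deriv_snd t ht).neg.congr_deriv (by abel)
  | succ j ih =>
    intro t ht
    have h1 := HasDerivWithinAt.clm_comp (C j) (HasDerivWithinAt.clm_comp S
      (HasDerivWithinAt.clm_comp S (ih t ht)))
    exact (((h.next j).deriv_snd t ht).neg.sub h1).congr_deriv (by abel)

theorem IsCascade.primitive [NormedSpace ℝ H] [IsScalarTower ℝ 𝕜 H] {s : Set ℝ}
    {p q : Fin (m + 1) → ℝ → H} (h : IsCascade S C s p q) :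
    IsCascade S C s (primitive S C q) fun j t => S (p j t) := by
  have hd := h.hasDerivWithinAt_primitive
  have hc : ∀ j, ContinuousOn (Cascade.primitive S C q j) s := fun j t ht =>
    (hd j t ht).continuousWithinAt
  have hSp : ∀ j, ContinuousOn (fun t => S (p j t)) s := fun j =>
    let ⟨_, hf⟩ := h.isWave j
    S.continuous.comp_continuousOn hf.continuousOn_fst
  have hSS : ∀ j, ∀ t ∈ s, HasDerivWithinAt (fun t => S (S (p j t))) (S (q j t)) s t :=
    fun j t ht =>
      let ⟨_, hf⟩ := h.isWave j
      HasDerivWithinAt.clm_comp S (hf.deriv_fst t ht)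
  refine ⟨⟨hc 0, hSp 0, continuousOn_const, fun t ht => HasDerivWithinAt.clm_comp S (hd 0 t ht),
    fun t ht => (hSS 0 t ht).congr_deriv ?_⟩, fun j => ⟨hc j.succ, hSp j.succ, ?_, fun t ht =>
    HasDerivWithinAt.clm_comp S (hd j.succ t ht), fun t ht => (hSS j.succ t ht).congr_deriv ?_⟩⟩
  · rw [primitive_zero]; abel
  · exact ((C j).continuous.comp_continuousOn (S.continuous.comp_continuousOn
      (S.continuous.comp_continuousOn (hc j.castSucc)))).neg
  · rw [primitive_succ]; abel

/-- Twice the energy of order `1 - r` of `(w, w')`, in the variables `x = A w` and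
`y = A^{1/2} w'`. -/
noncomputable def levelEnergy (S : H →L[𝕜] H) (r : ℕ) (x y : H) : ℝ :=
  ‖(S ^ (r + 1)) x‖ ^ 2 + ‖(S ^ (r + 1)) y‖ ^ 2

theorem levelEnergy_nonneg (S : H →L[𝕜] H) (r : ℕ) (x y : H) : 0 ≤ levelEnergy S r x y := by
  unfold levelEnergy; positivity

theorem pow_succ_apply (S : H →L[𝕜] H) (k : ℕ) (x : H) : (S ^ (k + 1)) x = (S ^ k) (S x) := by
  rw [pow_succ]; rfl

/-- The coupling operators act boundedly on the negative order spaces of the cascade. -/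
def CouplingBound (S : H →L[𝕜] H) (C : Fin m → H →L[𝕜] H) (c : ℝ) : Prop :=
  0 ≤ c ∧ ∀ j : Fin m, ∀ k ≤ m - (j : ℕ), ∀ x, ‖(S ^ k) (C j x)‖ ≤ c * ‖(S ^ k) x‖

/-- For the free component `A z = -w'` and `z' = w`: integrating in time exchanges displacement and
velocity and raises the order by one, without loss. -/
theorem levelEnergy_zero_le_primitive (q p : Fin (m + 1) → ℝ → H) (r : ℕ) (t : ℝ) :
    levelEnergy S (r + 1) (p 0 t) (q 0 t) = levelEnergy S r (primitive S C q 0 t) (S (p 0 t)) := by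
  rw [levelEnergy, levelEnergy, primitive_zero, map_neg, norm_neg, pow_succ_apply S (r + 1),
    pow_succ_apply S (r + 1), add_comm]

/-- Here `w' = -A z - C z_prev`, so the velocity is recovered from the primitive up to the coupling
term. That term is bounded by the primitive of the previous component at the weaker level `r + 1`,
because `C` acts boundedly on the space of order `-(r + 1)`; hence the restriction on `r`. -/
theorem levelEnergy_succ_le_primitive {c : ℝ} (hc : CouplingBound S C c)
    (q p : Fin (m + 1) → ℝ → H) (j : Fin m) {r : ℕ} (hr : r + 1 ≤ m - (j : ℕ)) (t : ℝ) :
    levelEnergy S (r + 1) (p j.succ t) (q j.succ t) ≤ (2 + 2 * (c * ‖S‖) ^ 2) *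
      (levelEnergy S r (primitive S C q j.succ t) (S (p j.succ t)) +
        levelEnergy S (r + 1) (primitive S C q j.castSucc t) (S (p j.castSucc t))) := by
  set z := primitive S C q j.castSucc t with hz
  have h1 : S (q j.succ t) = -primitive S C q j.succ t - C j (S (S z)) := by
    rw [primitive_succ]; abel
  have h2 : ‖(S ^ (r + 1)) (C j (S (S z)))‖ ≤ c * ‖S‖ * ‖(S ^ (r + 1 + 1)) z‖ := by
    refine (hc.2 j _ hr _).trans ?_
    rw [mul_assoc]
    refine mul_le_mul_of_nonneg_left ?_ hc.1
    rw [pow_comm_apply, ← pow_succ_apply]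
    exact S.le_opNorm _
  have h3 : ‖(S ^ (r + 1 + 1)) (q j.succ t)‖ ^ 2 ≤
      2 * ‖(S ^ (r + 1)) (primitive S C q j.succ t)‖ ^ 2 +
        2 * ((c * ‖S‖) ^ 2 * ‖(S ^ (r + 1 + 1)) z‖ ^ 2) := by
    rw [pow_succ_apply, h1, map_sub, map_neg, ← mul_pow]
    refine (norm_sub_sq_le_two_mul _ _).trans ?_
    rw [norm_neg]
    gcongr
  unfold levelEnergy
  rw [pow_succ_apply S (r + 1) (p j.succ t)]
  have k1 := sq_nonneg ‖(S ^ (r + 1)) (primitive S C q j.succ t)‖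
  have k2 := sq_nonneg ‖(S ^ (r + 1)) (S (p j.succ t))‖
  have k3 := sq_nonneg ‖(S ^ (r + 1 + 1)) z‖
  have k4 := sq_nonneg ‖(S ^ (r + 1 + 1)) (S (p j.castSucc t))‖
  have k5 := sq_nonneg (c * ‖S‖)
  nlinarith [mul_nonneg k5 k1, mul_nonneg k5 k2, mul_nonneg k5 k3, mul_nonneg k5 k4]

/-- The iterated primitives in time of a solution of the cascade. -/
noncomputable def iterPrimitive (S : H →L[𝕜] H) (C : Fin m → H →L[𝕜] H)
    (p q : Fin (m + 1) → ℝ → H) : ℕ → (Fin (m + 1) → ℝ → H) × (Fin (m + 1) → ℝ → H)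
  | 0 => (p, q)
  | k + 1 => (primitive S C (iterPrimitive S C p q k).2, fun j t => S ((iterPrimitive S C p q k).1 j t))

theorem IsCascade.iterPrimitive [NormedSpace ℝ H] [IsScalarTower ℝ 𝕜 H] {s : Set ℝ}
    {p q : Fin (m + 1) → ℝ → H} (h : IsCascade S C s p q) (k : ℕ) :
    IsCascade S C s (iterPrimitive S C p q k).1 (iterPrimitive S C p q k).2 := by
  induction k with
  | zero => exact h
  | succ k ih => exact ih.primitive

/-- The `j`-th component of the `(m - j)`-fold primitive solves a cascade coupled through the
velocities. -/
theorem IsCascade.isVelocityCascade [NormedSpace ℝ H] [IsScalarTower ℝ 𝕜 H] {s : Set ℝ}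
    {p q : Fin (m + 1) → ℝ → H} (h : IsCascade S C s p q) :
    IsVelocityCascade S C s (fun j => (Cascade.iterPrimitive S C p q (m - j)).1 j)
      (fun j => (Cascade.iterPrimitive S C p q (m - j)).2 j) := by
  refine ⟨(h.iterPrimitive _).first, fun j => ?_⟩
  have h1 := (h.iterPrimitive (m - (j + 1))).next j
  have h2 : m - (j : ℕ) = m - (j + 1) + 1 := by omega
  -- The component `j` is integrated once more than the component `j + 1`; the displacement in the
  -- coupling term is therefore the velocity of the further primitive.
  simp only [Fin.val_succ, Fin.val_castSucc]
  rw [h2]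
  exact h1

/-- Induction on `j + r`, with `j + r + k = m` kept fixed. One further primitive replaces `(j, r,
k)` by `(j, r - 1, k + 1)` and, through the coupling, by `(j - 1, r, k + 1)`; both decrease `j + r`,
at the cost of a factor `2κ`. The case `r = 0` is the hypothesis, and `k = 0` gives the level `m -
j` of the original solution. -/
theorem levelEnergy_le_iterPrimitive {c : ℝ} (hc : CouplingBound S C c)
    (p q : Fin (m + 1) → ℝ → H) (t : ℝ) {X : ℝ} (hX : 0 ≤ X)
    (h : ∀ j : Fin (m + 1), levelEnergy S 0 ((iterPrimitive S C p q (m - j)).1 j t)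
      ((iterPrimitive S C p q (m - j)).2 j t) ≤ X) (n : ℕ) :
    ∀ (j : Fin (m + 1)) (r k : ℕ), j + r = n → j + r + k = m →
      levelEnergy S r ((iterPrimitive S C p q k).1 j t) ((iterPrimitive S C p q k).2 j t) ≤
        (2 * (2 + 2 * (c * ‖S‖) ^ 2)) ^ n * X := by
  set κ := 2 + 2 * (c * ‖S‖) ^ 2 with hκ
  have hκ1 : 1 ≤ κ := by nlinarith [sq_nonneg (c * ‖S‖)]
  induction n with
  | zero =>
    intro j r k hn hk
    have hr : r = 0 := by omega
    have hk' : k = m - j := by omega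
    subst hr hk'
    simpa using h j
  | succ n ih =>
    intro j r k hn hk
    have hpow : 0 ≤ (2 * κ) ^ n * X := by positivity
    cases r with
    | zero =>
      have hk' : k = m - j := by omega
      subst hk'
      refine (h j).trans (le_mul_of_one_le_left hX (one_le_pow₀ (by linarith)))
    | succ r =>
      cases j using Fin.cases with
      | zero =>
        rw [levelEnergy_zero_le_primitive (C := C)]
        refine (ih 0 r (k + 1) (by simp at hn ⊢; omega) (by simp at hk ⊢; omega)).trans ?_
        rw [pow_succ (2 * κ), mul_assoc ((2 * κ) ^ n), mul_comm (2 * κ), ← mul_assoc]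
        exact le_mul_of_one_le_right hpow (by linarith)
      | succ j =>
        simp only [Fin.val_succ] at hn hk
        refine (levelEnergy_succ_le_primitive hc _ _ j (by omega) t).trans ?_
        have h1 := ih j.succ r (k + 1) (by simp; omega) (by simp; omega)
        have h2 := ih j.castSucc (r + 1) (k + 1) (by simp; omega) (by simp; omega)
        calc κ * _ ≤ κ * ((2 * κ) ^ n * X + (2 * κ) ^ n * X) :=
              mul_le_mul_of_nonneg_left (add_le_add h1 h2) (by positivity)
          _ = _ := by ring

end Primitive

/-! ### Observability of the cascade. -/

section Observability

variable {𝕜 H G : Type*} [RCLike 𝕜] [NormedAddCommGroup H] [InnerProductSpace 𝕜 H]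
  [NormedSpace ℝ H] [IsScalarTower ℝ 𝕜 H] [NormedAddCommGroup G] [NormedSpace 𝕜 G]
  {S : H →L[𝕜] H} {m : ℕ}

/-- Over long times, the observation of the last component of the cascade controls the weakened
energies of all the components. -/
theorem IsCascade.exists_levelEnergy_le (hS : (S : H →ₗ[𝕜] H).IsSymmetric)
    (hex : ∀ x y : H, ∃ p q : ℝ → H, IsWave S univ p q (fun _ => 0) ∧ p 0 = x ∧ q 0 = y)
    {C P : Fin m → H →L[𝕜] H} {c : ℝ} (hc : CouplingBound S C c)
    (hP : ∀ j, WaveObservable S (P j ∘L ContinuousLinearMap.snd 𝕜 H H))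
    (hC : ∀ j, ∃ α : ℝ, 0 < α ∧ ∀ x, α * ‖P j x‖ ^ 2 ≤ RCLike.re ⟪C j x, x⟫_𝕜)
    {B : H × H →L[𝕜] G} (hadm : WaveAdmissible S B) (hobs : WaveObservable S B) :
    ∃ T₁ : ℝ, 0 < T₁ ∧ ∀ T ≥ T₁, ∃ d : ℝ, 0 < d ∧ ∀ p q, IsCascade S C (Icc 0 T) p q →
      ∀ j : Fin (m + 1), levelEnergy S (m - j) (p j 0) (q j 0) ≤
        d * ∫ t in (0 : ℝ)..T, ‖B (p (Fin.last m) t, S (q (Fin.last m) t))‖ ^ 2 := by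
  obtain ⟨T₁, hT₁, h⟩ := IsVelocityCascade.exists_energy_le hS hex hP hC hadm hobs
  refine ⟨T₁, hT₁, fun T hT => ?_⟩
  obtain ⟨d, hd, h⟩ := h T hT
  refine ⟨(2 * (2 + 2 * (c * ‖S‖) ^ 2)) ^ m * (2 * d), by positivity, fun p q hpq j => ?_⟩
  -- The last component undergoes `m - m = 0` integrations, so the observation of the velocity chain
  -- is that of the original cascade.
  have h1 := h _ _ hpq.isVelocityCascade
  have hO0 : 0 ≤ ∫ t in (0 : ℝ)..T, ‖B (p (Fin.last m) t, S (q (Fin.last m) t))‖ ^ 2 :=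
    intervalIntegral.integral_nonneg (by linarith) fun _ _ => by positivity
  have h2 := levelEnergy_le_iterPrimitive hc p q 0
    (X := 2 * d * ∫ t in (0 : ℝ)..T, ‖B (p (Fin.last m) t, S (q (Fin.last m) t))‖ ^ 2)
    (by positivity) (fun j => ?_) m j (m - j) 0 (by omega) (by omega)
  · rw [mul_assoc]
    exact h2
  · have h3 := h1 j
    simp only [Fin.val_last, Nat.sub_self, waveEnergy] at h3
    simp only [levelEnergy, zero_add, pow_one]
    change _ ≤ d * ∫ t in (0 : ℝ)..T, ‖B (p (Fin.last m) t, S (q (Fin.last m) t))‖ ^ 2 at h3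
    linarith

end Observability

/-! ### Representation of dominated functionals. -/

section Riesz

variable {𝕜 K E : Type*} [RCLike 𝕜] [NormedAddCommGroup K] [InnerProductSpace 𝕜 K]
  [AddCommGroup E] [Module 𝕜 E]

/-- A functional dominated by the norm of `Φ` is represented by a vector, through `Φ`. -/
theorem exists_inner_eq_of_norm_le [CompleteSpace K] (Φ : E →ₗ[𝕜] K) (l : E →ₗ[𝕜] 𝕜) {M : ℝ}
    (h : ∀ x, ‖l x‖ ≤ M * ‖Φ x‖) : ∃ η : K, ∀ x, l x = ⟪η, Φ x⟫_𝕜 := by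
  -- The domination makes `l` a bounded functional of `Φ x`; it then extends from the range of `Φ`,
  -- which need not be closed or dense, by the Hahn–Banach theorem.
  have hker : LinearMap.ker Φ ≤ LinearMap.ker l := by
    intro x hx
    have h1 := h x
    rw [LinearMap.mem_ker.1 hx, norm_zero, mul_zero] at h1
    exact LinearMap.mem_ker.2 (norm_le_zero_iff.1 h1)
  let l₁ : LinearMap.range Φ →ₗ[𝕜] 𝕜 :=
    (LinearMap.ker Φ).liftQ l hker ∘ₗ (Φ.quotKerEquivRange.symm : LinearMap.range Φ →ₗ[𝕜] _)
  have hl₁ : ∀ x, l₁ ⟨Φ x, LinearMap.mem_range_self Φ x⟩ = l x := by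
    intro x
    have : Φ.quotKerEquivRange.symm ⟨Φ x, LinearMap.mem_range_self Φ x⟩ =
        (LinearMap.ker Φ).mkQ x := by
      rw [LinearEquiv.symm_apply_eq]; rfl
    simp only [l₁, LinearMap.comp_apply, LinearEquiv.coe_coe, this]
    exact Submodule.liftQ_apply _ _ _
  obtain ⟨g, hg, -⟩ := exists_extension_norm_eq (LinearMap.range Φ)
    (l₁.mkContinuous M (by rintro ⟨_, x, rfl⟩; rw [hl₁]; exact h x))
  refine ⟨(InnerProductSpace.toDual 𝕜 K).symm g, fun x => ?_⟩
  rw [InnerProductSpace.toDual_symm_apply]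
  exact ((hg ⟨Φ x, LinearMap.mem_range_self Φ x⟩).trans (hl₁ x)).symm

theorem denseRange_of_inner_eq_zero [CompleteSpace K] (Φ : E →ₗ[𝕜] K)
    (h : ∀ ζ, (∀ x, ⟪ζ, Φ x⟫_𝕜 = 0) → ζ = 0) : DenseRange Φ := by
  have h1 : (LinearMap.range Φ)ᗮ = ⊥ := by
    rw [Submodule.eq_bot_iff]
    intro ζ hζ
    exact h ζ fun x => (Submodule.mem_orthogonal' _ _).1 hζ _ (LinearMap.mem_range_self Φ x)
  have h2 := Submodule.topologicalClosure_eq_top_iff.2 h1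
  intro x
  have h3 : x ∈ (LinearMap.range Φ).topologicalClosure := by rw [h2]; trivial
  exact h3

theorem norm_le_of_inner_le {Φ : E →ₗ[𝕜] K} (hΦ : DenseRange Φ) {η : K} {M : ℝ} (hM : 0 ≤ M)
    (h : ∀ x, ‖⟪η, Φ x⟫_𝕜‖ ≤ M * ‖Φ x‖) : ‖η‖ ≤ M := by
  have h1 : ∀ y, ‖⟪η, y⟫_𝕜‖ ≤ M * ‖y‖ := fun y => by
    refine hΦ.induction_on (p := fun y => ‖⟪η, y⟫_𝕜‖ ≤ M * ‖y‖) y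
      (isClosed_le (by fun_prop) (by fun_prop)) h
  have h2 := h1 η
  rw [inner_self_eq_norm_sq_to_K, norm_pow, RCLike.norm_ofReal, abs_norm, pow_two] at h2
  by_cases h0 : ‖η‖ = 0
  · rwa [h0]
  · exact le_of_mul_le_mul_right h2 (lt_of_le_of_ne (norm_nonneg _) (Ne.symm h0))

theorem ext_inner_of_denseRange {Φ : E →ₗ[𝕜] K} (hΦ : DenseRange Φ) {η ζ : K}
    (h : ∀ x, ⟪η, Φ x⟫_𝕜 = ⟪ζ, Φ x⟫_𝕜) : η = ζ := by
  refine sub_eq_zero.1 (norm_le_zero_iff.1 (norm_le_of_inner_le hΦ le_rfl fun x => ?_))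
  rw [inner_sub_left, h, sub_self, norm_zero, zero_mul]

variable {L : Type*} [NormedAddCommGroup L] [InnerProductSpace 𝕜 L]

/-- The adjoint of the operator `Φ x ↦ Ψ x`. -/
theorem exists_continuous_adjoint [CompleteSpace K] {Φ : E →ₗ[𝕜] K} (hΦ : DenseRange Φ) (Ψ : E →ₗ[𝕜] L) {c : ℝ}
    (hc : 0 ≤ c) (h : ∀ x, ‖Ψ x‖ ≤ c * ‖Φ x‖) :
    ∃ Λ : L → K, Continuous Λ ∧ ∀ g x, ⟪Λ g, Φ x⟫_𝕜 = ⟪g, Ψ x⟫_𝕜 := by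
  have h1 : ∀ g : L, ∃ η : K, ∀ x, ⟪g, Ψ x⟫_𝕜 = ⟪η, Φ x⟫_𝕜 := fun g =>
    exists_inner_eq_of_norm_le Φ ((innerSL 𝕜 g : L →ₗ[𝕜] 𝕜) ∘ₗ Ψ) (M := ‖g‖ * c) fun x => by
      refine (norm_inner_le_norm g (Ψ x)).trans ?_
      rw [mul_assoc]
      exact mul_le_mul_of_nonneg_left (h x) (norm_nonneg g)
  choose Λ hΛ using h1
  refine ⟨Λ, ?_, fun g x => (hΛ g x).symm⟩
  -- Density of the range of `Φ` determines the representing vectors and bounds their differences,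
  -- so separate choices for each `g` still give a continuous map.
  refine (LipschitzWith.of_dist_le_mul (K := ⟨c, hc⟩) fun g g' => ?_).continuous
  rw [dist_eq_norm, dist_eq_norm]
  refine norm_le_of_inner_le hΦ (mul_nonneg hc (norm_nonneg _)) fun x => ?_
  rw [inner_sub_left, ← hΛ, ← hΛ, ← inner_sub_left]
  refine (norm_inner_le_norm _ _).trans ?_
  change _ ≤ c * _ * _
  rw [mul_comm c, mul_assoc]
  exact mul_le_mul_of_nonneg_left (h x) (norm_nonneg _)

end Riesz

/-! ### Translations in `L²` and correlations. -/

section Translation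

variable {𝕜 G : Type*} [RCLike 𝕜] [NormedAddCommGroup G] [InnerProductSpace 𝕜 G]

theorem memLp_indicator_Ioo {f : ℝ → G} (hf : Continuous f) (a b : ℝ) :
    MemLp (indicator (Ioo a b) f) 2 volume := by
  rw [memLp_indicator_iff_restrict measurableSet_Ioo]
  obtain ⟨C, hC⟩ := (isCompact_Icc (a := a) (b := b)).exists_bound_of_continuousOn hf.continuousOn
  refine MemLp.of_bound hf.aestronglyMeasurable C ?_
  filter_upwards [ae_restrict_mem measurableSet_Ioo] with t ht
  exact hC t (Ioo_subset_Icc_self ht)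

theorem norm_toLp_indicator_sq (𝕜 : Type*) {G : Type*} [RCLike 𝕜] [NormedAddCommGroup G]
    [InnerProductSpace 𝕜 G] {f : ℝ → G} (hf : Continuous f) {T : ℝ} (hT : 0 ≤ T) :
    ‖(memLp_indicator_Ioo hf 0 T).toLp‖ ^ 2 = ∫ t in (0 : ℝ)..T, ‖f t‖ ^ 2 := by
  have h2 := (memLp_indicator_Ioo hf 0 T).coeFn_toLp
  set g := (memLp_indicator_Ioo hf 0 T).toLp
  have h1 : ((‖g‖ ^ 2 : ℝ) : 𝕜) = ((∫ t in (0 : ℝ)..T, ‖f t‖ ^ 2 : ℝ) : 𝕜) := by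
    rw [RCLike.ofReal_pow, ← inner_self_eq_norm_sq_to_K, L2.inner_def,
      intervalIntegral.integral_of_le hT, integral_Ioc_eq_integral_Ioo, ← integral_ofReal,
      ← integral_indicator measurableSet_Ioo]
    refine integral_congr_ae ?_
    filter_upwards [h2] with t ht
    rw [ht]
    by_cases h : t ∈ Ioo 0 T
    · rw [indicator_of_mem h, indicator_of_mem h, inner_self_eq_norm_sq_to_K, RCLike.ofReal_pow]
    · rw [indicator_of_notMem h, indicator_of_notMem h, inner_zero_left]
  exact RCLike.ofReal_injective h1

/-- Translation on `L²(ℝ; G)`. -/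
noncomputable def shiftLp (g : Lp G 2 (volume : Measure ℝ)) (τ : ℝ) : Lp G 2 (volume : Measure ℝ) :=
  Lp.compMeasurePreserving (· + τ) (measurePreserving_add_right volume τ) g

theorem continuous_shiftLp (g : Lp G 2 (volume : Measure ℝ)) : Continuous (shiftLp g) := by
  have hc : Continuous fun τ : ℝ => (⟨fun t => t + τ, by fun_prop⟩ : C(ℝ, ℝ)) :=
    ContinuousMap.continuous_of_continuous_uncurry _ (by
      change Continuous fun z : ℝ × ℝ => z.2 + z.1
      fun_prop)
  exact Continuous.compMeasurePreservingLp continuous_const hc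
    (fun τ => measurePreserving_add_right volume τ) (by norm_num)

/-- The translate of a control supported in `(0, T)` meets the window `(0, T)` only where `t + τ <
T`. Shifting the variable back turns the pairing into the remaining action of the control on `(τ,
T)`. -/
theorem inner_shiftLp {g : ℝ → G} {T τ : ℝ} (hg : MemLp (indicator (Ioo 0 T) g) 2 volume)
    {f : ℝ → G} (hf : Continuous f) (hτ : τ ∈ Icc 0 T) :
    ⟪shiftLp hg.toLp τ, (memLp_indicator_Ioo hf 0 T).toLp⟫_𝕜 =
      ∫ t in τ..T, ⟪g t, f (t - τ)⟫_𝕜 := by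
  have hshift : Filter.Tendsto (fun t : ℝ => t + τ) (ae volume) (ae volume) :=
    (measurePreserving_add_right volume τ).quasiMeasurePreserving.tendsto_ae
  rw [L2.inner_def, intervalIntegral.integral_of_le hτ.2, integral_Ioc_eq_integral_Ioo,
    ← integral_indicator measurableSet_Ioo,
    ← integral_add_right_eq_self (indicator (Ioo τ T) fun t => ⟪g t, f (t - τ)⟫_𝕜) τ]
  refine integral_congr_ae ?_
  filter_upwards [Lp.coeFn_compMeasurePreserving hg.toLp (measurePreserving_add_right volume τ),
    hshift.eventually hg.coeFn_toLp, (memLp_indicator_Ioo hf 0 T).coeFn_toLp] with t h1 h2 h3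
  rw [shiftLp, h1, h3, Function.comp_apply, h2]
  by_cases ht : t + τ ∈ Ioo τ T
  · have ht' : t ∈ Ioo 0 T := ⟨by linarith [ht.1], by linarith [ht.2, hτ.1]⟩
    have ht'' : t + τ ∈ Ioo 0 T := ⟨by linarith [ht'.1, hτ.1], ht.2⟩
    rw [indicator_of_mem ht, indicator_of_mem ht', indicator_of_mem ht'', add_sub_cancel_right]
  · rw [indicator_of_notMem ht]
    by_cases h4 : t ∈ Ioo 0 T
    · rw [indicator_of_notMem (s := Ioo 0 T) (a := t + τ), inner_zero_left]
      exact fun h5 => ht ⟨by linarith [h4.1], h5.2⟩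
    · rw [indicator_of_notMem h4, inner_zero_right]

/-- Differentiation of a correlation in the shift. -/
theorem hasDerivWithinAt_integral_shift [NormedSpace ℝ G] [IsScalarTower ℝ 𝕜 G] {g : ℝ → G} {T : ℝ}
    (hg : MemLp g 2 (volume.restrict (Ioo 0 T))) {k k' : ℝ → G} (hk : ∀ t, HasDerivAt k (k' t) t)
    (hk' : Continuous k') (hk0 : k 0 = 0) {τ : ℝ} (hτ : τ ∈ Icc 0 T) :
    HasDerivWithinAt (fun τ => ∫ t in τ..T, ⟪g t, k (t - τ)⟫_𝕜)
      (-∫ t in τ..T, ⟪g t, k' (t - τ)⟫_𝕜) (Icc 0 T) τ := by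
  set μ : Measure ℝ := volume.restrict (Ioo 0 T) with hμ
  have hkc : Continuous k := continuous_iff_continuousAt.2 fun t => (hk t).continuousAt
  obtain ⟨c, hc⟩ := (isCompact_Icc (a := (0 : ℝ)) (b := T + 1)).exists_bound_of_continuousOn
    hk'.continuousOn
  have hc0 : 0 ≤ c := (norm_nonneg _).trans (hc 0 ⟨le_rfl, by linarith [hτ.1, hτ.2]⟩)
  have hlip : ∀ a ≤ T + 1, ∀ b ≤ T + 1, ‖k (max a 0) - k (max b 0)‖ ≤ c * |a - b| := by
    intro a ha b hb
    have hT : 0 ≤ T + 1 := by linarith [hτ.1, hτ.2]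
    refine ((convex_Icc (0 : ℝ) (T + 1)).norm_image_sub_le_of_norm_hasDerivWithin_le
      (fun x _ => (hk x).hasDerivWithinAt) hc ⟨le_max_right b 0, max_le hb hT⟩
      ⟨le_max_right a 0, max_le ha hT⟩).trans ?_
    refine mul_le_mul_of_nonneg_left ?_ hc0
    have := abs_max_sub_max_le_abs a b 0
    rwa [Real.norm_eq_abs]
  -- Since `k 0 = 0`, truncating the argument at `0` moves the dependence on `σ` from the limits of
  -- integration into a Lipschitz integrand, and dominated differentiation applies. The corner at `t
  -- = σ` is a null set.
  let F : ℝ → ℝ → 𝕜 := fun σ t => ⟪g t, k (max (t - σ) 0)⟫_𝕜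
  let F' : ℝ → 𝕜 := indicator (Ioi τ) fun t => -⟪g t, k' (t - τ)⟫_𝕜
  have hFm : ∀ σ, AEStronglyMeasurable (F σ) μ := fun σ =>
    hg.aestronglyMeasurable.inner (Continuous.aestronglyMeasurable (by fun_prop))
  have hgi : Integrable (fun t => ‖g t‖) μ := (hg.integrable (by norm_num)).norm
  have hF0 : ∀ σ ∈ Icc 0 T, ∫ t in σ..T, ⟪g t, k (t - σ)⟫_𝕜 = ∫ t, F σ t ∂μ := by
    intro σ hσ
    rw [intervalIntegral.integral_of_le hσ.2, integral_Ioc_eq_integral_Ioo]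
    have h1 : ∫ t in Ioo σ T, ⟪g t, k (t - σ)⟫_𝕜 = ∫ t in Ioo σ T, F σ t :=
      setIntegral_congr_fun measurableSet_Ioo fun t ht => by
        simp only [F]
        rw [max_eq_left (sub_nonneg.2 ht.1.le)]
    rw [h1]
    refine (setIntegral_eq_of_subset_of_forall_sdiff_eq_zero measurableSet_Ioo
      (Ioo_subset_Ioo_left hσ.1) fun t ht => ?_).symm
    have : t - σ ≤ 0 := by
      by_contra h
      exact ht.2 ⟨by linarith, ht.1.2⟩
    simp only [F]
    rw [max_eq_right this, hk0, inner_zero_right]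
  have hF'0 : ∫ t, F' t ∂μ = -∫ t in τ..T, ⟪g t, k' (t - τ)⟫_𝕜 := by
    rw [intervalIntegral.integral_of_le hτ.2, integral_Ioc_eq_integral_Ioo, ← integral_neg,
      integral_indicator measurableSet_Ioi, hμ, Measure.restrict_restrict measurableSet_Ioi]
    congr 2
    ext t
    exact ⟨fun h => ⟨h.1, h.2.2⟩, fun h => ⟨h.1, hτ.1.trans_lt h.1, h.2⟩⟩
  have hFi : Integrable (F τ) μ := by
    refine (hgi.mul_const (c * (T + 1))).mono' (hFm τ) ?_
    filter_upwards [ae_restrict_mem measurableSet_Ioo] with t ht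
    refine (norm_inner_le_norm _ _).trans (mul_le_mul_of_nonneg_left ?_ (norm_nonneg _))
    have h1 := hlip (t - τ) (by linarith [ht.2, hτ.1]) 0 (by linarith [hτ.1, hτ.2])
    rw [max_self, hk0, sub_zero, sub_zero] at h1
    refine h1.trans (mul_le_mul_of_nonneg_left ?_ hc0)
    exact abs_le.2 ⟨by linarith [ht.1, hτ.2], by linarith [ht.2, hτ.1]⟩
  have key := hasDerivAt_integral_of_dominated_loc_of_lip (𝕜 := ℝ) (μ := μ) (F := F) (F' := F')
    (bound := fun t => ‖g t‖ * c) (s := Metric.ball τ 1) (Metric.ball_mem_nhds τ one_pos)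
    (Eventually.of_forall hFm) hFi ?_ ?_ (hgi.mul_const c) ?_
  · rw [← hF'0]
    exact key.2.hasDerivWithinAt.congr (fun σ hσ => hF0 σ hσ) (hF0 τ hτ)
  · refine AEStronglyMeasurable.indicator ?_ measurableSet_Ioi
    exact (hg.aestronglyMeasurable.inner (Continuous.aestronglyMeasurable (by fun_prop))).neg
  · filter_upwards [ae_restrict_mem measurableSet_Ioo] with t ht
    refine LipschitzOnWith.of_dist_le_mul fun a ha b hb => ?_
    rw [Metric.mem_ball, Real.dist_eq, abs_lt] at ha hb
    rw [dist_eq_norm, Real.coe_nnabs, abs_of_nonneg (mul_nonneg (norm_nonneg _) hc0), mul_assoc]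
    simp only [F]
    rw [← inner_sub_right]
    refine (norm_inner_le_norm _ _).trans (mul_le_mul_of_nonneg_left ?_ (norm_nonneg _))
    refine (hlip _ (by linarith [ht.2, hτ.1]) _ (by linarith [ht.2, hτ.1])).trans_eq ?_
    rw [sub_sub_sub_cancel_left, abs_sub_comm, Real.dist_eq]
  · have hne : ∀ᵐ t ∂μ, t ≠ τ := ae_restrict_of_ae (by simp [ae_iff])
    filter_upwards [hne] with t ht
    rcases lt_or_gt_of_ne ht with h | h
    · simp only [F', indicator_of_notMem (notMem_Ioi.2 h.le)]
      refine (hasDerivAt_const τ (0 : 𝕜)).congr_of_eventuallyEq ?_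
      filter_upwards [lt_mem_nhds h] with σ hσ
      simp only [F]
      rw [max_eq_right (by linarith), hk0, inner_zero_right]
    · simp only [F', indicator_of_mem (mem_Ioi.2 h)]
      have h1 : HasDerivAt (fun σ => k (t - σ)) (-k' (t - τ)) τ := by
        have := (hk (t - τ)).scomp τ ((hasDerivAt_id τ).const_sub t)
        rwa [neg_one_smul] at this
      have h2 := HasDerivWithinAt.clm_comp (innerSL 𝕜 (g t)) h1.hasDerivWithinAt (s := univ)
      rw [hasDerivWithinAt_univ, map_neg] at h2
      refine HasDerivAt.congr_of_eventuallyEq h2 ?_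
      filter_upwards [gt_mem_nhds h] with σ hσ
      simp only [F]
      rw [max_eq_left (by linarith)]
      rfl

end Translation

/-! ### Weak norms of the data and uniqueness for the cascade. -/

section WeakState

variable {𝕜 H : Type*} [RCLike 𝕜] [NormedAddCommGroup H] [InnerProductSpace 𝕜 H]
  {S : H →L[𝕜] H} {m : ℕ}

theorem inner_pow_apply (hS : (S : H →ₗ[𝕜] H).IsSymmetric) (k : ℕ) (x y : H) :
    ⟪x, (S ^ k) y⟫_𝕜 = ⟪(S ^ k) x, y⟫_𝕜 := by
  induction k generalizing x y with
  | zero => rfl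
  | succ k ih =>
    rw [pow_succ_apply_left S k y, pow_succ_apply S k x, ← ih]
    exact (hS x _).symm

theorem pow_injective (hinj : Function.Injective S) (k : ℕ) : Function.Injective (S ^ k) := by
  induction k with
  | zero => exact fun x y h => h
  | succ k ih => exact fun x y h => hinj (ih (by simpa only [pow_succ_apply] using h))

/-- The data `(x, y)` of the cascade, with the component of index `j` measured in the norm of
negative order `m - j + s`. -/
noncomputable def weakState (S : H →L[𝕜] H) (m s : ℕ) :
    ((Fin (m + 1) → H) × (Fin (m + 1) → H)) →ₗ[𝕜]
      PiLp 2 (fun _ : Fin (m + 1) ⊕ Fin (m + 1) => H) where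
  toFun d := WithLp.toLp 2 (Sum.elim (fun j => (S ^ (m - (j : ℕ) + s + 1)) (d.1 j))
    fun j => (S ^ (m - (j : ℕ) + s + 1)) (d.2 j))
  map_add' d e := by
    ext i
    rcases i with j | j <;> simp
  map_smul' c d := by
    ext i
    rcases i with j | j <;> simp

theorem norm_weakState_sq (s : ℕ) (d : (Fin (m + 1) → H) × (Fin (m + 1) → H)) :
    ‖weakState S m s d‖ ^ 2 = ∑ j : Fin (m + 1), levelEnergy S (m - (j : ℕ) + s) (d.1 j) (d.2 j) := by
  rw [PiLp.norm_sq_eq_of_L2, Fintype.sum_sum_type, ← Finset.sum_add_distrib]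
  rfl

theorem inner_weakState (s : ℕ) (η : PiLp 2 (fun _ : Fin (m + 1) ⊕ Fin (m + 1) => H))
    (d : (Fin (m + 1) → H) × (Fin (m + 1) → H)) :
    ⟪η, weakState S m s d⟫_𝕜 = ∑ j, (⟪η (Sum.inl j), (S ^ (m - (j : ℕ) + s + 1)) (d.1 j)⟫_𝕜 +
      ⟪η (Sum.inr j), (S ^ (m - (j : ℕ) + s + 1)) (d.2 j)⟫_𝕜) := by
  rw [PiLp.inner_apply, Fintype.sum_sum_type, ← Finset.sum_add_distrib]
  rfl

theorem inner_weakState_single_left (s : ℕ) (η : PiLp 2 (fun _ : Fin (m + 1) ⊕ Fin (m + 1) => H))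
    (j : Fin (m + 1)) (x : H) : ⟪η, weakState S m s (Pi.single j x, 0)⟫_𝕜 =
      ⟪η (Sum.inl j), (S ^ (m - (j : ℕ) + s + 1)) x⟫_𝕜 := by
  rw [inner_weakState, Finset.sum_eq_single j]
  · simp
  · intro i _ hi
    simp [Pi.single_eq_of_ne hi]
  · simp

theorem inner_weakState_single_right (s : ℕ) (η : PiLp 2 (fun _ : Fin (m + 1) ⊕ Fin (m + 1) => H))
    (j : Fin (m + 1)) (x : H) : ⟪η, weakState S m s (0, Pi.single j x)⟫_𝕜 =
      ⟪η (Sum.inr j), (S ^ (m - (j : ℕ) + s + 1)) x⟫_𝕜 := by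
  rw [inner_weakState, Finset.sum_eq_single j]
  · simp
  · intro i _ hi
    simp [Pi.single_eq_of_ne hi]
  · simp

theorem eq_zero_of_inner_weakState (hS : (S : H →ₗ[𝕜] H).IsSymmetric)
    (hinj : Function.Injective S) (s : ℕ) (η : PiLp 2 (fun _ : Fin (m + 1) ⊕ Fin (m + 1) => H))
    (h : ∀ d, ⟪η, weakState S m s d⟫_𝕜 = 0) : η = 0 := by
  have key : ∀ (k : ℕ) (x : H), (∀ y, ⟪x, (S ^ k) y⟫_𝕜 = 0) → x = 0 := fun k x hx => by
    have h1 : (S ^ k) x = 0 :=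
      inner_self_eq_zero (𝕜 := 𝕜).1 ((inner_pow_apply hS k x _).symm.trans (hx _))
    exact pow_injective hinj k (h1.trans (map_zero _).symm)
  ext i
  rcases i with j | j
  · exact key _ _ fun y => (inner_weakState_single_left s η j y).symm.trans (h _)
  · exact key _ _ fun y => (inner_weakState_single_right s η j y).symm.trans (h _)

theorem IsCascade.continuous_fst [NormedSpace ℝ H] {C : Fin m → H →L[𝕜] H}
    {p q : Fin (m + 1) → ℝ → H} (h : IsCascade S C univ p q)
    (j : Fin (m + 1)) : Continuous (p j) :=
  let ⟨_, hf⟩ := h.isWave j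
  continuousOn_univ.1 hf.continuousOn_fst

end WeakState

section Uniqueness

variable {𝕜 H : Type*} [RCLike 𝕜] [NormedAddCommGroup H] [InnerProductSpace 𝕜 H]
  [NormedSpace ℝ H] [IsScalarTower ℝ 𝕜 H] {S : H →L[𝕜] H} {m : ℕ} {C : Fin m → H →L[𝕜] H}

/-- By the growth estimate the energy stays zero, and the injectivity of `S` turns zero energy into
`p = q = 0`. -/
theorem IsWave.eq_zero (hS : (S : H →ₗ[𝕜] H).IsSymmetric) (hinj : Function.Injective S) {a b : ℝ}
    {p q f : ℝ → H} (h : IsWave S (Icc a b) p q f) (hf : ∀ t ∈ Icc a b, f t = 0) (hp : p a = 0)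
    (hq : q a = 0) : ∀ t ∈ Icc a b, p t = 0 ∧ q t = 0 := by
  intro t ht
  have hab := ht.1.trans ht.2
  have h1 := h.waveEnergy_le hS (left_mem_Icc.2 hab) ht
  have h2 : ∫ x in a..b, ‖f x‖ ^ 2 = 0 := by
    rw [intervalIntegral.integral_congr (g := fun _ => (0 : ℝ)) fun x hx => ?_]
    · simp
    · rw [uIcc_of_le hab] at hx
      simp [hf x hx]
  rw [h2, waveEnergy, waveEnergy, hp, hq, map_zero, norm_zero] at h1
  have h3 : ‖S (p t)‖ = 0 := by nlinarith [norm_nonneg (S (p t)), sq_nonneg ‖S (q t)‖]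
  have h4 : ‖S (q t)‖ = 0 := by nlinarith [norm_nonneg (S (q t)), sq_nonneg ‖S (p t)‖]
  exact ⟨hinj ((norm_eq_zero.1 h3).trans (map_zero S).symm),
    hinj ((norm_eq_zero.1 h4).trans (map_zero S).symm)⟩

theorem IsCascade.eq_zero (hS : (S : H →ₗ[𝕜] H).IsSymmetric) (hinj : Function.Injective S)
    {a b : ℝ} {p q : Fin (m + 1) → ℝ → H} (h : IsCascade S C (Icc a b) p q)
    (hp : ∀ j, p j a = 0) (hq : ∀ j, q j a = 0) (j : Fin (m + 1)) :
    ∀ t ∈ Icc a b, p j t = 0 ∧ q j t = 0 := by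
  induction j using Fin.induction with
  | zero => exact h.first.eq_zero hS hinj (fun _ _ => rfl) (hp 0) (hq 0)
  | succ j ih =>
    exact (h.next j).eq_zero hS hinj (fun t ht => by rw [(ih t ht).1]; simp) (hp _) (hq _)

theorem IsCascade.eq_of_initial (hS : (S : H →ₗ[𝕜] H).IsSymmetric) (hinj : Function.Injective S)
    {a b : ℝ} {p q p₁ q₁ : Fin (m + 1) → ℝ → H} (h : IsCascade S C (Icc a b) p q)
    (h₁ : IsCascade S C (Icc a b) p₁ q₁) (hp : ∀ j, p j a = p₁ j a) (hq : ∀ j, q j a = q₁ j a)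
    (j : Fin (m + 1)) : ∀ t ∈ Icc a b, p j t = p₁ j t ∧ q j t = q₁ j t := fun t ht =>
  let ⟨h1, h2⟩ := (h.sub h₁).eq_zero hS hinj (fun j => sub_eq_zero.2 (hp j))
    (fun j => sub_eq_zero.2 (hq j)) j t ht
  ⟨sub_eq_zero.1 h1, sub_eq_zero.1 h2⟩

end Uniqueness

/-! ### The Hilbert uniqueness method. -/

section Control

theorem inner_toLp_indicator {𝕜 G : Type*} [RCLike 𝕜] [NormedAddCommGroup G]
    [InnerProductSpace 𝕜 G] (g : Lp G 2 (volume : Measure ℝ)) {f : ℝ → G} (hf : Continuous f)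
    {T : ℝ} (hT : 0 ≤ T) : ⟪g, (memLp_indicator_Ioo hf 0 T).toLp⟫_𝕜 =
      ∫ t in (0 : ℝ)..T, ⟪g t, f t⟫_𝕜 := by
  rw [L2.inner_def, intervalIntegral.integral_of_le hT, integral_Ioc_eq_integral_Ioo,
    ← integral_indicator measurableSet_Ioo]
  refine integral_congr_ae ?_
  filter_upwards [(memLp_indicator_Ioo hf 0 T).coeFn_toLp] with t ht
  rw [ht]
  by_cases h : t ∈ Ioo 0 T
  · rw [indicator_of_mem h, indicator_of_mem h]
  · rw [indicator_of_notMem h, indicator_of_notMem h, inner_zero_right]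

theorem intervalIntegrable_inner {𝕜 G : Type*} [RCLike 𝕜] [NormedAddCommGroup G]
    [InnerProductSpace 𝕜 G] {v f : ℝ → G} {T : ℝ} (hT : 0 ≤ T)
    (hv : MemLp v 2 (volume.restrict (Ioo 0 T))) (hf : Continuous f) :
    IntervalIntegrable (fun t => ⟪v t, f t⟫_𝕜) volume 0 T := by
  rw [intervalIntegrable_iff_integrableOn_Ioo_of_le hT]
  obtain ⟨c, hc⟩ := (isCompact_Icc (a := (0 : ℝ)) (b := T)).exists_bound_of_continuousOn
    hf.continuousOn
  refine ((hv.integrable (by norm_num)).norm.mul_const c).mono'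
    (hv.aestronglyMeasurable.inner hf.aestronglyMeasurable) ?_
  filter_upwards [ae_restrict_mem measurableSet_Ioo] with t ht
  exact (norm_inner_le_norm _ _).trans
    (mul_le_mul_of_nonneg_left (hc t (Ioo_subset_Icc_self ht)) (norm_nonneg _))

variable {𝕜 H G : Type*} [RCLike 𝕜] [NormedAddCommGroup H] [InnerProductSpace 𝕜 H]
  [NormedSpace ℝ H] [IsScalarTower ℝ 𝕜 H] [NormedAddCommGroup G] [InnerProductSpace 𝕜 G]
  {S : H →L[𝕜] H} {m : ℕ} {C : Fin m → H →L[𝕜] H}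

/-- The space of the solutions of the cascade on the whole line. -/
def cascadeSolutions (S : H →L[𝕜] H) (C : Fin m → H →L[𝕜] H) :
    Submodule 𝕜 ((Fin (m + 1) → ℝ → H) × (Fin (m + 1) → ℝ → H)) where
  carrier := {W | IsCascade S C univ W.1 W.2}
  add_mem' h h' := IsCascade.add h h'
  zero_mem' := isCascade_zero
  smul_mem' c _ h := IsCascade.smul c h

/-- Hilbert uniqueness method: an observed and admissible cascade is null controllable by
transposition, with a state that depends continuously on time and is differentiable in the weak
sense. -/
theorem exists_transposition_control [CompleteSpace H] [CompleteSpace G]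
    (hS : (S : H →ₗ[𝕜] H).IsSymmetric)
    (hinj : Function.Injective S)
    (hex : ∀ x y : Fin (m + 1) → H, ∃ p q : Fin (m + 1) → ℝ → H, IsCascade S C univ p q ∧
      (∀ j, p j 0 = x j) ∧ ∀ j, q j 0 = y j)
    (β : H →L[𝕜] G) (s : ℕ) {T c : ℝ} (hT : 0 ≤ T) (hc : 0 ≤ c)
    (hadm : ∀ p q, IsCascade S C univ p q → ∫ t in (0 : ℝ)..T, ‖β (p (Fin.last m) t)‖ ^ 2 ≤
      c * ‖weakState S m s (fun j => p j 0, fun j => q j 0)‖ ^ 2)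
    (hobs : ∀ p q, IsCascade S C univ p q →
      ‖weakState S m s (fun j => p j 0, fun j => q j 0)‖ ^ 2 ≤
        c * ∫ t in (0 : ℝ)..T, ‖β (p (Fin.last m) t)‖ ^ 2)
    (η₀ : PiLp 2 (fun _ : Fin (m + 1) ⊕ Fin (m + 1) => H)) :
    ∃ v : ℝ → G, MemLp v 2 (volume.restrict (Ioo 0 T)) ∧
      ∃ η : ℝ → PiLp 2 (fun _ : Fin (m + 1) ⊕ Fin (m + 1) => H),
        Continuous η ∧ η 0 = η₀ ∧ η T = 0 ∧
        (∀ p q, IsCascade S C (Icc 0 T) p q → ∀ τ ∈ Icc 0 T,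
          ∫ t in (0 : ℝ)..τ, ⟪v t, β (p (Fin.last m) t)⟫_𝕜 =
            ⟪η τ, weakState S m s (fun j => p j τ, fun j => q j τ)⟫_𝕜 -
            ⟪η₀, weakState S m s (fun j => p j 0, fun j => q j 0)⟫_𝕜) ∧
        ∀ (j : Fin (m + 1)) (x : H), ∀ τ ∈ Icc 0 T,
          HasDerivWithinAt (fun τ => ⟪η τ, weakState S m s (0, Pi.single j (S x))⟫_𝕜)
            (-⟪η τ, weakState S m s (Pi.single j x, 0)⟫_𝕜) (Icc 0 T) τ := by
  -- `Φ` reads the initial data in the weak norm and `Ψ` the observation on `(0, T)`; the two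
  -- hypotheses say that their norms are equivalent. Solutions live on the whole line so that they
  -- can be translated freely.
  let Φ : cascadeSolutions S C →ₗ[𝕜] PiLp 2 (fun _ : Fin (m + 1) ⊕ Fin (m + 1) => H) :=
    weakState S m s ∘ₗ
      { toFun := fun W => (fun j => W.1.1 j 0, fun j => W.1.2 j 0)
        map_add' := fun _ _ => rfl
        map_smul' := fun _ _ => rfl }
  have hΦ : ∀ p q (h : IsCascade S C univ p q),
      Φ ⟨(p, q), h⟩ = weakState S m s (fun j => p j 0, fun j => q j 0) := fun _ _ _ => rfl
  have hβc : ∀ W : cascadeSolutions S C, Continuous fun t => β (W.1.1 (Fin.last m) t) := fun W =>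
    β.continuous.comp (IsCascade.continuous_fst W.2 (Fin.last m))
  let Ψ : cascadeSolutions S C →ₗ[𝕜] Lp G 2 (volume : Measure ℝ) :=
    { toFun := fun W => (memLp_indicator_Ioo (hβc W) 0 T).toLp
      map_add' := fun W V => by
        rw [← MemLp.toLp_add, MemLp.toLp_eq_toLp_iff]
        refine Eventually.of_forall fun t => ?_
        rw [← indicator_add']
        exact congrFun (congrArg _ (funext fun t => map_add β _ _)) t
      map_smul' := fun a W => by
        rw [RingHom.id_apply, ← MemLp.toLp_const_smul, MemLp.toLp_eq_toLp_iff]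
        refine Eventually.of_forall fun t => ?_
        by_cases ht : t ∈ Ioo 0 T
        · simp only [indicator_of_mem ht, Pi.smul_apply]
          exact map_smul β _ _
        · simp only [indicator_of_notMem ht, Pi.smul_apply, smul_zero] }
  have hΨn : ∀ W, ‖Ψ W‖ ^ 2 = ∫ t in (0 : ℝ)..T, ‖β (W.1.1 (Fin.last m) t)‖ ^ 2 := fun W =>
    norm_toLp_indicator_sq 𝕜 (hβc W) hT
  have hdense : DenseRange Φ := denseRange_of_inner_eq_zero Φ fun ζ hζ =>
    eq_zero_of_inner_weakState hS hinj s ζ fun d => by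
      obtain ⟨p, q, h, hp, hq⟩ := hex d.1 d.2
      rw [show d = (fun j => p j 0, fun j => q j 0) from
        Prod.ext (funext fun j => (hp j).symm) (funext fun j => (hq j).symm)]
      exact hζ ⟨(p, q), h⟩
  have hsq : ∀ {x y : ℝ}, 0 ≤ y → x ^ 2 ≤ c * y ^ 2 → x ≤ √c * y := fun hy h => by
    refine abs_le_of_sq_le_sq' ?_ (by positivity) |>.2
    rwa [mul_pow, Real.sq_sqrt hc]
  have hΨΦ : ∀ W, ‖Ψ W‖ ≤ √c * ‖Φ W‖ := fun W => hsq (norm_nonneg _) (by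
    rw [hΨn]; exact hadm _ _ W.2)
  have hΦΨ : ∀ W, ‖Φ W‖ ≤ √c * ‖Ψ W‖ := fun W => hsq (norm_nonneg _) (by
    rw [hΨn]; exact hobs _ _ W.2)
  obtain ⟨Λ, hΛc, hΛ⟩ := exists_continuous_adjoint hdense Ψ (Real.sqrt_nonneg c) hΨΦ
  -- The control: observability bounds the functional defined by `η₀` by the observation, so that an
  -- element of `L²` represents it.
  obtain ⟨g, hg⟩ := exists_inner_eq_of_norm_le Ψ (-(innerSL 𝕜 η₀ : _ →ₗ[𝕜] 𝕜) ∘ₗ Φ)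
    (M := ‖η₀‖ * √c) fun W => by
      change ‖-⟪η₀, Φ W⟫_𝕜‖ ≤ _
      rw [norm_neg]
      refine (norm_inner_le_norm _ _).trans ?_
      rw [mul_assoc]
      exact mul_le_mul_of_nonneg_left (hΦΨ W) (norm_nonneg _)
  have hg' : ∀ W : cascadeSolutions S C,
      ∫ t in (0 : ℝ)..T, ⟪g t, β (W.1.1 (Fin.last m) t)⟫_𝕜 = -⟪η₀, Φ W⟫_𝕜 := fun W =>
    (inner_toLp_indicator g (hβc W) hT).symm.trans (hg W).symm
  have hgm : MemLp g 2 (volume.restrict (Ioo 0 T)) := (Lp.memLp g).restrict _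
  have hgi : MemLp (indicator (Ioo 0 T) g) 2 volume :=
    (memLp_indicator_iff_restrict measurableSet_Ioo).2 hgm
  -- The state at time `τ` must cancel what the control still does on `(τ, T)`. For the solution
  -- that starts from given data at time `τ`, this is the pairing of the translated control with the
  -- observation, so the adjoint `Λ` of "data ↦ observation" yields the state.
  set η : ℝ → PiLp 2 (fun _ : Fin (m + 1) ⊕ Fin (m + 1) => H) :=
    fun τ => -Λ (shiftLp hgi.toLp τ) with hη
  have key : ∀ τ ∈ Icc 0 T, ∀ W : cascadeSolutions S C,
      ⟪η τ, Φ W⟫_𝕜 = -∫ t in τ..T, ⟪g t, β (W.1.1 (Fin.last m) (t - τ))⟫_𝕜 := fun τ hτ W => by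
    rw [hη, inner_neg_left, hΛ]
    exact congrArg Neg.neg (inner_shiftLp hgi (hβc W) hτ)
  have h0 : η 0 = η₀ := ext_inner_of_denseRange hdense fun W => by
    rw [key 0 (left_mem_Icc.2 hT)]
    simp only [sub_zero]
    rw [hg', neg_neg]
  refine ⟨g, hgm, η, (hΛc.comp (continuous_shiftLp _)).neg, h0,
    ext_inner_of_denseRange hdense fun W => ?_, fun p q hpq τ hτ => ?_, fun j x τ hτ => ?_⟩
  · rw [key T (right_mem_Icc.2 hT), intervalIntegral.integral_same, neg_zero, inner_zero_left]
  -- A solution on `[0, T]` is the restriction of a global one, by uniqueness; translated by `τ`,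
  -- the global solution carries the values at `τ` to time `0`. Subtracting the identity at `τ` from
  -- the one at `0` leaves the integral over `(0, τ)`.
  · obtain ⟨P, Q, h, hP, hQ⟩ := hex (fun j => p j 0) (fun j => q j 0)
    have heq := (h.mono (subset_univ (Icc 0 T))).eq_of_initial hS hinj hpq hP hQ
    have hi := intervalIntegrable_inner (𝕜 := 𝕜) hT hgm (hβc ⟨(P, Q), h⟩)
    have h1 := key τ hτ ⟨(_, _), h.comp_add_const τ (t := univ) fun _ _ => mem_univ _⟩
    have h2 := hg' ⟨(P, Q), h⟩
    rw [hΦ] at h1 h2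
    simp only [zero_add, sub_add_cancel] at h1
    have h3 : ∀ t ∈ Icc 0 T, ((fun j => P j t, fun j => Q j t) :
        (Fin (m + 1) → H) × (Fin (m + 1) → H)) = (fun j => p j t, fun j => q j t) := fun t ht =>
      Prod.ext (funext fun j => (heq j t ht).1) (funext fun j => (heq j t ht).2)
    rw [h3 τ hτ] at h1
    rw [h3 0 (left_mem_Icc.2 hT)] at h2
    have h4 : ∫ t in (0 : ℝ)..τ, ⟪g t, β (p (Fin.last m) t)⟫_𝕜 =
        ∫ t in (0 : ℝ)..τ, ⟪g t, β (P (Fin.last m) t)⟫_𝕜 :=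
      intervalIntegral.integral_congr fun t ht => by
        rw [uIcc_of_le hτ.1] at ht
        rw [(heq (Fin.last m) t ⟨ht.1, ht.2.trans hτ.2⟩).1]
    have h5 := intervalIntegral.integral_add_adjacent_intervals
      (hi.mono_set (by rw [uIcc_of_le hτ.1, uIcc_of_le hT]; exact Icc_subset_Icc_right hτ.2))
      (hi.mono_set (by rw [uIcc_of_le hτ.2, uIcc_of_le hT]; exact Icc_subset_Icc_left hτ.1))
    rw [h4, h1, ← sub_eq_of_eq_add h5.symm, h2]
    ring
  -- The test data `(0, S x)` are those of the primitive of the solution with data `(x, 0)`. Its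
  -- first components vanish at time `0`, which is the condition on `k` for differentiating the
  -- correlation, and its derivative brings back the data `(x, 0)`.
  · obtain ⟨P, Q, h, hP, hQ⟩ := hex (Pi.single j x) 0
    have hz : ∀ i, primitive S C Q i 0 = 0 := fun i => by
      induction i using Fin.induction with
      | zero => rw [primitive_zero, hQ]; simp
      | succ i ih => rw [primitive_succ, hQ, ih]; simp
    let _ : NormedSpace ℝ G := NormedSpace.restrictScalars ℝ 𝕜 G
    have : IsScalarTower ℝ 𝕜 G := IsScalarTower.of_algebraMap_smul fun _ _ => rfl
    have hd := hasDerivWithinAt_integral_shift (𝕜 := 𝕜) hgm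
      (k := fun t => β (primitive S C Q (Fin.last m) t)) (k' := fun t => β (P (Fin.last m) t))
      (fun t => hasDerivWithinAt_univ.1
        (HasDerivWithinAt.clm_comp β (h.hasDerivWithinAt_primitive (Fin.last m) t (mem_univ t))))
      (hβc ⟨(P, Q), h⟩) (by simp only [hz, map_zero]) hτ
    have e1 : Φ ⟨(primitive S C Q, fun j t => S (P j t)), h.primitive⟩ = weakState S m s (0, Pi.single j (S x)) := by
      rw [hΦ]
      congr 2
      · exact funext hz
      · funext i
        rw [hP]
        by_cases hij : i = j
        · subst hij; simp
        · simp [Pi.single_eq_of_ne hij]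
    have e2 : Φ ⟨(P, Q), h⟩ = weakState S m s (Pi.single j x, 0) := by
      rw [hΦ]
      congr 2
      · exact funext hP
      · exact funext hQ
    rw [← e1, ← e2]
    refine (hd.neg.congr (fun σ hσ => key σ hσ _) (key τ hτ _)).congr_deriv ?_
    rw [key τ hτ]

end Control

/-! ### Identification of the state space with `H^{2n}`, and duality. -/

namespace CoerciveOperator

variable {𝕜 : Type} {H : Type*} [RCLike 𝕜] [NormedAddCommGroup H] [InnerProductSpace 𝕜 H]
  [CompleteSpace H] (A : CoerciveOperator 𝕜 H)

theorem eq_zero_of_inner_pow (k : ℕ) (x : H) (h : ∀ y, ⟪x, (A.invSqrt ^ k) y⟫_𝕜 = 0) : x = 0 := by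
  have h1 : (A.invSqrt ^ k) x = 0 :=
    inner_self_eq_zero (𝕜 := 𝕜).1 ((inner_pow_apply A.isSymmetric_invSqrt k x _).symm.trans (h _))
  exact A.invSqrt_pow_injective k (h1.trans (map_zero _).symm)

/-- The identification of `H` with `H_{k-1}`. -/
noncomputable def ofH : (k : ℕ) → H → A.SobPred k
  | 0, x => (show StrongDual 𝕜 (A.Sob 1) from
      innerSL 𝕜 x ∘L ((A.halfPowIso 1).toContinuousLinearEquiv : A.Sob 1 →L[𝕜] H))
  | k + 1, x => (show A.Sob k from (A.halfPow k).symm x)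

/-- A single formula for the dual space `H_{-1}` and for the spaces `H_{k-1}` with `k ≥ 1`, which
removes the case distinction from the duality argument. At `k = 0` the identification is conjugate
linear, so `ofH` is handled only as a continuous surjective map. -/
theorem pair_ofH (k : ℕ) (x : H) (φ : A.Sob 1) :
    A.pair k (A.ofH k x) φ = ⟪x, (A.invSqrt ^ k) (A.halfPow 1 φ)⟫_𝕜 := by
  cases k with
  | zero => rfl
  | succ k =>
    change ⟪A.emb k ((A.halfPow k).symm x), A.emb 1 φ⟫_𝕜 = _
    rw [emb_eq, LinearEquiv.apply_symm_apply, emb_one, pow_succ_apply,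
      inner_pow_apply A.isSymmetric_invSqrt]

theorem continuous_ofH (k : ℕ) : Continuous (A.ofH k) := by
  cases k with
  | zero => exact (((innerSL 𝕜).continuous).clm_comp continuous_const :
      Continuous fun x : H => innerSL 𝕜 x ∘L
        ((A.halfPowIso 1).toContinuousLinearEquiv : A.Sob 1 →L[𝕜] H))
  | succ k => exact A.continuous_halfPow_symm k

theorem ofH_zero (k : ℕ) : A.ofH k 0 = 0 := by
  cases k with
  | zero => exact (by simp : innerSL 𝕜 (0 : H) ∘L
      ((A.halfPowIso 1).toContinuousLinearEquiv : A.Sob 1 →L[𝕜] H) = 0)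
  | succ k => exact map_zero (A.halfPow k).symm

theorem ofH_surjective (k : ℕ) : Function.Surjective (A.ofH k) := by
  cases k with
  | zero =>
    intro z
    let z₁ : StrongDual 𝕜 H := (show StrongDual 𝕜 (A.Sob 1) from z) ∘L
      ((A.halfPowIso 1).symm.toContinuousLinearEquiv : H →L[𝕜] A.Sob 1)
    refine ⟨(InnerProductSpace.toDual 𝕜 H).symm z₁, ?_⟩
    refine ContinuousLinearMap.ext (M₁ := A.Sob 1) (M₂ := 𝕜) fun φ => ?_
    change ⟪(InnerProductSpace.toDual 𝕜 H).symm z₁, A.halfPowIso 1 φ⟫_𝕜 = _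
    rw [InnerProductSpace.toDual_symm_apply]
    exact congrArg (show StrongDual 𝕜 (A.Sob 1) from z) ((A.halfPowIso 1).symm_apply_apply φ)
  | succ k => exact (A.halfPow k).symm.surjective

end CoerciveOperator

section Duality

variable {𝕜 : Type} {H G : Type*} [RCLike 𝕜] [NormedAddCommGroup H] [InnerProductSpace 𝕜 H]
  [CompleteSpace H] {A : CoerciveOperator 𝕜 H} {m s : ℕ}

/-- The vector of `H^{2n}` that represents the state `(y, y')`. -/
theorem exists_state (y : (j : Fin (m + 1)) → A.Sob (m - j + s))
    (y' : (j : Fin (m + 1)) → A.SobPred (m - j + s)) :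
    ∃ η : PiLp 2 (fun _ : Fin (m + 1) ⊕ Fin (m + 1) => H),
      ∀ j, y j = -(A.halfPow _).symm (η (Sum.inr j)) ∧ y' j = A.ofH _ (η (Sum.inl j)) := by
  choose x hx using fun j => A.ofH_surjective _ (y' j)
  refine ⟨WithLp.toLp 2 (Sum.elim x fun j => -A.halfPow _ (y j)), fun j => ⟨?_, (hx j).symm⟩⟩
  change y j = -(A.halfPow _).symm (-A.halfPow _ (y j))
  rw [map_neg, LinearEquiv.symm_apply_apply, neg_neg]

/-- The duality bracket of the transposition identity is a scalar product in `H^{2n}`: the powers of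
`S` that define the norms of the state move onto the test data. The sign in front of `⟨y, w'⟩` is
absorbed in the representation of `y`. -/
theorem sum_pair_eq_inner_weakState {y : (j : Fin (m + 1)) → A.Sob (m - j + s)}
    {y' : (j : Fin (m + 1)) → A.SobPred (m - j + s)}
    {η : PiLp 2 (fun _ : Fin (m + 1) ⊕ Fin (m + 1) => H)}
    (h : ∀ j, y j = -(A.halfPow _).symm (η (Sum.inr j)) ∧ y' j = A.ofH _ (η (Sum.inl j)))
    (w : Fin (m + 1) → A.Sob 2) (w' : Fin (m + 1) → A.Sob 1) :
    ∑ j, (A.pair _ (y' j) (A.incl one_le_two (w j)) - ⟪A.emb _ (y j), A.emb 1 (w' j)⟫_𝕜) =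
      ⟪η, weakState A.invSqrt m s (fun j => A.halfPow 2 (w j), fun j => A.halfPow 1 (w' j))⟫_𝕜 := by
  rw [inner_weakState]
  refine Finset.sum_congr rfl fun j _ => ?_
  rw [(h j).1, (h j).2, A.pair_ofH, A.halfPow_incl_one_two, map_neg, inner_neg_left, sub_neg_eq_add,
    A.emb_eq, LinearEquiv.apply_symm_apply, A.emb_one, pow_succ_apply, pow_succ_apply,
    inner_pow_apply A.isSymmetric_invSqrt _ (η (Sum.inr j))]

variable [NormedSpace ℝ H] [IsScalarTower ℝ 𝕜 H] [NormedAddCommGroup G] [InnerProductSpace 𝕜 G]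
  {C : Fin m → H →L[𝕜] H} {T : ℝ}

/-- Test solutions can be prescribed at time `T`, by translating global solutions by `-T`. A state
at `T` that is annihilated by all of them is zero, so every transposition solution for such a
control is steered to zero. -/
theorem IsTranspositionSolution.eq_zero_of_inner
    (hex : ∀ x y : Fin (m + 1) → H, ∃ p q : Fin (m + 1) → ℝ → H, IsCascade A.invSqrt C univ p q ∧
      (∀ j, p j 0 = x j) ∧ ∀ j, q j 0 = y j)
    {Bstar : A.Sob 2 →L[𝕜] G} (hT : 0 ≤ T) {v : ℝ → G}
    {y0 : (j : Fin (m + 1)) → A.Sob (m - j + s)} {y1 : (j : Fin (m + 1)) → A.SobPred (m - j + s)}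
    {y : (j : Fin (m + 1)) → ℝ → A.Sob (m - j + s)}
    {y' : (j : Fin (m + 1)) → ℝ → A.SobPred (m - j + s)}
    (h : IsTranspositionSolution A C Bstar s T v y0 y1 y y')
    (hv : ∀ w w', IsCascadeSolution A C T w w' →
      ∫ t in (0 : ℝ)..T, ⟪v t, Bstar (w (Fin.last m) t)⟫_𝕜 =
        -∑ j, (A.pair _ (y1 j) (A.incl one_le_two (w j 0)) - ⟪A.emb _ (y0 j), A.emb 1 (w' j 0)⟫_𝕜))
    (j : Fin (m + 1)) : y j T = 0 ∧ y' j T = 0 := by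
  obtain ⟨η, hη⟩ := exists_state (fun j => y j T) (fun j => y' j T)
  have h0 : η = 0 := by
    refine eq_zero_of_inner_weakState A.isSymmetric_invSqrt A.invSqrt_injective s η fun d => ?_
    obtain ⟨p, q, hpq, hp, hq⟩ := hex d.1 d.2
    have hW := (hpq.comp_add_const (-T) (t := Icc 0 T) fun _ _ => mem_univ _).isCascadeSolution
    have h1 := h.transposition _ _ hW T (right_mem_Icc.2 hT)
    rw [hv _ _ hW, sum_pair_eq_inner_weakState hη] at h1
    simp only [LinearEquiv.apply_symm_apply, add_neg_cancel, hp, hq] at h1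
    have h2 := sub_eq_neg_self.1 h1.symm
    exact h2
  have := hη j
  rw [h0] at this
  exact ⟨this.1.trans (by simp), this.2.trans (A.ofH_zero _)⟩

/-- Null controllability by duality, from the admissibility and the observability of the last
component of the cascade. -/
theorem isNullControllable_of_observable [CompleteSpace G]
    (hex : ∀ x y : Fin (m + 1) → H, ∃ p q : Fin (m + 1) → ℝ → H, IsCascade A.invSqrt C univ p q ∧
      (∀ j, p j 0 = x j) ∧ ∀ j, q j 0 = y j)
    (Bstar : A.Sob 2 →L[𝕜] G) (s : ℕ) {c : ℝ} (hT : 0 ≤ T) (hc : 0 ≤ c)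
    (hadm : ∀ p q, IsCascade A.invSqrt C univ p q →
      ∫ t in (0 : ℝ)..T, ‖Bstar ((A.halfPow 2).symm (p (Fin.last m) t))‖ ^ 2 ≤
        c * ‖weakState A.invSqrt m s (fun j => p j 0, fun j => q j 0)‖ ^ 2)
    (hobs : ∀ p q, IsCascade A.invSqrt C univ p q →
      ‖weakState A.invSqrt m s (fun j => p j 0, fun j => q j 0)‖ ^ 2 ≤
        c * ∫ t in (0 : ℝ)..T, ‖Bstar ((A.halfPow 2).symm (p (Fin.last m) t))‖ ^ 2) :
    IsNullControllable A C Bstar s T := by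
  intro y0 y1
  have hS := A.isSymmetric_invSqrt
  obtain ⟨η₀, hη₀⟩ := exists_state y0 y1
  obtain ⟨v, hv, η, hηc, h0, hηT, htr, hd⟩ := exists_transposition_control hS A.invSqrt_injective hex
    (Bstar ∘L ((A.halfPowIso 2).symm.toContinuousLinearEquiv : H →L[𝕜] A.Sob 2)) s hT hc hadm hobs η₀
  have hβ : ∀ x, (Bstar ∘L ((A.halfPowIso 2).symm.toContinuousLinearEquiv : H →L[𝕜] A.Sob 2)) x =
    Bstar ((A.halfPow 2).symm x) := fun _ => rfl
  have htr' : ∀ w w', IsCascadeSolution A C T w w' → ∀ τ ∈ Icc 0 T,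
      ∫ t in (0 : ℝ)..τ, ⟪v t, Bstar (w (Fin.last m) t)⟫_𝕜 =
        ⟪η τ, weakState A.invSqrt m s
          (fun j => A.halfPow 2 (w j τ), fun j => A.halfPow 1 (w' j τ))⟫_𝕜 -
        ∑ j, (A.pair _ (y1 j) (A.incl one_le_two (w j 0)) -
          ⟪A.emb _ (y0 j), A.emb 1 (w' j 0)⟫_𝕜) := by
    intro w w' hw τ hτ
    have h1 := htr _ _ hw.isCascade τ hτ
    simp only [hβ, LinearEquiv.symm_apply_apply] at h1
    rw [h1, sum_pair_eq_inner_weakState hη₀]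
  have hcomp : ∀ i, Continuous fun τ => η τ i := fun i => (PiLp.continuous_apply 2 _ i).comp hηc
  refine ⟨v, hv, ⟨fun j τ => -(A.halfPow _).symm (η τ (Sum.inr j)),
    fun j τ => A.ofH _ (η τ (Sum.inl j)), ⟨fun j => ?_, fun j => ?_, fun j => ?_, fun j => ?_,
    fun j φ t ht => ?_, fun w w' hw τ hτ => ?_⟩⟩, fun y y' h j => ?_⟩
  · exact ((A.continuous_halfPow_symm _).comp (hcomp _)).neg.continuousOn
  · exact ((A.continuous_ofH _).comp (hcomp _)).continuousOn
  · rw [h0]; exact (hη₀ j).1.symm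
  · rw [h0]; exact (hη₀ j).2.symm
  · set k := m - (j : ℕ) + s
    -- The weak derivative tests only against vectors `S x`. These separate points, and the
    -- candidate derivative is continuous, so the derivative exists in `H` and can be tested against
    -- an arbitrary `φ ∈ H_1`. The conjugations exchange the two arguments of the scalar product.
    have hstrong : ∀ t ∈ Icc 0 T, HasDerivWithinAt
        (fun τ => (A.invSqrt ^ (k + 1)) (η τ (Sum.inr j))) (-(A.invSqrt ^ k) (η t (Sum.inl j)))
        (Icc 0 T) t := by
      refine hasDerivWithinAt_of_functionals (fun x => innerSL 𝕜 (A.invSqrt x)) (fun x hx => ?_)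
        ((A.invSqrt ^ k).continuous.comp (hcomp _)).neg.continuousOn fun x τ hτ => ?_
      · refine A.eq_zero_of_inner_pow 1 x fun y => ?_
        rw [pow_one, ← inner_conj_symm]
        exact (congrArg _ (hx y)).trans (map_zero _)
      · have h1 := (hd j x τ hτ).star
        simp only [inner_weakState_single_left, inner_weakState_single_right] at h1
        simp only [innerSL_apply_apply]
        have e1 : ∀ σ, ⟪A.invSqrt x, (A.invSqrt ^ (k + 1)) (η σ (Sum.inr j))⟫_𝕜 =
            star ⟪η σ (Sum.inr j), (A.invSqrt ^ (k + 1)) (A.invSqrt x)⟫_𝕜 := fun σ => by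
          rw [inner_pow_apply hS]
          exact (inner_conj_symm _ _).symm
        have e2 : ⟪A.invSqrt x, -(A.invSqrt ^ k) (η τ (Sum.inl j))⟫_𝕜 =
            star (-⟪η τ (Sum.inl j), (A.invSqrt ^ (k + 1)) x⟫_𝕜) := by
          rw [inner_neg_right, inner_pow_apply hS, star_neg, pow_succ_apply]
          exact congrArg _ (inner_conj_symm _ _).symm
        simp only [e1, e2]
        exact h1
    have h1 := (HasDerivWithinAt.clm_comp (innerSL 𝕜 (A.halfPow 1 φ)) (hstrong t ht)).neg.star
    simp only [innerSL_apply_apply, inner_neg_right, neg_neg] at h1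
    have e1 : ∀ τ, ⟪A.emb k (-(A.halfPow k).symm (η τ (Sum.inr j))), A.emb 1 φ⟫_𝕜 =
        star (-⟪A.halfPow 1 φ, (A.invSqrt ^ (k + 1)) (η τ (Sum.inr j))⟫_𝕜) := fun τ => by
      rw [map_neg, inner_neg_left, star_neg, A.emb_eq, LinearEquiv.apply_symm_apply, A.emb_one,
        pow_succ_apply_left, ← inner_conj_symm]
      exact congrArg (fun z => -star z) (hS _ _)
    simp only [e1]
    refine h1.congr_deriv ?_
    rw [A.pair_ofH, inner_pow_apply hS]
    exact inner_conj_symm _ _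
  · rw [htr' w w' hw τ hτ, sum_pair_eq_inner_weakState (η := η τ) fun j => ⟨rfl, rfl⟩]
  · refine h.eq_zero_of_inner hex hT (fun w w' hw => ?_) j
    rw [htr' w w' hw T (right_mem_Icc.2 hT), hηT, inner_zero_left, zero_sub]

end Duality

/-! ### Forward estimates of the cascade in weak norms. -/

section Growth

variable {𝕜 H : Type*} [RCLike 𝕜] [NormedAddCommGroup H] [InnerProductSpace 𝕜 H]
  {S : H →L[𝕜] H} {m : ℕ} {C : Fin m → H →L[𝕜] H}

theorem levelEnergy_le_norm_weakState_sq (s : ℕ) (d : (Fin (m + 1) → H) × (Fin (m + 1) → H))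
    (j : Fin (m + 1)) :
    levelEnergy S (m - (j : ℕ) + s) (d.1 j) (d.2 j) ≤ ‖weakState S m s d‖ ^ 2 := by
  rw [norm_weakState_sq]
  exact Finset.single_le_sum
    (f := fun j : Fin (m + 1) => levelEnergy S (m - (j : ℕ) + s) (d.1 j) (d.2 j))
    (fun i _ => levelEnergy_nonneg S _ _ _) (Finset.mem_univ j)

/-- Grönwall for one component after the other. At its level `m - j - 1 + s`, the source of the
component `j + 1` contains `S² p_j`, and is thus bounded by the energy of the component `j` at level
`m - j + s`. The boundedness of `C j` is available up to the order `m - j`, which is where `s ≤ 1`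
is needed. -/
theorem IsCascade.exists_levelEnergy_le_initial [NormedSpace ℝ H] [IsScalarTower ℝ 𝕜 H]
    (hS : (S : H →ₗ[𝕜] H).IsSymmetric) {c : ℝ} (hc : CouplingBound S C c) {s : ℕ} (hs : s ≤ 1)
    {T : ℝ} (hT : 0 ≤ T) (j : Fin (m + 1)) :
    ∃ K : ℝ, 0 ≤ K ∧ ∀ p q, IsCascade S C (Icc 0 T) p q → ∀ t ∈ Icc 0 T,
      levelEnergy S (m - (j : ℕ) + s) (p j t) (q j t) ≤
        K * ‖weakState S m s (fun j => p j 0, fun j => q j 0)‖ ^ 2 := by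
  have h0 := left_mem_Icc.2 hT
  induction j using Fin.induction with
  | zero =>
    refine ⟨1, zero_le_one, fun p q h t ht => ?_⟩
    rw [one_mul]
    refine le_trans ?_ (levelEnergy_le_norm_weakState_sq s (fun j => p j 0, fun j => q j 0) 0)
    have h1 := le_exp_mul_of_abs_deriv_le (h := fun _ => 0) le_rfl
      (fun t ht => h.first.hasDerivWithinAt_energy hS (m - ((0 : Fin (m + 1)) : ℕ) + s) ht)
      (fun t _ => by positivity) continuousOn_const (fun _ _ => le_rfl) (fun t _ => by simp) h0 ht
    simpa [levelEnergy] using h1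
  | succ j ih =>
    obtain ⟨K, hK, ih⟩ := ih
    refine ⟨Real.exp (1 * (T - 0)) * (1 + T * (c ^ 2 * K)), by positivity, fun p q h t ht => ?_⟩
    have hj := levelEnergy_le_norm_weakState_sq (S := S) s (fun j => p j 0, fun j => q j 0) j.succ
    set N := ‖weakState S m s (fun j => p j 0, fun j => q j 0)‖ ^ 2 with hN
    have hN0 : 0 ≤ N := by positivity
    have h1 := le_exp_mul_of_abs_deriv_le (h := fun _ => c ^ 2 * (K * N)) zero_le_one
      (fun t ht => (h.next j).hasDerivWithinAt_energy hS (m - (j.succ : ℕ) + s) ht)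
      (fun t _ => by positivity) continuousOn_const (fun _ _ => by positivity) (fun t ht => ?_) h0 ht
    · refine h1.trans ?_
      rw [intervalIntegral.integral_const, smul_eq_mul, sub_zero, mul_assoc]
      refine mul_le_mul_of_nonneg_left ?_ (Real.exp_pos _).le
      rw [add_mul, one_mul]
      exact add_le_add hj (le_of_eq (by ring))
    · have h2 : ‖(S ^ (m - (j.succ : ℕ) + s)) (-C j (S (S (p j.castSucc t))))‖ ^ 2 ≤
          c ^ 2 * (K * N) := by
        rw [map_neg, norm_neg]
        have h3 := hc.2 j (m - (j.succ : ℕ) + s) (by rw [Fin.val_succ]; omega)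
          (S (S (p j.castSucc t)))
        rw [← pow_succ_apply, ← pow_succ_apply] at h3
        have e : m - (j.succ : ℕ) + s + 1 + 1 = m - (j.castSucc : ℕ) + s + 1 := by
          rw [Fin.val_succ, Fin.val_castSucc]; omega
        rw [e] at h3
        have h4 : ‖(S ^ (m - (j.castSucc : ℕ) + s + 1)) (p j.castSucc t)‖ ^ 2 ≤ K * N :=
          le_trans (le_add_of_nonneg_right (by positivity)) (ih p q h t ht)
        refine (pow_le_pow_left₀ (norm_nonneg _) h3 2).trans ?_
        rw [mul_pow]
        exact mul_le_mul_of_nonneg_left h4 (by positivity)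
      set u := (S ^ (m - (j.succ : ℕ) + s + 1)) (q j.succ t)
      set w := (S ^ (m - (j.succ : ℕ) + s)) (-C j (S (S (p j.castSucc t))))
      have h5 : |RCLike.re ⟪u, w⟫_𝕜| ≤ ‖u‖ * ‖w‖ :=
        (RCLike.abs_re_le_norm _).trans (norm_inner_le_norm _ _)
      rw [abs_mul, abs_two]
      nlinarith [sq_nonneg (‖u‖ - ‖w‖),
        sq_nonneg ‖(S ^ (m - (j.succ : ℕ) + s + 1)) (p j.succ t)‖]

/-- The source of the last equation of the cascade is controlled by the initial data. -/
theorem IsCascade.exists_source_le_initial [NormedSpace ℝ H] [IsScalarTower ℝ 𝕜 H]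
    (hS : (S : H →ₗ[𝕜] H).IsSymmetric) {c : ℝ} (hc : CouplingBound S C c) {T : ℝ} (hT : 0 ≤ T)
    (j : Fin (m + 1)) :
    ∃ K : ℝ, 0 ≤ K ∧ ∀ p q, IsCascade S C (Icc 0 T) p q → ∃ f,
      IsWave S (Icc 0 T) (p j) (q j) f ∧ ∀ t ∈ Icc 0 T, ‖(S ^ (m - (j : ℕ))) (f t)‖ ^ 2 ≤
        K * ‖weakState S m 0 (fun j => p j 0, fun j => q j 0)‖ ^ 2 := by
  cases j using Fin.cases with
  | zero => exact ⟨0, le_rfl, fun p q h => ⟨_, h.first, fun t _ => by simp⟩⟩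
  | succ j =>
    obtain ⟨K, hK, h1⟩ := IsCascade.exists_levelEnergy_le_initial hS hc zero_le_one hT j.castSucc
    refine ⟨c ^ 2 * K, by positivity, fun p q h => ⟨_, h.next j, fun t ht => ?_⟩⟩
    have h2 := hc.2 j (m - (j.succ : ℕ)) (by rw [Fin.val_succ]; omega) (S (S (p j.castSucc t)))
    rw [← pow_succ_apply, ← pow_succ_apply] at h2
    have e : m - (j.succ : ℕ) + 1 + 1 = m - (j.castSucc : ℕ) + 0 + 1 := by
      rw [Fin.val_succ, Fin.val_castSucc]; omega
    rw [e] at h2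
    rw [map_neg, norm_neg]
    refine (pow_le_pow_left₀ (norm_nonneg _) h2 2).trans ?_
    rw [mul_pow, mul_assoc]
    refine mul_le_mul_of_nonneg_left ?_ (by positivity)
    exact le_trans (le_add_of_nonneg_right (by positivity)) (h1 p q h t ht)

end Growth

/-! ### From the hypotheses on `A` to the abstract estimates. -/

section Hypotheses

variable {𝕜 : Type} {H G : Type*} [RCLike 𝕜] [NormedAddCommGroup H] [InnerProductSpace 𝕜 H]
  [CompleteSpace H] {A : CoerciveOperator 𝕜 H} {m : ℕ}

/-- Duality: boundedness of `L^*` on `H_k` is boundedness of `L` for the norm of `H_{-k}`. With `y =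
S^k L x` one has `|y|² = ⟨S^k x, A^{k/2} L^* A^{-k/2} y⟩`. -/
theorem CoerciveOperator.exists_norm_pow_le (A : CoerciveOperator 𝕜 H) {L : H →L[𝕜] H} {k : ℕ}
    (h : A.BoundedOn (ContinuousLinearMap.adjoint L) k) :
    ∃ c : ℝ, 0 ≤ c ∧ ∀ x, ‖(A.invSqrt ^ k) (L x)‖ ≤ c * ‖(A.invSqrt ^ k) x‖ := by
  obtain ⟨L', hL'⟩ := h
  refine ⟨‖L'‖, norm_nonneg _, fun x => ?_⟩
  have hS := A.isSymmetric_invSqrt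
  set y := (A.invSqrt ^ k) (L x) with hy
  have h1 : ⟪y, y⟫_𝕜 = ⟪(A.invSqrt ^ k) x, A.halfPow k (L' ((A.halfPow k).symm y))⟫_𝕜 := by
    rw [← inner_pow_apply hS k x, ← A.emb_eq, hL', A.emb_eq, LinearEquiv.apply_symm_apply,
      ContinuousLinearMap.adjoint_inner_right, inner_pow_apply hS k (L x)]
  have h2 : ‖y‖ ^ 2 ≤ ‖L'‖ * ‖(A.invSqrt ^ k) x‖ * ‖y‖ := by
    have h3 : ‖⟪y, y⟫_𝕜‖ = ‖y‖ ^ 2 := by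
      rw [inner_self_eq_norm_sq_to_K, norm_pow, RCLike.norm_ofReal, abs_norm]
    rw [← h3, h1]
    refine (norm_inner_le_norm _ _).trans ?_
    have h4 : ‖A.halfPow k (L' ((A.halfPow k).symm y))‖ ≤ ‖L'‖ * ‖y‖ := by
      have := L'.le_opNorm ((A.halfPow k).symm y)
      rwa [A.norm_eq, A.norm_eq, LinearEquiv.apply_symm_apply] at this
    calc _ ≤ ‖(A.invSqrt ^ k) x‖ * (‖L'‖ * ‖y‖) := mul_le_mul_of_nonneg_left h4 (norm_nonneg _)
      _ = _ := by ring
  rcases (norm_nonneg y).eq_or_lt with h0 | h0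
  · rw [← h0]; positivity
  · rw [pow_two] at h2
    exact le_of_mul_le_mul_right h2 h0

theorem CouplingAssumption.exists_couplingBound {C P : Fin m → H →L[𝕜] H}
    (h : CouplingAssumption A C P) : ∃ c, CouplingBound A.invSqrt C c := by
  have h1 : ∀ (j : Fin m) (k : Fin (m + 1)), ∃ c : ℝ, 0 ≤ c ∧ ((k : ℕ) ≤ m - (j : ℕ) →
      ∀ x, ‖(A.invSqrt ^ (k : ℕ)) (C j x)‖ ≤ c * ‖(A.invSqrt ^ (k : ℕ)) x‖) := fun j k => by
    by_cases hk : (k : ℕ) ≤ m - (j : ℕ)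
    · obtain ⟨c, hc, h2⟩ := A.exists_norm_pow_le ((h j).1 k hk)
      exact ⟨c, hc, fun _ => h2⟩
    · exact ⟨0, le_rfl, fun h => absurd h hk⟩
  choose c hc h2 using h1
  refine ⟨∑ j, ∑ k, c j k, Finset.sum_nonneg fun j _ => Finset.sum_nonneg fun k _ => hc j k,
    fun j k hk x => ?_⟩
  refine (h2 j ⟨k, by omega⟩ hk x).trans (mul_le_mul_of_nonneg_right ?_ (norm_nonneg _))
  refine (Finset.single_le_sum (f := fun k => c j k) (fun k _ => hc j k) (Finset.mem_univ _)).trans ?_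
  exact Finset.single_le_sum (f := fun j => ∑ k, c j k)
    (fun j _ => Finset.sum_nonneg fun k _ => hc j k) (Finset.mem_univ j)

variable [NormedAddCommGroup G] [InnerProductSpace 𝕜 G]

/-- The observation `𝓑` as a function of `(A w, w')`. -/
noncomputable def CoerciveOperator.liftObs (A : CoerciveOperator 𝕜 H)
    (𝓑 : A.Sob 2 × H →L[𝕜] G) : H × H →L[𝕜] G :=
  𝓑 ∘L ((A.halfPowIso 2).symm.toContinuousLinearEquiv : H →L[𝕜] A.Sob 2).prodMap
    (ContinuousLinearMap.id 𝕜 H)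

theorem CoerciveOperator.liftObs_apply (𝓑 : A.Sob 2 × H →L[𝕜] G) (x y : H) :
    A.liftObs 𝓑 (x, y) = 𝓑 ((A.halfPow 2).symm x, y) := rfl

theorem CoerciveOperator.energy_zero_symm (A : CoerciveOperator 𝕜 H) (p q : ℝ → H) (t : ℝ) :
    A.energy 0 ((A.halfPow 2).symm (p t)) ((A.halfPow 1).symm (q t)) =
      waveEnergy A.invSqrt p q t := by
  simp only [A.energy_eq, LinearEquiv.apply_symm_apply, zero_add, pow_one, waveEnergy]

variable [NormedSpace ℝ H] [IsScalarTower ℝ 𝕜 H]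

theorem CoerciveOperator.exists_isCascade (A : CoerciveOperator 𝕜 H) (C : Fin m → H →L[𝕜] H)
    (x y : Fin (m + 1) → H) : ∃ p q : Fin (m + 1) → ℝ → H, IsCascade A.invSqrt C univ p q ∧
      (∀ j, p j 0 = x j) ∧ ∀ j, q j 0 = y j :=
  let ⟨_, b, _, hμ, hb⟩ := A.exists_eigenbasis_invSqrt
  exists_cascade b A.isSymmetric_invSqrt hμ hb C x y

theorem IsAdmissible.waveAdmissible {𝓑 : A.Sob 2 × H →L[𝕜] G} (h : IsAdmissible A 𝓑) :
    WaveAdmissible A.invSqrt (A.liftObs 𝓑) := by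
  intro T hT
  obtain ⟨D, hD, h⟩ := h T hT
  refine ⟨D, hD, fun p q f hw => ?_⟩
  simpa only [A.energy_zero_symm, A.emb_one, LinearEquiv.apply_symm_apply,
    A.liftObs_apply] using h _ _ _ hw.isStrongSolution

theorem IsObservable.waveObservable {𝓑 : A.Sob 2 × H →L[𝕜] G} (h : IsObservable A 𝓑) :
    WaveObservable A.invSqrt (A.liftObs 𝓑) := by
  obtain ⟨T₀, hT₀, h⟩ := h
  refine ⟨T₀, hT₀, fun T hT => ?_⟩
  obtain ⟨R, hR, h⟩ := h T hT
  refine ⟨R, hR, fun p q hw => ?_⟩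
  simpa only [A.energy_zero_symm, A.emb_one, LinearEquiv.apply_symm_apply,
    A.liftObs_apply] using h _ _ hw.isStrongSolution

theorem VelocityObservable.waveObservable {P : H →L[𝕜] H} (h : VelocityObservable A P) :
    WaveObservable A.invSqrt (P ∘L ContinuousLinearMap.snd 𝕜 H H) := by
  obtain ⟨T₀, hT₀, h⟩ := h
  refine ⟨T₀, hT₀, fun T hT => ?_⟩
  obtain ⟨R, hR, h⟩ := h T hT
  refine ⟨R, hR, fun p q hw => ?_⟩
  simpa only [A.energy_zero_symm, A.emb_one, LinearEquiv.apply_symm_apply,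
    ContinuousLinearMap.comp_apply, ContinuousLinearMap.coe_snd'] using h _ _ hw.isStrongSolution

theorem exists_isObservabilityTime {C P : Fin m → H →L[𝕜] H} (hC : CouplingAssumption A C P)
    (hP : ∀ j, VelocityObservable A (P j)) {𝓑 : A.Sob 2 × H →L[𝕜] G} (hadm : IsAdmissible A 𝓑)
    (hobs : IsObservable A 𝓑) : ∃ Tstar, IsObservabilityTime A C 𝓑 Tstar := by
  obtain ⟨c, hc⟩ := hC.exists_couplingBound
  -- A free wave is a cascade with no coupling, so its existence is the case of one equation.
  obtain ⟨T₁, hT₁, h⟩ := IsCascade.exists_levelEnergy_le A.isSymmetric_invSqrt (fun x y =>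
    let ⟨p, q, h, hp, hq⟩ := A.exists_isCascade (m := 0) Fin.elim0 (fun _ => x) (fun _ => y)
    ⟨p 0, q 0, h.first, hp 0, hq 0⟩) hc (fun j => (hP j).waveObservable) (fun j => (hC j).2.2)
    hadm.waveAdmissible hobs.waveObservable
  refine ⟨T₁, hT₁, fun T hT j => ?_⟩
  obtain ⟨d, hd, h⟩ := h T (le_of_lt hT)
  refine ⟨d, hd, fun w w' hw => ?_⟩
  have h1 := h _ _ hw.isCascade j
  simp only [A.liftObs_apply, LinearEquiv.symm_apply_apply, ← A.emb_one] at h1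
  refine le_trans ?_ h1
  rw [A.energy_eq, ← levelEnergy]
  exact half_le_self (levelEnergy_nonneg _ _ _ _)

theorem IsObservabilityTime.exists_levelEnergy_le {C : Fin m → H →L[𝕜] H}
    {𝓑 : A.Sob 2 × H →L[𝕜] G} {Tstar T : ℝ} (h : IsObservabilityTime A C 𝓑 Tstar)
    (hT : Tstar < T) : ∃ d : ℝ, 0 ≤ d ∧ ∀ p q, IsCascade A.invSqrt C univ p q → ∀ j : Fin (m + 1),
      levelEnergy A.invSqrt (m - (j : ℕ)) (p j 0) (q j 0) ≤ d * ∫ t in (0 : ℝ)..T,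
        ‖𝓑 ((A.halfPow 2).symm (p (Fin.last m) t), A.invSqrt (q (Fin.last m) t))‖ ^ 2 := by
  choose d hd h1 using h.2 T hT
  refine ⟨2 * ∑ j, d j, mul_nonneg zero_le_two (Finset.sum_nonneg fun j _ => (hd j).le),
    fun p q hpq j => ?_⟩
  have h2 := h1 j _ _ (hpq.mono (subset_univ (Icc 0 T))).isCascadeSolution
  simp only [A.energy_eq, LinearEquiv.apply_symm_apply, A.emb_one] at h2
  have hO : 0 ≤ ∫ t in (0 : ℝ)..T,
      ‖𝓑 ((A.halfPow 2).symm (p (Fin.last m) t), A.invSqrt (q (Fin.last m) t))‖ ^ 2 :=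
    intervalIntegral.integral_nonneg (h.1.trans hT).le fun _ _ => by positivity
  have h3 : d j ≤ ∑ j, d j :=
    Finset.single_le_sum (f := d) (fun j _ => (hd j).le) (Finset.mem_univ j)
  have h4 := mul_le_mul_of_nonneg_right h3 hO
  unfold levelEnergy
  linarith

end Hypotheses

/-! ### Null controllability in the two cases. -/

section Controllability

variable {𝕜 : Type} {H G : Type*} [RCLike 𝕜] [NormedAddCommGroup H] [InnerProductSpace 𝕜 H]
  [CompleteSpace H] [NormedSpace ℝ H] [IsScalarTower ℝ 𝕜 H] [NormedAddCommGroup G]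
  [InnerProductSpace 𝕜 G] [CompleteSpace G] {A : CoerciveOperator 𝕜 H} {m : ℕ}
  {C P : Fin m → H →L[𝕜] H} {Tstar T : ℝ}

/-- The control is dual to the observation `B^* w`, which is the velocity observation of the
primitive of the solution. The observability inequality applied to the primitive controls the data
one level lower, hence `s = 1`; at that level `B^* w` is bounded by the energy, because `B` is
bounded. -/
theorem isNullControllable_velocity (hC : CouplingAssumption A C P) (B : G →L[𝕜] H)
    (hobs : IsObservabilityTime A C (velocityObs A B) Tstar) (hT : Tstar < T) :
    IsNullControllable A C (ContinuousLinearMap.adjoint B ∘L A.emb 2) 1 T := by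
  have hT0 : 0 < T := hobs.1.trans hT
  obtain ⟨c, hc⟩ := hC.exists_couplingBound
  obtain ⟨K, hK, hgrow⟩ := IsCascade.exists_levelEnergy_le_initial A.isSymmetric_invSqrt hc le_rfl
    hT0.le (Fin.last m)
  obtain ⟨d, hd, hobs⟩ := hobs.exists_levelEnergy_le hT
  set L := ContinuousLinearMap.adjoint B
  have hβ : ∀ x, (L ∘L A.emb 2) ((A.halfPow 2).symm x) = L (A.invSqrt (A.invSqrt x)) := fun x => by
    rw [ContinuousLinearMap.comp_apply, A.emb_two, LinearEquiv.apply_symm_apply]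
  set κ : ℝ := 2 + 2 * (c * ‖A.invSqrt‖) ^ 2 with hκ
  have hκ0 : 0 ≤ κ := by positivity
  refine isNullControllable_of_observable (A.exists_isCascade C) _ 1
    (c := T * (‖L‖ ^ 2 * K) + ((m + 1 : ℕ) : ℝ) * (κ * (d + d) + d)) hT0.le (by positivity)
    (fun p q h => ?_) (fun p q h => ?_)
  · simp only [hβ]
    set N := ‖weakState A.invSqrt m 1 (fun j => p j 0, fun j => q j 0)‖ ^ 2
    have hN : 0 ≤ N := by positivity
    have h1 : ∀ t ∈ Icc 0 T, ‖L (A.invSqrt (A.invSqrt (p (Fin.last m) t)))‖ ^ 2 ≤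
        ‖L‖ ^ 2 * (K * N) := fun t ht => by
      have h2 := hgrow p q (h.mono (subset_univ _)) t ht
      rw [Fin.val_last, Nat.sub_self, zero_add] at h2
      refine (pow_le_pow_left₀ (norm_nonneg _) (L.le_opNorm _) 2).trans ?_
      rw [mul_pow]
      refine mul_le_mul_of_nonneg_left (le_trans ?_ h2) (by positivity)
      exact le_add_of_nonneg_right (by positivity)
    have h2 : ∫ t in (0 : ℝ)..T, ‖L (A.invSqrt (A.invSqrt (p (Fin.last m) t)))‖ ^ 2 ≤
        ∫ t in (0 : ℝ)..T, ‖L‖ ^ 2 * (K * N) := by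
      refine intervalIntegral.integral_mono_on hT0.le (Continuous.intervalIntegrable ?_ _ _)
        (continuous_const.intervalIntegrable _ _) h1
      have := h.continuous_fst (Fin.last m)
      fun_prop
    rw [intervalIntegral.integral_const, smul_eq_mul, sub_zero] at h2
    refine h2.trans ?_
    have h3 : 0 ≤ ((m + 1 : ℕ) : ℝ) * (κ * (d + d) + d) * N := by positivity
    linarith
  · simp only [hβ]
    set O := ∫ t in (0 : ℝ)..T, ‖L (A.invSqrt (A.invSqrt (p (Fin.last m) t)))‖ ^ 2
    have hO : 0 ≤ O := intervalIntegral.integral_nonneg hT0.le fun _ _ => by positivity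
    have h1 : ∀ j : Fin (m + 1), levelEnergy A.invSqrt (m - (j : ℕ)) (primitive A.invSqrt C q j 0)
        (A.invSqrt (p j 0)) ≤ d * O := hobs _ _ h.primitive
    -- Returning from the primitive to the solution costs one order and, through the coupling, the
    -- primitive of the previous component at exactly the level where it is already controlled.
    have h2 : ∀ j : Fin (m + 1), levelEnergy A.invSqrt (m - (j : ℕ) + 1) (p j 0) (q j 0) ≤
        (κ * (d + d) + d) * O := by
      intro j
      cases j using Fin.cases with
      | zero =>
        rw [levelEnergy_zero_le_primitive (C := C)]
        refine (h1 0).trans (mul_le_mul_of_nonneg_right ?_ hO)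
        exact le_add_of_nonneg_left (by positivity)
      | succ j =>
        have e : m - (j.succ : ℕ) + 1 = m - (j.castSucc : ℕ) := by
          rw [Fin.val_succ, Fin.val_castSucc]; omega
        refine (levelEnergy_succ_le_primitive hc q p j (r := m - (j.succ : ℕ))
          (by rw [Fin.val_succ]; omega) 0).trans ?_
        rw [← hκ]
        have h3 := h1 j.succ
        have h4 := h1 j.castSucc
        rw [← e] at h4
        have h5 := mul_le_mul_of_nonneg_left (add_le_add h3 h4) hκ0
        have h6 : 0 ≤ d * O := by positivity
        linarith
    rw [norm_weakState_sq]
    refine (Finset.sum_le_sum fun j _ => h2 j).trans ?_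
    rw [Finset.sum_const, Finset.card_univ, Fintype.card_fin, nsmul_eq_mul]
    have h3 : 0 ≤ T * (‖L‖ ^ 2 * K) * O := by positivity
    linarith

/-- The observation and the control are directly dual, so `s = 0` and the observability inequality
is used as it stands. The reverse bound combines the admissibility of the last equation with the
weak estimates of its energy and of its source, both of which reach the required order `0` at `j =
m`. -/
theorem isNullControllable_position (hC : CouplingAssumption A C P) (Bstar : A.Sob 2 →L[𝕜] G)
    (hadm : IsAdmissible A (positionObs A Bstar))
    (hobs : IsObservabilityTime A C (positionObs A Bstar) Tstar) (hT : Tstar < T) :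
    IsNullControllable A C Bstar 0 T := by
  have hT0 : 0 < T := hobs.1.trans hT
  obtain ⟨c, hc⟩ := hC.exists_couplingBound
  obtain ⟨K, hK, hgrow⟩ := IsCascade.exists_levelEnergy_le_initial A.isSymmetric_invSqrt hc
    zero_le_one hT0.le (Fin.last m)
  obtain ⟨K', hK', hsource⟩ := IsCascade.exists_source_le_initial A.isSymmetric_invSqrt hc
    hT0.le (Fin.last m)
  obtain ⟨D, hD, hadm⟩ := hadm.waveAdmissible T hT0
  obtain ⟨d, hd, hobs⟩ := hobs.exists_levelEnergy_le hT
  refine isNullControllable_of_observable (A.exists_isCascade C) _ 0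
    (c := D * (K + K + T * K + T * K') + ((m + 1 : ℕ) : ℝ) * d) hT0.le (by positivity)
    (fun p q h => ?_) (fun p q h => ?_)
  · set N := ‖weakState A.invSqrt m 0 (fun j => p j 0, fun j => q j 0)‖ ^ 2
    have hN : 0 ≤ N := by positivity
    have h' := h.mono (subset_univ (Icc 0 T))
    obtain ⟨f, hf, hfle⟩ := hsource p q h'
    have h1 : ∀ t ∈ Icc 0 T,
        waveEnergy A.invSqrt (p (Fin.last m)) (q (Fin.last m)) t ≤ K * N := fun t ht => by
      have h2 := hgrow p q h' t ht
      rw [Fin.val_last, Nat.sub_self, zero_add] at h2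
      refine le_trans ?_ h2
      unfold waveEnergy levelEnergy
      rw [zero_add, pow_one]
      exact half_le_self (by positivity)
    have h2 : ∫ t in (0 : ℝ)..T, waveEnergy A.invSqrt (p (Fin.last m)) (q (Fin.last m)) t ≤
        ∫ t in (0 : ℝ)..T, K * N :=
      intervalIntegral.integral_mono_on hT0.le
        (hf.continuousOn_waveEnergy.intervalIntegrable_of_Icc hT0.le)
        (continuous_const.intervalIntegrable _ _) h1
    have h3 : ∫ t in (0 : ℝ)..T, ‖f t‖ ^ 2 ≤ ∫ t in (0 : ℝ)..T, K' * N :=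
      intervalIntegral.integral_mono_on hT0.le
        ((hf.continuousOn_source.norm.pow 2).intervalIntegrable_of_Icc hT0.le)
        (continuous_const.intervalIntegrable _ _) fun t ht => by
          have h4 := hfle t ht
          rw [Fin.val_last, Nat.sub_self, pow_zero] at h4
          exact h4
    rw [intervalIntegral.integral_const, smul_eq_mul, sub_zero] at h2 h3
    refine (hadm _ _ _ hf).trans ?_
    have h4 := add_le_add (add_le_add (add_le_add (h1 0 (left_mem_Icc.2 hT0.le))
      (h1 T (right_mem_Icc.2 hT0.le))) h2) h3
    have h5 := mul_le_mul_of_nonneg_left h4 hD.le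
    have h6 : 0 ≤ ((m + 1 : ℕ) : ℝ) * d * N := by positivity
    linarith
  · set O := ∫ t in (0 : ℝ)..T, ‖Bstar ((A.halfPow 2).symm (p (Fin.last m) t))‖ ^ 2
    have hO : 0 ≤ O := intervalIntegral.integral_nonneg hT0.le fun _ _ => by positivity
    rw [norm_weakState_sq]
    refine (Finset.sum_le_sum fun (j : Fin (m + 1)) _ => (show levelEnergy A.invSqrt (m - (j : ℕ) + 0) (p j 0)
      (q j 0) ≤ d * O from hobs p q h j)).trans ?_
    rw [Finset.sum_const, Finset.card_univ, Fintype.card_fin, nsmul_eq_mul]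
    have h3 : 0 ≤ D * (K + K + T * K + T * K') * O := by positivity
    linarith

end Controllability

end Cascade

theorem theorem2p23 {𝕜 : Type} {H G : Type*} [RCLike 𝕜]
    [NormedAddCommGroup H] [InnerProductSpace 𝕜 H] [CompleteSpace H]
    [NormedSpace ℝ H] [IsScalarTower ℝ 𝕜 H]
    [NormedAddCommGroup G] [InnerProductSpace 𝕜 G] [CompleteSpace G]
    (A : Cascade.CoerciveOperator 𝕜 H)
    -- the number of equations is `n = m + 1 ≥ 2`
    (m : ℕ) (hm : 1 ≤ m) (C P : Fin m → H →L[𝕜] H)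
    (hC : Cascade.CouplingAssumption A C P)
    (hP : ∀ j, Cascade.VelocityObservable A (P j)) :
    -- bounded control operator `B ∈ 𝓛(G; H)`, observation `(w, w') ↦ B^* w'`
    (∀ B : G →L[𝕜] H,
      Cascade.IsAdmissible A (Cascade.velocityObs A B) → Cascade.IsObservable A (Cascade.velocityObs A B) →
        (∃ Tstar, Cascade.IsObservabilityTime A C (Cascade.velocityObs A B) Tstar) ∧
        ∀ Tstar, Cascade.IsObservabilityTime A C (Cascade.velocityObs A B) Tstar → ∀ T > Tstar,
          Cascade.IsNullControllable A C (ContinuousLinearMap.adjoint B ∘L A.emb 2) 1 T) ∧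
    -- unbounded control operator `B ∈ 𝓛(G; H_2')`, observation `(w, w') ↦ B^* w`
    (∀ Bstar : A.Sob 2 →L[𝕜] G,
      Cascade.IsAdmissible A (Cascade.positionObs A Bstar) → Cascade.IsObservable A (Cascade.positionObs A Bstar) →
        (∃ Tstar, Cascade.IsObservabilityTime A C (Cascade.positionObs A Bstar) Tstar) ∧
        ∀ Tstar, Cascade.IsObservabilityTime A C (Cascade.positionObs A Bstar) Tstar → ∀ T > Tstar,
          Cascade.IsNullControllable A C Bstar 0 T) := by
  refine ⟨fun B hadm hobs => ⟨Cascade.exists_isObservabilityTime hC hP hadm hobs,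
    fun Tstar h T hT => Cascade.isNullControllable_velocity hC B h hT⟩, fun Bstar hadm hobs =>
    ⟨Cascade.exists_isObservabilityTime hC hP hadm hobs,
    fun Tstar h T hT => Cascade.isNullControllable_position hC Bstar hadm h hT⟩⟩
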